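/- Let $\mathbb{K}$ be a commutative ring. Graded $\mathbb{K}$-modules are $\mathbb{N}$-graded, differentials have degree $-1$, and the usual sign rule applies. A (graded) $\Sigma_*$-module is a sequence $M(n)$, $n\ge 0$, of graded $\mathbb{K}$-modules with an action of the symmetric group $\Sigma_n$ on $M(n)$. Let $F(M)$ be the free graded (symmetric, unital) operad on $M$, with its splitting $F(M)=\bigoplus_{r\ge 0}F_{(r)}(M)$, where $F_{(r)}(M)$ is spanned by the composites of $r$ generators, and let $\tilde F(M)=\bigoplus_{r\ge 1}F_{(r)}(M)$ be its augmentation ideal. The indecomposable quotient of $F(M)$ is the quotient of $\tilde F(M)$ by the $\Sigma_*$-submodule generated by the partial composites $p\circ_i q$ with $p,q\in\tilde F(M)$; the inclusion of the generators $M=F_{(1)}(M)\subset\tilde F(M)$ identifies it with $M$. A quasi-free operad $P=F(M)$ is a dg-operad whose underlying graded operad is $F(M)$, i.e. $F(M)$ equipped with an operad derivation $\delta$ of degree $-1$, commuting with the symmetric groups, with $\delta^2=0$ (in general $\delta$ is not induced by a differential of $M$). **Theorem.** Let $P=F(M)$ and $P'=F(M')$ be quasi-free operads over $\mathbb{K}$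 such that $M(0)=M(1)=0$ and $M'(0)=M'(1)=0$. If $\mathbb{K}$ is not a field, assume in addition that $M$ and $M'$ are projective as $\mathbb{K}$-modules, i.e. that all the modules $M(n)_d$ and $M'(n)_d$ are projective over $\mathbb{K}$. Let $\phi:P\to P'$ be a morphism of dg-operads which preserves augmentation ideals, $\phi(\tilde F(M))\subset\tilde F(M')$. Under the identification of $M$ and $M'$ with the indecomposable quotients of $P$ and $P'$, the differentials of $P$ and $P'$ induce differentials on $M$ and $M'$, and $\phi$ induces a morphism of dg-$\Sigma_*$-modules $\bar\phi:M\to M'$. Then $\phi:P\to P'$ is a quasi-isomorphism (i.e. $\phi:P(n)\to P'(n)$ induces an isomorphism in homology for all $n$) if and only if $\bar\phi:M\to M'$ is a quasi-isomorphism (i.e. $\bar\phi:M(n)\to M'(n)$ induces an isomorphism in homology for all $n$). -/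

import Mathlib

open CategoryTheory

universe u v w

/-! Sigma-modules, operads and dg-operads over a commutative ring. -/

/-- A graded `Σ_*`-module over `K`: for every arity `n` and every degree `d : ℕ` a `K`-module
`X n d`, with a `K`-linear left action of the symmetric group on `n` letters. -/
structure GradedSigmaModule (K : Type u) [CommRing K] where
  X : ℕ → ℕ → Type v
  [instAddCommGroup : ∀ n d, AddCommGroup (X n d)]
  [instModule : ∀ n d, Module K (X n d)]
  ρ : ∀ n d, Representation K (Equiv.Perm (Fin n)) (X n d)

attribute [instance] GradedSigmaModule.instAddCommGroup GradedSigmaModule.instModule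

/-- The conditions `M(0) = 0` and `M(1) = 0`. -/
structure GradedSigmaModule.IsReduced {K : Type u} [CommRing K]
    (M : GradedSigmaModule.{u, v} K) : Prop where
  arity_zero : ∀ d, Subsingleton (M.X 0 d)
  arity_one : ∀ d, Subsingleton (M.X 1 d)

/-- The place of an input in a partial composite `p ∘_i q` of an operation `p` with `m` inputs and
an operation `q` with `n` inputs: the input `j` of `q` becomes the input `i + j`, the inputs `a < i`
of `p` are fixed, and the inputs `a > i` of `p` are shifted by `n - 1` (inputs are counted
from `0`). -/
def insertFun {m n k : ℕ} (i : Fin m) (hk : m + n = k + 1) :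
    {a : Fin m // a ≠ i} ⊕ Fin n → Fin k
  | Sum.inl a => ⟨if a.1 < i then (a.1 : ℕ) else (a.1 : ℕ) + n - 1, by
      have h1 := a.1.2
      have h2 := i.2
      have h3 : (a.1 : ℕ) ≠ i := fun h => a.2 (Fin.ext h)
      split_ifs with h
      · have : (a.1 : ℕ) < i := h
        omega
      · omega⟩
  | Sum.inr j => ⟨(i : ℕ) + j, by omega⟩

theorem insertFun_bijective {m n k : ℕ} (i : Fin m) (hk : m + n = k + 1) :
    Function.Bijective (insertFun i hk : {a : Fin m // a ≠ i} ⊕ Fin n → Fin k) := by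
  rw [Fintype.bijective_iff_injective_and_card]
  constructor
  · rintro (⟨a, ha⟩ | a) (⟨b, hb⟩ | b) h
    all_goals
      simp only [insertFun, Fin.mk.injEq, Fin.lt_def] at h
    · have ha' : (a : ℕ) ≠ i := fun h => ha (Fin.ext h)
      have hb' : (b : ℕ) ≠ i := fun h => hb (Fin.ext h)
      have : a = b := by
        apply Fin.ext
        split_ifs at h <;> omega
      subst this
      rfl
    · have ha' : (a : ℕ) ≠ i := fun h => ha (Fin.ext h)
      have := b.2
      split_ifs at h <;> omega
    · have hb' : (b : ℕ) ≠ i := fun h => hb (Fin.ext h)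
      have := a.2
      split_ifs at h <;> omega
    · have : a = b := Fin.ext (by omega)
      rw [this]
  · have := i.2
    simp [Fintype.card_subtype_compl]
    omega

/-- The identification of the inputs of `p ∘_i q` with the inputs of `p` other than `i` and the
inputs of `q`. -/
noncomputable def insertEquiv {m n k : ℕ} (i : Fin m) (hk : m + n = k + 1) :
    {a : Fin m // a ≠ i} ⊕ Fin n ≃ Fin k :=
  Equiv.ofBijective _ (insertFun_bijective i hk)

/-- The partial composite of permutations: it sends the place of an input of `p ∘_i q` to the place
of the corresponding input of `(σ p) ∘_{σ i} (τ q)`. -/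
noncomputable def permCirc {m n k : ℕ} (σ : Equiv.Perm (Fin m)) (i : Fin m)
    (τ : Equiv.Perm (Fin n)) (hk : m + n = k + 1) : Equiv.Perm (Fin k) :=
  (insertEquiv i hk).symm.trans
    ((Equiv.sumCongr
      (σ.subtypeEquiv (p := fun a => a ≠ i) (q := fun a => a ≠ σ i) (fun a => by simp)) τ).trans
      (insertEquiv (σ i) hk))

theorem permCirc_inl {m n k : ℕ} (σ : Equiv.Perm (Fin m)) (i : Fin m)
    (τ : Equiv.Perm (Fin n)) (hk : m + n = k + 1) (a : {a : Fin m // a ≠ i}) :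
    permCirc σ i τ hk (insertEquiv i hk (Sum.inl a)) =
      insertEquiv (σ i) hk (Sum.inl ⟨σ a, fun h => a.2 (σ.injective h)⟩) := by
  simp only [permCirc, Equiv.trans_apply, Equiv.symm_apply_apply]
  rfl

theorem permCirc_inr {m n k : ℕ} (σ : Equiv.Perm (Fin m)) (i : Fin m)
    (τ : Equiv.Perm (Fin n)) (hk : m + n = k + 1) (j : Fin n) :
    permCirc σ i τ hk (insertEquiv i hk (Sum.inr j)) = insertEquiv (σ i) hk (Sum.inr (τ j)) := by
  simp only [permCirc, Equiv.trans_apply, Equiv.symm_apply_apply]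
  rfl

/-- A graded operad, given by its partial composition products
`circ i : P(m)_a ⊗ P(n)_b → P(m+n-1)_{a+b}`. The target indices `k = m + n - 1` and `c = a + b`
are free variables tied by equations. Inputs are counted from `0`. -/
structure GradedOperad (K : Type u) [CommRing K] extends GradedSigmaModule.{u, v} K where
  one : X 1 0
  circ : ∀ {m n k a b c : ℕ} (i : Fin m), m + n = k + 1 → a + b = c →
    (X m a →ₗ[K] X n b →ₗ[K] X k c)
  one_circ : ∀ {n b : ℕ} (i : Fin 1) (hk : 1 + n = n + 1) (hc : 0 + b = b) (q : X n b),
    circ i hk hc one q = q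
  circ_one : ∀ {m a : ℕ} (i : Fin m) (hk : m + 1 = m + 1) (hc : a + 0 = a) (p : X m a),
    circ i hk hc p one = p
  circ_assoc : ∀ {m n s k l t a b c e f g : ℕ} (i : Fin m) (j : Fin n) (j' : Fin k)
    (_ : (j' : ℕ) = i + j)
    (hk : m + n = k + 1) (ht : k + s = t + 1) (hl : n + s = l + 1) (ht' : m + l = t + 1)
    (he : a + b = e) (hg : e + c = g) (hf : b + c = f) (hg' : a + f = g)
    (p : X m a) (q : X n b) (r : X s c),
    circ j' ht hg (circ i hk he p q) r = circ i ht' hg' p (circ j hl hf q r)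
  circ_comm : ∀ {m n₁ n₂ k₁ k₂ t a b₁ b₂ e₁ e₂ g : ℕ} (i₁ i₂ : Fin m) (_ : i₁ < i₂)
    (i₂' : Fin k₁) (_ : (i₂' : ℕ) + 1 = i₂ + n₁) (i₁' : Fin k₂) (_ : (i₁' : ℕ) = i₁)
    (hk₁ : m + n₁ = k₁ + 1) (ht₁ : k₁ + n₂ = t + 1)
    (hk₂ : m + n₂ = k₂ + 1) (ht₂ : k₂ + n₁ = t + 1)
    (he₁ : a + b₁ = e₁) (hg₁ : e₁ + b₂ = g) (he₂ : a + b₂ = e₂) (hg₂ : e₂ + b₁ = g)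
    (p : X m a) (q₁ : X n₁ b₁) (q₂ : X n₂ b₂),
    circ i₂' ht₁ hg₁ (circ i₁ hk₁ he₁ p q₁) q₂ =
      (-1 : K) ^ (b₁ * b₂) • circ i₁' ht₂ hg₂ (circ i₂ hk₂ he₂ p q₂) q₁
  circ_equivariant : ∀ {m n k a b c : ℕ} (i : Fin m) (hk : m + n = k + 1) (hc : a + b = c)
    (σ : Equiv.Perm (Fin m)) (τ : Equiv.Perm (Fin n)) (p : X m a) (q : X n b),
    circ (σ i) hk hc (ρ m a σ p) (ρ n b τ q) = ρ k c (permCirc σ i τ hk) (circ i hk hc p q)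

/-- A morphism of graded `Σ_*`-modules (homogeneous of degree `0`). -/
structure GradedSigmaModule.Hom {K : Type u} [CommRing K] (M : GradedSigmaModule.{u, v} K)
    (N : GradedSigmaModule.{u, w} K) where
  app : ∀ n d, M.X n d →ₗ[K] N.X n d
  map_ρ : ∀ n d (σ : Equiv.Perm (Fin n)) (x : M.X n d),
    app n d (M.ρ n d σ x) = N.ρ n d σ (app n d x)

/-- A morphism of graded operads. -/
structure GradedOperad.Hom {K : Type u} [CommRing K] (P : GradedOperad.{u, v} K)
    (Q : GradedOperad.{u, w} K) extends
    toSigmaHom : GradedSigmaModule.Hom P.toGradedSigmaModule Q.toGradedSigmaModule where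
  map_one : app 1 0 P.one = Q.one
  map_circ : ∀ {m n k a b c : ℕ} (i : Fin m) (hk : m + n = k + 1) (hc : a + b = c)
    (p : P.X m a) (q : P.X n b),
    app k c (P.circ i hk hc p q) = Q.circ i hk hc (app m a p) (app n b q)

/-- A differential on a graded operad: an operad derivation of degree `-1` with square zero which
commutes with the symmetric groups. Since degrees are natural numbers, the derivation relation
`δ(p ∘_i q) = δ(p) ∘_i q + (-1)^|p| p ∘_i δ(q)` is split according to whether `p` or `q` is of
degree `0` (where `δ` vanishes). -/
structure GradedOperad.Differential {K : Type u} [CommRing K] (P : GradedOperad.{u, v} K) where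
  d : ∀ n a, P.X n (a + 1) →ₗ[K] P.X n a
  d_d : ∀ n a (x : P.X n (a + 1 + 1)), d n a (d n (a + 1) x) = 0
  d_ρ : ∀ n a (σ : Equiv.Perm (Fin n)) (x : P.X n (a + 1)),
    d n a (P.ρ n (a + 1) σ x) = P.ρ n a σ (d n a x)
  d_circ : ∀ {m n k a b c : ℕ} (i : Fin m) (hk : m + n = k + 1)
    (h : (a + 1) + (b + 1) = c + 1) (h₁ : a + (b + 1) = c) (h₂ : (a + 1) + b = c)
    (p : P.X m (a + 1)) (q : P.X n (b + 1)),
    d k c (P.circ i hk h p q) =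
      P.circ i hk h₁ (d m a p) q + (-1 : K) ^ (a + 1) • P.circ i hk h₂ p (d n b q)
  d_circ_left : ∀ {m n k a : ℕ} (i : Fin m) (hk : m + n = k + 1)
    (h : (a + 1) + 0 = a + 1) (h₁ : a + 0 = a) (p : P.X m (a + 1)) (q : P.X n 0),
    d k a (P.circ i hk h p q) = P.circ i hk h₁ (d m a p) q
  d_circ_right : ∀ {m n k b : ℕ} (i : Fin m) (hk : m + n = k + 1)
    (h : 0 + (b + 1) = b + 1) (h₂ : 0 + b = b) (p : P.X m 0) (q : P.X n (b + 1)),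
    d k b (P.circ i hk h p q) = P.circ i hk h₂ p (d n b q)

/-- A dg-operad: a graded operad with a differential. -/
structure DGOperad (K : Type u) [CommRing K] where
  toGradedOperad : GradedOperad.{u, v} K
  diff : toGradedOperad.Differential

/-- The chain complex `P(n)` underlying a dg-operad in arity `n`. -/
noncomputable def DGOperad.complex {K : Type u} [CommRing K] (P : DGOperad.{u, v} K) (n : ℕ) :
    ChainComplex (ModuleCat.{v} K) ℕ :=
  ChainComplex.of (fun d => ModuleCat.of K (P.toGradedOperad.X n d))
    (fun d => ModuleCat.ofHom (P.diff.d n d))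
    (fun d => by
      ext x
      exact P.diff.d_d n d x)

/-- A morphism of dg-operads. -/
structure DGOperad.Hom {K : Type u} [CommRing K] (P : DGOperad.{u, v} K)
    (Q : DGOperad.{u, w} K) extends
    toOperadHom : GradedOperad.Hom P.toGradedOperad Q.toGradedOperad where
  map_d : ∀ n a (x : P.toGradedOperad.X n (a + 1)),
    app n a (P.diff.d n a x) = Q.diff.d n a (app n (a + 1) x)

/-- The chain map `P(n) → Q(n)` underlying a morphism of dg-operads. -/
noncomputable def DGOperad.Hom.chainMap {K : Type u} [CommRing K] {P Q : DGOperad.{u, v} K}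
    (φ : DGOperad.Hom P Q) (n : ℕ) : P.complex n ⟶ Q.complex n :=
  ChainComplex.ofHom (fun d => ModuleCat.ofHom (φ.app n d))
    (fun d => by
      simp only [DGOperad.complex, ChainComplex.of_d]
      ext x
      exact (φ.map_d n d x).symm)

/-- A quasi-isomorphism of dg-operads: an isomorphism in homology in each arity. -/
def DGOperad.Hom.IsQuasiIso {K : Type u} [CommRing K] {P Q : DGOperad.{u, v} K}
    (φ : DGOperad.Hom P Q) : Prop :=
  ∀ n, QuasiIso (φ.chainMap n)

/-! The free graded operad on a graded `Σ_*`-module, built from formal expressions modulo the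
axioms of operads. -/

namespace FreeOperad

/-- Formal operadic expressions of arity `n` and degree `d` in the elements of `M`. -/
inductive Term {K : Type u} [CommRing K] (M : GradedSigmaModule.{u, v} K) :
    ℕ → ℕ → Type (max u v)
  | zero {n d : ℕ} : Term M n d
  | add {n d : ℕ} (p q : Term M n d) : Term M n d
  | smul {n d : ℕ} (c : K) (p : Term M n d) : Term M n d
  | act {n d : ℕ} (σ : Equiv.Perm (Fin n)) (p : Term M n d) : Term M n d
  | gen {n d : ℕ} (x : M.X n d) : Term M n d
  | one : Term M 1 0
  | circ {m n k a b c : ℕ} (i : Fin m) (hk : m + n = k + 1) (hc : a + b = c)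
      (p : Term M m a) (q : Term M n b) : Term M k c

open Term in
/-- The congruence on formal expressions generated by the axioms of `K`-modules, of linear actions
of symmetric groups and of operads, and by the relations which make the inclusion of the generators
a morphism of `Σ_*`-modules. -/
inductive Rel {K : Type u} [CommRing K] (M : GradedSigmaModule.{u, v} K) :
    ∀ {n d : ℕ}, Term M n d → Term M n d → Prop
  | refl {n d : ℕ} (p : Term M n d) : Rel M p p
  | symm {n d : ℕ} {p q : Term M n d} : Rel M p q → Rel M q p
  | trans {n d : ℕ} {p q r : Term M n d} : Rel M p q → Rel M q r → Rel M p r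
  | add_congr {n d : ℕ} {p p' q q' : Term M n d} :
      Rel M p p' → Rel M q q' → Rel M (add p q) (add p' q')
  | smul_congr {n d : ℕ} (c : K) {p p' : Term M n d} : Rel M p p' → Rel M (smul c p) (smul c p')
  | act_congr {n d : ℕ} (σ : Equiv.Perm (Fin n)) {p p' : Term M n d} :
      Rel M p p' → Rel M (act σ p) (act σ p')
  | circ_congr {m n k a b c : ℕ} (i : Fin m) (hk : m + n = k + 1) (hc : a + b = c)
      {p p' : Term M m a} {q q' : Term M n b} :
      Rel M p p' → Rel M q q' → Rel M (circ i hk hc p q) (circ i hk hc p' q')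
  | add_assoc {n d : ℕ} (p q r : Term M n d) : Rel M (add (add p q) r) (add p (add q r))
  | add_comm {n d : ℕ} (p q : Term M n d) : Rel M (add p q) (add q p)
  | zero_add {n d : ℕ} (p : Term M n d) : Rel M (add zero p) p
  | smul_add {n d : ℕ} (c : K) (p q : Term M n d) :
      Rel M (smul c (add p q)) (add (smul c p) (smul c q))
  | add_smul {n d : ℕ} (c c' : K) (p : Term M n d) :
      Rel M (smul (c + c') p) (add (smul c p) (smul c' p))
  | mul_smul {n d : ℕ} (c c' : K) (p : Term M n d) : Rel M (smul (c * c') p) (smul c (smul c' p))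
  | one_smul {n d : ℕ} (p : Term M n d) : Rel M (smul 1 p) p
  | zero_smul {n d : ℕ} (p : Term M n d) : Rel M (smul 0 p) zero
  | act_add {n d : ℕ} (σ : Equiv.Perm (Fin n)) (p q : Term M n d) :
      Rel M (act σ (add p q)) (add (act σ p) (act σ q))
  | act_smul {n d : ℕ} (σ : Equiv.Perm (Fin n)) (c : K) (p : Term M n d) :
      Rel M (act σ (smul c p)) (smul c (act σ p))
  | act_one {n d : ℕ} (p : Term M n d) : Rel M (act 1 p) p
  | act_mul {n d : ℕ} (σ τ : Equiv.Perm (Fin n)) (p : Term M n d) :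
      Rel M (act (σ * τ) p) (act σ (act τ p))
  | gen_add {n d : ℕ} (x y : M.X n d) : Rel M (gen (x + y)) (add (gen x) (gen y))
  | gen_smul {n d : ℕ} (c : K) (x : M.X n d) : Rel M (gen (c • x)) (smul c (gen x))
  | gen_act {n d : ℕ} (σ : Equiv.Perm (Fin n)) (x : M.X n d) :
      Rel M (gen (M.ρ n d σ x)) (act σ (gen x))
  | circ_add_left {m n k a b c : ℕ} (i : Fin m) (hk : m + n = k + 1) (hc : a + b = c)
      (p p' : Term M m a) (q : Term M n b) :
      Rel M (circ i hk hc (add p p') q) (add (circ i hk hc p q) (circ i hk hc p' q))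
  | circ_smul_left {m n k a b c : ℕ} (i : Fin m) (hk : m + n = k + 1) (hc : a + b = c)
      (s : K) (p : Term M m a) (q : Term M n b) :
      Rel M (circ i hk hc (smul s p) q) (smul s (circ i hk hc p q))
  | circ_add_right {m n k a b c : ℕ} (i : Fin m) (hk : m + n = k + 1) (hc : a + b = c)
      (p : Term M m a) (q q' : Term M n b) :
      Rel M (circ i hk hc p (add q q')) (add (circ i hk hc p q) (circ i hk hc p q'))
  | circ_smul_right {m n k a b c : ℕ} (i : Fin m) (hk : m + n = k + 1) (hc : a + b = c)
      (s : K) (p : Term M m a) (q : Term M n b) :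
      Rel M (circ i hk hc p (smul s q)) (smul s (circ i hk hc p q))
  | one_circ {n b : ℕ} (i : Fin 1) (hk : 1 + n = n + 1) (hc : 0 + b = b) (q : Term M n b) :
      Rel M (circ i hk hc one q) q
  | circ_one {m a : ℕ} (i : Fin m) (hk : m + 1 = m + 1) (hc : a + 0 = a) (p : Term M m a) :
      Rel M (circ i hk hc p one) p
  | circ_assoc {m n s k l t a b c e f g : ℕ} (i : Fin m) (j : Fin n) (j' : Fin k)
      (hj : (j' : ℕ) = i + j)
      (hk : m + n = k + 1) (ht : k + s = t + 1) (hl : n + s = l + 1) (ht' : m + l = t + 1)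
      (he : a + b = e) (hg : e + c = g) (hf : b + c = f) (hg' : a + f = g)
      (p : Term M m a) (q : Term M n b) (r : Term M s c) :
      Rel M (circ j' ht hg (circ i hk he p q) r) (circ i ht' hg' p (circ j hl hf q r))
  | circ_comm {m n₁ n₂ k₁ k₂ t a b₁ b₂ e₁ e₂ g : ℕ} (i₁ i₂ : Fin m) (hi : i₁ < i₂)
      (i₂' : Fin k₁) (hi₂ : (i₂' : ℕ) + 1 = i₂ + n₁) (i₁' : Fin k₂) (hi₁ : (i₁' : ℕ) = i₁)
      (hk₁ : m + n₁ = k₁ + 1) (ht₁ : k₁ + n₂ = t + 1)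
      (hk₂ : m + n₂ = k₂ + 1) (ht₂ : k₂ + n₁ = t + 1)
      (he₁ : a + b₁ = e₁) (hg₁ : e₁ + b₂ = g) (he₂ : a + b₂ = e₂) (hg₂ : e₂ + b₁ = g)
      (p : Term M m a) (q₁ : Term M n₁ b₁) (q₂ : Term M n₂ b₂) :
      Rel M (circ i₂' ht₁ hg₁ (circ i₁ hk₁ he₁ p q₁) q₂)
        (smul ((-1 : K) ^ (b₁ * b₂)) (circ i₁' ht₂ hg₂ (circ i₂ hk₂ he₂ p q₂) q₁))
  | circ_equivariant {m n k a b c : ℕ} (i : Fin m) (hk : m + n = k + 1) (hc : a + b = c)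
      (σ : Equiv.Perm (Fin m)) (τ : Equiv.Perm (Fin n)) (p : Term M m a) (q : Term M n b) :
      Rel M (circ (σ i) hk hc (act σ p) (act τ q)) (act (permCirc σ i τ hk) (circ i hk hc p q))

variable {K : Type u} [CommRing K] (M : GradedSigmaModule.{u, v} K)

/-- Equality of formal expressions in the free operad. -/
def termSetoid (n d : ℕ) : Setoid (Term M n d) where
  r := Rel M
  iseqv := ⟨Rel.refl, Rel.symm, Rel.trans⟩

/-- The component `F(M)(n)_d` of the free operad. -/
def Carrier (n d : ℕ) : Type (max u v) := Quotient (termSetoid M n d)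

variable {M}

/-- The class of a formal expression. -/
def mk {n d : ℕ} (p : Term M n d) : Carrier M n d := Quotient.mk (termSetoid M n d) p

theorem sound {n d : ℕ} {p q : Term M n d} (h : Rel M p q) : mk p = mk q :=
  Quotient.sound (s := termSetoid M n d) h

theorem mk_surj {n d : ℕ} (x : Carrier M n d) : ∃ p : Term M n d, mk p = x :=
  Quotient.exists_rep x

instance (n d : ℕ) : Zero (Carrier M n d) := ⟨mk Term.zero⟩

instance (n d : ℕ) : Add (Carrier M n d) :=
  ⟨Quotient.map₂ Term.add (fun _ _ h _ _ h' => Rel.add_congr h h')⟩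

instance (n d : ℕ) : SMul K (Carrier M n d) :=
  ⟨fun c => Quotient.map (Term.smul c) (fun _ _ h => Rel.smul_congr c h)⟩

instance (n d : ℕ) : Neg (Carrier M n d) := ⟨fun x => (-1 : K) • x⟩

theorem mk_add {n d : ℕ} (p q : Term M n d) : mk (Term.add p q) = mk p + mk q := rfl

theorem mk_smul {n d : ℕ} (c : K) (p : Term M n d) : mk (Term.smul c p) = c • mk p := rfl

theorem mk_zero {n d : ℕ} : mk (Term.zero : Term M n d) = 0 := rfl

instance (n d : ℕ) : AddCommGroup (Carrier M n d) where
  add_assoc x y z := by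
    obtain ⟨p, rfl⟩ := mk_surj x
    obtain ⟨q, rfl⟩ := mk_surj y
    obtain ⟨r, rfl⟩ := mk_surj z
    exact sound (Rel.add_assoc p q r)
  zero_add x := by
    obtain ⟨p, rfl⟩ := mk_surj x
    exact sound (Rel.zero_add p)
  add_zero x := by
    obtain ⟨p, rfl⟩ := mk_surj x
    exact (sound (Rel.add_comm p Term.zero)).trans (sound (Rel.zero_add p))
  add_comm x y := by
    obtain ⟨p, rfl⟩ := mk_surj x
    obtain ⟨q, rfl⟩ := mk_surj y
    exact sound (Rel.add_comm p q)
  neg_add_cancel x := by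
    obtain ⟨p, rfl⟩ := mk_surj x
    change mk (Term.add (Term.smul (-1) p) p) = mk Term.zero
    rw [← sound (Rel.add_congr (Rel.refl (Term.smul (-1) p)) (Rel.one_smul p)),
      ← sound (Rel.add_smul _ _ _), neg_add_cancel]
    exact sound (Rel.zero_smul p)
  nsmul := nsmulRec
  zsmul := zsmulRec

instance (n d : ℕ) : Module K (Carrier M n d) where
  one_smul x := by
    obtain ⟨p, rfl⟩ := mk_surj x
    exact sound (Rel.one_smul p)
  mul_smul c c' x := by
    obtain ⟨p, rfl⟩ := mk_surj x
    exact sound (Rel.mul_smul c c' p)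
  smul_zero c := by
    have h : (0 : Carrier M n d) = (0 : K) • (0 : Carrier M n d) :=
      (sound (Rel.zero_smul Term.zero)).symm
    change mk (Term.smul c Term.zero) = mk Term.zero
    rw [← sound (Rel.smul_congr c (Rel.zero_smul Term.zero)), ← sound (Rel.mul_smul c 0 _),
      mul_zero, sound (Rel.zero_smul _)]
  smul_add c x y := by
    obtain ⟨p, rfl⟩ := mk_surj x
    obtain ⟨q, rfl⟩ := mk_surj y
    exact sound (Rel.smul_add c p q)
  add_smul c c' x := by
    obtain ⟨p, rfl⟩ := mk_surj x
    exact sound (Rel.add_smul c c' p)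
  zero_smul x := by
    obtain ⟨p, rfl⟩ := mk_surj x
    exact sound (Rel.zero_smul p)

/-- The action of a permutation on the free operad. -/
def actMap {n d : ℕ} (σ : Equiv.Perm (Fin n)) : Carrier M n d →ₗ[K] Carrier M n d where
  toFun := Quotient.map (Term.act σ) (fun _ _ h => Rel.act_congr σ h)
  map_add' x y := by
    obtain ⟨p, rfl⟩ := mk_surj x
    obtain ⟨q, rfl⟩ := mk_surj y
    exact sound (Rel.act_add σ p q)
  map_smul' c x := by
    obtain ⟨p, rfl⟩ := mk_surj x
    exact sound (Rel.act_smul σ c p)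

/-- The partial composition products of the free operad. -/
def circMap {m n k a b c : ℕ} (i : Fin m) (hk : m + n = k + 1) (hc : a + b = c) :
    Carrier M m a →ₗ[K] Carrier M n b →ₗ[K] Carrier M k c :=
  LinearMap.mk₂ K
    (Quotient.map₂ (Term.circ i hk hc) (fun _ _ h _ _ h' => Rel.circ_congr i hk hc h h'))
    (fun x y z => by
      obtain ⟨p, rfl⟩ := mk_surj x
      obtain ⟨q, rfl⟩ := mk_surj y
      obtain ⟨r, rfl⟩ := mk_surj z
      exact sound (Rel.circ_add_left i hk hc p q r))
    (fun s x y => by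
      obtain ⟨p, rfl⟩ := mk_surj x
      obtain ⟨q, rfl⟩ := mk_surj y
      exact sound (Rel.circ_smul_left i hk hc s p q))
    (fun x y z => by
      obtain ⟨p, rfl⟩ := mk_surj x
      obtain ⟨q, rfl⟩ := mk_surj y
      obtain ⟨r, rfl⟩ := mk_surj z
      exact sound (Rel.circ_add_right i hk hc p q r))
    (fun s x y => by
      obtain ⟨p, rfl⟩ := mk_surj x
      obtain ⟨q, rfl⟩ := mk_surj y
      exact sound (Rel.circ_smul_right i hk hc s p q))

end FreeOperad

open FreeOperad

section Free

variable {K : Type u} [CommRing K] (M : GradedSigmaModule.{u, v} K)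

/-- The free graded operad `F(M)` on a graded `Σ_*`-module `M`. -/
def freeOperad : GradedOperad.{u, max u v} K where
  X := Carrier M
  ρ n d :=
    { toFun := fun σ => actMap σ
      map_one' := by
        ext x
        obtain ⟨p, rfl⟩ := mk_surj x
        exact sound (Rel.act_one p)
      map_mul' := fun σ τ => by
        ext x
        obtain ⟨p, rfl⟩ := mk_surj x
        exact sound (Rel.act_mul σ τ p) }
  one := mk Term.one
  circ i hk hc := circMap i hk hc
  one_circ i hk hc x := by
    obtain ⟨p, rfl⟩ := mk_surj x
    exact sound (Rel.one_circ i hk hc p)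
  circ_one i hk hc x := by
    obtain ⟨p, rfl⟩ := mk_surj x
    exact sound (Rel.circ_one i hk hc p)
  circ_assoc i j j' hj hk ht hl ht' he hg hf hg' x y z := by
    obtain ⟨p, rfl⟩ := mk_surj x
    obtain ⟨q, rfl⟩ := mk_surj y
    obtain ⟨r, rfl⟩ := mk_surj z
    exact sound (Rel.circ_assoc i j j' hj hk ht hl ht' he hg hf hg' p q r)
  circ_comm i₁ i₂ hi i₂' hi₂ i₁' hi₁ hk₁ ht₁ hk₂ ht₂ he₁ hg₁ he₂ hg₂ x y z := by
    obtain ⟨p, rfl⟩ := mk_surj x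
    obtain ⟨q, rfl⟩ := mk_surj y
    obtain ⟨r, rfl⟩ := mk_surj z
    exact sound (Rel.circ_comm i₁ i₂ hi i₂' hi₂ i₁' hi₁ hk₁ ht₁ hk₂ ht₂ he₁ hg₁ he₂ hg₂ p q r)
  circ_equivariant i hk hc σ τ x y := by
    obtain ⟨p, rfl⟩ := mk_surj x
    obtain ⟨q, rfl⟩ := mk_surj y
    exact sound (Rel.circ_equivariant i hk hc σ τ p q)

/-- The universal morphism `M → F(M)`. -/
def freeGen : GradedSigmaModule.Hom M (freeOperad M).toGradedSigmaModule where
  app n d :=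
    { toFun := fun x => mk (Term.gen x)
      map_add' := fun x y => sound (Rel.gen_add x y)
      map_smul' := fun c x => sound (Rel.gen_smul c x) }
  map_ρ n d σ x := sound (Rel.gen_act σ x)

variable {M}

/-- Induction principle: `F(M)` is spanned by the composites of generators. -/
theorem freeOperad_induction {motive : ∀ n d, (freeOperad M).X n d → Prop}
    (zero : ∀ n d, motive n d 0)
    (add : ∀ n d p q, motive n d p → motive n d q → motive n d (p + q))
    (smul : ∀ n d (c : K) p, motive n d p → motive n d (c • p))
    (act : ∀ n d σ p, motive n d p → motive n d ((freeOperad M).ρ n d σ p))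
    (gen : ∀ n d x, motive n d ((freeGen M).app n d x))
    (one : motive 1 0 (freeOperad M).one)
    (circ : ∀ m n k a b c (i : Fin m) (hk : m + n = k + 1) (hc : a + b = c) p q,
      motive m a p → motive n b q → motive k c ((freeOperad M).circ i hk hc p q))
    (n d : ℕ) (p : (freeOperad M).X n d) : motive n d p := by
  obtain ⟨t, rfl⟩ := mk_surj p
  induction t with
  | zero => exact zero _ _
  | add p q hp hq => exact add _ _ _ _ hp hq
  | smul c p hp => exact smul _ _ c _ hp
  | act σ p hp => exact act _ _ σ _ hp
  | gen x => exact gen _ _ x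
  | one => exact one
  | circ i hk hc p q hp hq => exact circ _ _ _ _ _ _ i hk hc _ _ hp hq

/-- The value of a formal expression in an operad, once the generators have values. -/
def termValue {Q : GradedOperad.{u, w} K} (f : GradedSigmaModule.Hom M Q.toGradedSigmaModule) :
    ∀ {n d : ℕ}, Term M n d → Q.X n d
  | _, _, Term.zero => 0
  | _, _, Term.add p q => termValue f p + termValue f q
  | _, _, Term.smul c p => c • termValue f p
  | _, _, Term.act σ p => Q.ρ _ _ σ (termValue f p)
  | _, _, Term.gen x => f.app _ _ x
  | _, _, Term.one => Q.one
  | _, _, Term.circ i hk hc p q => Q.circ i hk hc (termValue f p) (termValue f q)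

theorem termValue_rel {Q : GradedOperad.{u, w} K}
    (f : GradedSigmaModule.Hom M Q.toGradedSigmaModule) {n d : ℕ} {p q : Term M n d}
    (h : Rel M p q) : termValue f p = termValue f q := by
  induction h with
  | refl => rfl
  | symm _ ih => exact ih.symm
  | trans _ _ ih ih' => exact ih.trans ih'
  | add_congr _ _ ih ih' => simp only [termValue, ih, ih']
  | smul_congr _ _ ih => simp only [termValue, ih]
  | act_congr _ _ ih => simp only [termValue, ih]
  | circ_congr _ _ _ _ _ ih ih' => simp only [termValue, ih, ih']
  | add_assoc => exact add_assoc _ _ _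
  | add_comm => exact add_comm _ _
  | zero_add => exact zero_add _
  | smul_add => exact smul_add _ _ _
  | add_smul => exact add_smul _ _ _
  | mul_smul => exact mul_smul _ _ _
  | one_smul => exact one_smul _ _
  | zero_smul => exact zero_smul _ _
  | act_add => exact map_add _ _ _
  | act_smul => exact map_smul _ _ _
  | act_one => simp [termValue]
  | act_mul => simp [termValue]
  | gen_add => exact map_add _ _ _
  | gen_smul => exact map_smul _ _ _
  | gen_act => exact f.map_ρ _ _ _ _
  | circ_add_left => simp [termValue]
  | circ_smul_left => simp [termValue]
  | circ_add_right => simp [termValue]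
  | circ_smul_right => simp [termValue]
  | one_circ => exact Q.one_circ _ _ _ _
  | circ_one => exact Q.circ_one _ _ _ _
  | circ_assoc i j j' hj => exact Q.circ_assoc i j j' hj _ _ _ _ _ _ _ _ _ _ _
  | circ_comm i₁ i₂ hi i₂' hi₂ i₁' hi₁ =>
    exact Q.circ_comm i₁ i₂ hi i₂' hi₂ i₁' hi₁ _ _ _ _ _ _ _ _ _ _ _
  | circ_equivariant => exact Q.circ_equivariant _ _ _ _ _ _ _

/-- The universal property of the free operad: the extension of a morphism of `Σ_*`-modules
`M → Q` to a morphism of operads `F(M) → Q`. -/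
def freeLift {Q : GradedOperad.{u, w} K} (f : GradedSigmaModule.Hom M Q.toGradedSigmaModule) :
    GradedOperad.Hom (freeOperad M) Q where
  app n d :=
    { toFun := Quotient.lift (termValue f) (fun _ _ h => termValue_rel f h)
      map_add' := fun x y => by
        obtain ⟨p, rfl⟩ := mk_surj x
        obtain ⟨q, rfl⟩ := mk_surj y
        rfl
      map_smul' := fun c x => by
        obtain ⟨p, rfl⟩ := mk_surj x
        rfl }
  map_ρ n d σ x := by
    obtain ⟨p, rfl⟩ := mk_surj x
    rfl
  map_one := rfl
  map_circ i hk hc x y := by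
    obtain ⟨p, rfl⟩ := mk_surj x
    obtain ⟨q, rfl⟩ := mk_surj y
    rfl

theorem freeLift_gen {Q : GradedOperad.{u, w} K}
    (f : GradedSigmaModule.Hom M Q.toGradedSigmaModule) {n d : ℕ} (x : M.X n d) :
    (freeLift f).app n d ((freeGen M).app n d x) = f.app n d x := rfl

/-- Uniqueness in the universal property of the free operad. -/
theorem freeLift_unique {Q : GradedOperad.{u, w} K}
    (f : GradedSigmaModule.Hom M Q.toGradedSigmaModule) (g : GradedOperad.Hom (freeOperad M) Q)
    (hg : ∀ n d x, g.app n d ((freeGen M).app n d x) = f.app n d x) (n d : ℕ)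
    (p : (freeOperad M).X n d) : g.app n d p = (freeLift f).app n d p := by
  refine freeOperad_induction (motive := fun n d p => g.app n d p = (freeLift f).app n d p)
    ?_ ?_ ?_ ?_ ?_ ?_ ?_ n d p
  · intro n d
    rw [map_zero, map_zero]
  · intro n d p q hp hq
    rw [map_add, map_add, hp, hq]
  · intro n d c p hp
    rw [map_smul, map_smul, hp]
  · intro n d σ p hp
    rw [g.map_ρ, (freeLift f).map_ρ, hp]
  · intro n d x
    rw [hg, freeLift_gen]
  · rw [g.map_one, (freeLift f).map_one]
  · intro m n k a b c i hk hc p q hp hq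
    rw [g.map_circ, (freeLift f).map_circ, hp, hq]

/-! The weight grading, the augmentation ideal and the indecomposable quotient of a free operad. -/

/-- `HasWeight r p`: the element `p` of `F(M)` is a linear combination of composites of `r`
generators (and their images under permutations). -/
inductive HasWeight : ∀ (r : ℕ) {n d : ℕ}, (freeOperad M).X n d → Prop
  | zero {r n d : ℕ} : HasWeight r (0 : (freeOperad M).X n d)
  | add {r n d : ℕ} {p q : (freeOperad M).X n d} :
      HasWeight r p → HasWeight r q → HasWeight r (p + q)
  | smul {r n d : ℕ} (c : K) {p : (freeOperad M).X n d} : HasWeight r p → HasWeight r (c • p)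
  | act {r n d : ℕ} (σ : Equiv.Perm (Fin n)) {p : (freeOperad M).X n d} :
      HasWeight r p → HasWeight r ((freeOperad M).ρ n d σ p)
  | one : HasWeight 0 (freeOperad M).one
  | gen {n d : ℕ} (x : M.X n d) : HasWeight 1 ((freeGen M).app n d x)
  | circ {r s m n k a b c : ℕ} (i : Fin m) (hk : m + n = k + 1) (hc : a + b = c)
      {p : (freeOperad M).X m a} {q : (freeOperad M).X n b} :
      HasWeight r p → HasWeight s q → HasWeight (r + s) ((freeOperad M).circ i hk hc p q)

variable (M)

/-- The component `F_(r)(M)(n)_d` of weight `r` of the free operad. -/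
def weightPart (r n d : ℕ) : Submodule K ((freeOperad M).X n d) where
  carrier := {p | HasWeight r p}
  zero_mem' := HasWeight.zero
  add_mem' := HasWeight.add
  smul_mem' c _ h := HasWeight.smul c h

/-- The augmentation ideal of the free operad: the sum of the components of weight `r ≥ 1`. -/
def augIdeal (n d : ℕ) : Submodule K ((freeOperad M).X n d) :=
  ⨆ (r : ℕ) (_ : 1 ≤ r), weightPart M r n d

/-- The decomposable elements of the free operad: the `Σ_*`-submodule generated by the partial
composites `p ∘_i q` of elements `p` and `q` of the augmentation ideal. -/
def decomposables (n d : ℕ) : Submodule K ((freeOperad M).X n d) :=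
  Submodule.span K {z | ∃ (m l a b : ℕ) (i : Fin m) (hk : m + l = n + 1) (hc : a + b = d)
    (σ : Equiv.Perm (Fin n)), ∃ p ∈ augIdeal M m a, ∃ q ∈ augIdeal M l b,
      z = (freeOperad M).ρ n d σ ((freeOperad M).circ i hk hc p q)}

/-- The indecomposable quotient of the free operad. -/
abbrev Indec (n d : ℕ) : Type (max u v) :=
  augIdeal M n d ⧸ (decomposables M n d).submoduleOf (augIdeal M n d)

variable {M}

theorem mem_augIdeal_of_weight {r n d : ℕ} {p : (freeOperad M).X n d} (hr : 1 ≤ r)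
    (h : HasWeight r p) : p ∈ augIdeal M n d :=
  Submodule.mem_iSup_of_mem r (Submodule.mem_iSup_of_mem hr h)

theorem augIdeal_induction {n d : ℕ} {C : (freeOperad M).X n d → Prop}
    (h0 : C 0) (hadd : ∀ p q, C p → C q → C (p + q))
    (hw : ∀ r p, 1 ≤ r → HasWeight r p → C p) {p : (freeOperad M).X n d}
    (hp : p ∈ augIdeal M n d) : C p := by
  refine Submodule.iSup_induction _ (motive := C) hp (fun r x hx => ?_) h0 hadd
  refine Submodule.iSup_induction _ (motive := C) hx (fun hr y hy => hw r y hr hy) h0 hadd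

theorem gen_mem_augIdeal {n d : ℕ} (x : M.X n d) : (freeGen M).app n d x ∈ augIdeal M n d :=
  mem_augIdeal_of_weight le_rfl (HasWeight.gen x)

/-- Multiples of the unit of the free operad. -/
inductive IsScalar : ∀ {n d : ℕ}, (freeOperad M).X n d → Prop
  | zero {n d : ℕ} : IsScalar (0 : (freeOperad M).X n d)
  | smul_one (c : K) : IsScalar (c • (freeOperad M).one)

theorem IsScalar.add {n d : ℕ} {p q : (freeOperad M).X n d} (hp : IsScalar p) (hq : IsScalar q) :
    IsScalar (p + q) := by
  cases hp with
  | zero => rwa [zero_add]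
  | smul_one c =>
    cases hq with
    | zero => rw [add_zero]; exact IsScalar.smul_one c
    | smul_one c' => rw [← add_smul]; exact IsScalar.smul_one _

theorem IsScalar.smul {n d : ℕ} (s : K) {p : (freeOperad M).X n d} (hp : IsScalar p) :
    IsScalar (s • p) := by
  cases hp with
  | zero => rw [smul_zero]; exact IsScalar.zero
  | smul_one c => rw [smul_smul]; exact IsScalar.smul_one _

theorem IsScalar.act {n d : ℕ} (σ : Equiv.Perm (Fin n)) {p : (freeOperad M).X n d}
    (hp : IsScalar p) : IsScalar ((freeOperad M).ρ n d σ p) := by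
  cases hp with
  | zero => rw [map_zero]; exact IsScalar.zero
  | smul_one c =>
    rw [Subsingleton.elim σ 1, map_one]
    exact IsScalar.smul_one c

/-- A composite with a multiple of the unit on the left is a multiple of the right factor. -/
theorem IsScalar.circ_left {m n k a b c : ℕ} (i : Fin m) (hk : m + n = k + 1) (hc : a + b = c)
    {p : (freeOperad M).X m a} {q : (freeOperad M).X n b} (hp : IsScalar p)
    {C : (freeOperad M).X k c → Prop} (h0 : C 0)
    (hC : ∀ (s : K) (hn : n = k) (hb : b = c), C (s • (hn ▸ hb ▸ q))) :
    C ((freeOperad M).circ i hk hc p q) := by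
  cases hp with
  | zero => rw [map_zero, LinearMap.zero_apply]; exact h0
  | smul_one s =>
    obtain rfl : n = k := by omega
    obtain rfl : b = c := by omega
    rw [map_smul, LinearMap.smul_apply, (freeOperad M).one_circ]
    exact hC s rfl rfl

/-- A composite with a multiple of the unit on the right is a multiple of the left factor. -/
theorem IsScalar.circ_right {m n k a b c : ℕ} (i : Fin m) (hk : m + n = k + 1) (hc : a + b = c)
    {p : (freeOperad M).X m a} {q : (freeOperad M).X n b} (hq : IsScalar q)
    {C : (freeOperad M).X k c → Prop} (h0 : C 0)
    (hC : ∀ (s : K) (hn : m = k) (hb : a = c), C (s • (hn ▸ hb ▸ p))) :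
    C ((freeOperad M).circ i hk hc p q) := by
  cases hq with
  | zero => rw [map_zero]; exact h0
  | smul_one s =>
    obtain rfl : m = k := by omega
    obtain rfl : a = c := by omega
    rw [map_smul, (freeOperad M).circ_one]
    exact hC s rfl rfl

theorem circ_mem_decomposables {m n k a b c : ℕ} (i : Fin m) (hk : m + n = k + 1)
    (hc : a + b = c) {p : (freeOperad M).X m a} {q : (freeOperad M).X n b}
    (hp : p ∈ augIdeal M m a) (hq : q ∈ augIdeal M n b) :
    (freeOperad M).circ i hk hc p q ∈ decomposables M k c :=
  Submodule.subset_span ⟨m, n, a, b, i, hk, hc, 1, p, hp, q, hq, by simp⟩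

theorem act_mem_decomposables {n d : ℕ} (σ : Equiv.Perm (Fin n)) {z : (freeOperad M).X n d}
    (hz : z ∈ decomposables M n d) : (freeOperad M).ρ n d σ z ∈ decomposables M n d := by
  induction hz using Submodule.span_induction with
  | mem z h =>
    obtain ⟨m, l, a, b, i, hk, hc, τ, p, hp, q, hq, rfl⟩ := h
    exact Submodule.subset_span ⟨m, l, a, b, i, hk, hc, σ * τ, p, hp, q, hq, by simp⟩
  | zero => rw [map_zero]; exact Submodule.zero_mem _
  | add x y _ _ hx hy => rw [map_add]; exact Submodule.add_mem _ hx hy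
  | smul c x _ hx => rw [map_smul]; exact Submodule.smul_mem _ c hx

theorem weight_cases {r n d : ℕ} {p : (freeOperad M).X n d} (h : HasWeight r p) :
    (r = 0 → IsScalar p) ∧
      (1 ≤ r → p ∈ LinearMap.range ((freeGen M).app n d) ⊔ decomposables M n d) := by
  induction h with
  | zero => exact ⟨fun _ => IsScalar.zero, fun _ => Submodule.zero_mem _⟩
  | add _ _ hp hq =>
    exact ⟨fun h => (hp.1 h).add (hq.1 h), fun h => Submodule.add_mem _ (hp.2 h) (hq.2 h)⟩
  | smul c _ hp => exact ⟨fun h => (hp.1 h).smul c, fun h => Submodule.smul_mem _ c (hp.2 h)⟩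
  | act σ _ hp =>
    refine ⟨fun h => (hp.1 h).act σ, fun h => ?_⟩
    obtain ⟨_, ⟨x, rfl⟩, z, hz, rfl⟩ := Submodule.mem_sup.1 (hp.2 h)
    rw [map_add, ← (freeGen M).map_ρ]
    exact Submodule.add_mem _ (Submodule.mem_sup_left ⟨_, rfl⟩)
      (Submodule.mem_sup_right (act_mem_decomposables σ hz))
  | one =>
    refine ⟨fun _ => ?_, fun h => absurd h (by decide)⟩
    have := IsScalar.smul_one (M := M) 1
    rwa [one_smul] at this
  | gen x =>
    exact ⟨fun h => absurd h (by decide), fun _ => Submodule.mem_sup_left ⟨x, rfl⟩⟩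
  | @circ r s m n k a b c i hk hc p q wp wq hp hq =>
    constructor
    · intro h
      refine IsScalar.circ_left i hk hc (hp.1 (by omega)) IsScalar.zero ?_
      rintro t rfl rfl
      exact (hq.1 (by omega)).smul t
    · intro h
      rcases Nat.eq_zero_or_pos r with hr | hr
      · refine IsScalar.circ_left i hk hc (hp.1 hr)
          (C := fun z => z ∈ LinearMap.range ((freeGen M).app k c) ⊔ decomposables M k c)
          (Submodule.zero_mem _) ?_
        rintro t rfl rfl
        exact Submodule.smul_mem _ t (hq.2 (by omega))
      · rcases Nat.eq_zero_or_pos s with hs | hs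
        · refine IsScalar.circ_right i hk hc (hq.1 hs)
            (C := fun z => z ∈ LinearMap.range ((freeGen M).app k c) ⊔ decomposables M k c)
            (Submodule.zero_mem _) ?_
          rintro t rfl rfl
          exact Submodule.smul_mem _ t (hp.2 hr)
        · exact Submodule.mem_sup_right (circ_mem_decomposables i hk hc
            (mem_augIdeal_of_weight hr wp) (mem_augIdeal_of_weight hs wq))

theorem augIdeal_le {n d : ℕ} :
    augIdeal M n d ≤ LinearMap.range ((freeGen M).app n d) ⊔ decomposables M n d :=
  iSup₂_le fun _ hr _ hp => (weight_cases hp).2 hr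

/-! The square zero extension of the unit operad by `M`, which shows that the generators of the free
operad are its indecomposable elements. -/

/-- The graded `K`-module underlying the unit operad: `K` in arity `1` and degree `0`. -/
def unitPart (K : Type u) [CommRing K] (n d : ℕ) : Submodule K K where
  carrier := {c | c = 0 ∨ (n = 1 ∧ d = 0)}
  zero_mem' := Or.inl rfl
  add_mem' := by
    rintro a b (rfl | h) (rfl | h')
    · exact Or.inl (add_zero _)
    · exact Or.inr h'
    · exact Or.inr h
    · exact Or.inr h
  smul_mem' := by
    rintro c a (rfl | h)
    · exact Or.inl (smul_zero _)
    · exact Or.inr h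

/-- The identity of `M(m)_a = M(k)_c` if `(m, a) = (k, c)`, and zero otherwise. -/
noncomputable def GradedSigmaModule.transport {K : Type u} [CommRing K]
    (M : GradedSigmaModule.{u, v} K) (m a k c : ℕ) : M.X m a →ₗ[K] M.X k c :=
  if h : m = k ∧ a = c then h.1 ▸ h.2 ▸ LinearMap.id else 0

@[simp] theorem transport_self (m a : ℕ) (x : M.X m a) : M.transport m a m a x = x := by
  simp [GradedSigmaModule.transport]

theorem permCirc_one_right {m : ℕ} (σ : Equiv.Perm (Fin m)) (i : Fin m) (τ : Equiv.Perm (Fin 1))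
    (hk : m + 1 = m + 1) : permCirc σ i τ hk = σ := by
  have hl : ∀ (i : Fin m) (a : {a : Fin m // a ≠ i}), insertEquiv (n := 1) i hk (Sum.inl a) = a.1 := by
    intro i a
    apply Fin.ext
    simp only [insertEquiv, Equiv.ofBijective_apply, insertFun]
    split_ifs <;> omega
  have hr : ∀ (i : Fin m) (j : Fin 1), insertEquiv i hk (Sum.inr j) = i := by
    intro i j
    apply Fin.ext
    simp only [insertEquiv, Equiv.ofBijective_apply, insertFun]
    omega
  ext1 x
  obtain ⟨y, rfl⟩ := (insertEquiv (n := 1) i hk).surjective x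
  rcases y with a | j
  · rw [permCirc_inl, hl, hl]
  · rw [permCirc_inr, hr, hr]

theorem permCirc_one_left {n : ℕ} (σ : Equiv.Perm (Fin 1)) (i : Fin 1) (τ : Equiv.Perm (Fin n))
    (hk : 1 + n = n + 1) : permCirc σ i τ hk = τ := by
  have hr : ∀ (i : Fin 1) (j : Fin n), insertEquiv i hk (Sum.inr j) = j := by
    intro i j
    apply Fin.ext
    simp only [insertEquiv, Equiv.ofBijective_apply, insertFun]
    omega
  ext1 x
  obtain ⟨y, rfl⟩ := (insertEquiv i hk).surjective x
  rcases y with a | j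
  · exact absurd (Subsingleton.elim _ _) a.2
  · rw [permCirc_inr, hr, hr]

/-- The partial composition products of the square zero extension:
`(s, x) ∘_i (t, y) = (s t, t x + s y)`. -/
noncomputable def sqZeroCirc (M : GradedSigmaModule.{u, v} K) {m n k a b c : ℕ}
    (hk : m + n = k + 1) (hc : a + b = c) :
    (unitPart K m a × M.X m a) →ₗ[K] (unitPart K n b × M.X n b) →ₗ[K]
      (unitPart K k c × M.X k c) :=
  LinearMap.mk₂ K
    (fun p q => (⟨(p.1 : K) * q.1, by
        rcases p.1.2 with h | h
        · exact Or.inl (by rw [h, zero_mul])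
        rcases q.1.2 with h' | h'
        · exact Or.inl (by rw [h', mul_zero])
        · exact Or.inr ⟨by omega, by omega⟩⟩,
      (q.1 : K) • M.transport m a k c p.2 + (p.1 : K) • M.transport n b k c q.2))
    (fun p p' q => by
      refine Prod.ext (Subtype.ext ?_) ?_
      · simp [add_mul]
      · simp only [Prod.fst_add, Prod.snd_add, Submodule.coe_add, map_add, smul_add, add_smul]
        abel)
    (fun s p q => by
      refine Prod.ext (Subtype.ext ?_) ?_
      · simp [mul_assoc]
      · simp [smul_smul, mul_comm])
    (fun p q q' => by
      refine Prod.ext (Subtype.ext ?_) ?_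
      · simp [mul_add]
      · simp only [Prod.fst_add, Prod.snd_add, Submodule.coe_add, map_add, smul_add, add_smul]
        abel)
    (fun s p q => by
      refine Prod.ext (Subtype.ext ?_) ?_
      · simp [mul_left_comm]
      · simp [smul_smul, mul_comm])

theorem sqZeroCirc_fst {m n k a b c : ℕ} (hk : m + n = k + 1) (hc : a + b = c)
    (p : unitPart K m a × M.X m a) (q : unitPart K n b × M.X n b) :
    ((sqZeroCirc M hk hc p q).1 : K) = p.1 * q.1 := rfl

theorem sqZeroCirc_snd {m n k a b c : ℕ} (hk : m + n = k + 1) (hc : a + b = c)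
    (p : unitPart K m a × M.X m a) (q : unitPart K n b × M.X n b) :
    (sqZeroCirc M hk hc p q).2 =
      (q.1 : K) • M.transport m a k c p.2 + (p.1 : K) • M.transport n b k c q.2 := rfl

variable (M) in
/-- The square zero extension of the unit operad by `M`. -/
noncomputable def sqZero : GradedOperad.{u, max u v} K where
  X n d := unitPart K n d × M.X n d
  ρ n d :=
    { toFun := fun σ => LinearMap.prodMap LinearMap.id (M.ρ n d σ)
      map_one' := by
        ext x <;> simp
      map_mul' := fun σ τ => by
        ext x <;> simp }
  one := (⟨1, Or.inr ⟨rfl, rfl⟩⟩, 0)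
  circ _ hk hc := sqZeroCirc M hk hc
  one_circ i hk hc q := by
    refine Prod.ext (Subtype.ext ?_) ?_
    · simp [sqZeroCirc_fst]
    · simp [sqZeroCirc_snd]
  circ_one i hk hc p := by
    refine Prod.ext (Subtype.ext ?_) ?_
    · simp [sqZeroCirc_fst]
    · simp [sqZeroCirc_snd]
  circ_assoc {m n s k l t a b c e f g} i j j' hj hk ht hl ht' he hg hf hg' := by
    rintro ⟨⟨p, hp⟩, x⟩ ⟨⟨q, hq⟩, y⟩ ⟨⟨r, hr⟩, z⟩
    refine Prod.ext (Subtype.ext ?_) ?_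
    · simp [sqZeroCirc_fst, mul_assoc]
    · simp only [sqZeroCirc_fst, sqZeroCirc_snd, map_add, map_smul, smul_add]
      have h1 : r • q • M.transport k e t g (M.transport m a k e x) =
          (q * r) • M.transport m a t g x := by
        rcases hq with rfl | ⟨rfl, rfl⟩
        · simp
        rcases hr with rfl | ⟨rfl, rfl⟩
        · simp
        obtain rfl : m = k := by omega
        obtain rfl : a = e := by omega
        obtain rfl : m = t := by omega
        obtain rfl : a = g := by omega
        simp [smul_smul, mul_comm]
      have h2 : r • p • M.transport k e t g (M.transport n b k e y) =
          p • r • M.transport l f t g (M.transport n b l f y) := by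
        rcases hp with rfl | ⟨rfl, rfl⟩
        · simp
        rcases hr with rfl | ⟨rfl, rfl⟩
        · simp
        obtain rfl : n = k := by omega
        obtain rfl : b = e := by omega
        obtain rfl : n = t := by omega
        obtain rfl : b = g := by omega
        obtain rfl : n = l := by omega
        obtain rfl : b = f := by omega
        rw [smul_comm]
      have h3 : (p * q) • M.transport s c t g z =
          p • q • M.transport l f t g (M.transport s c l f z) := by
        rcases hp with rfl | ⟨rfl, rfl⟩
        · simp
        rcases hq with rfl | ⟨rfl, rfl⟩
        · simp
        obtain rfl : s = t := by omega
        obtain rfl : c = g := by omega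
        obtain rfl : s = l := by omega
        obtain rfl : c = f := by omega
        simp [smul_smul]
      rw [h1, h2, h3]
      abel
  circ_comm {m n₁ n₂ k₁ k₂ t a b₁ b₂ e₁ e₂ g} i₁ i₂ hi i₂' hi₂ i₁' hi₁ hk₁ ht₁ hk₂ ht₂ he₁ hg₁
      he₂ hg₂ := by
    rintro ⟨⟨p, hp⟩, x⟩ ⟨⟨q, hq⟩, y⟩ ⟨⟨r, hr⟩, z⟩
    have hp0 : p = 0 := by
      rcases hp with h | ⟨h, _⟩
      · exact h
      · have h1 := i₁.2
        have h2 := i₂.2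
        have h3 : (i₁ : ℕ) < i₂ := hi
        omega
    subst hp0
    refine Prod.ext (Subtype.ext ?_) ?_
    · simp [sqZeroCirc_fst]
    · simp only [sqZeroCirc_fst, sqZeroCirc_snd, map_smul, Prod.smul_snd, zero_smul,
        zero_mul, add_zero]
      rcases hq with rfl | ⟨rfl, rfl⟩
      · simp
      rcases hr with rfl | ⟨rfl, rfl⟩
      · simp
      obtain rfl : m = k₁ := by omega
      obtain rfl : m = k₂ := by omega
      obtain rfl : a = e₁ := by omega
      obtain rfl : a = e₂ := by omega
      simp [smul_smul, mul_comm]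
  circ_equivariant {m n k a b c} i hk hc σ τ := by
    rintro ⟨⟨p, hp⟩, x⟩ ⟨⟨q, hq⟩, y⟩
    refine Prod.ext rfl ?_
    change q • M.transport m a k c (M.ρ m a σ x) + p • M.transport n b k c (M.ρ n b τ y) =
      M.ρ k c (permCirc σ i τ hk) (q • M.transport m a k c x + p • M.transport n b k c y)
    rw [map_add, map_smul, map_smul]
    congr 1
    · rcases hq with rfl | ⟨rfl, rfl⟩
      · rw [zero_smul, zero_smul]
      · obtain rfl : m = k := by omega
        obtain rfl : a = c := by omega
        rw [transport_self, transport_self, permCirc_one_right]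
    · rcases hp with rfl | ⟨rfl, rfl⟩
      · rw [zero_smul, zero_smul]
      · obtain rfl : n = k := by omega
        obtain rfl : b = c := by omega
        rw [transport_self, transport_self, permCirc_one_left]

variable (M) in
/-- The morphism of operads `F(M) → sqZero M` which extends the inclusion of `M`. -/
noncomputable def toSqZero : GradedOperad.Hom (freeOperad M) (sqZero M) :=
  freeLift (Q := sqZero M)
    { app := fun n d => LinearMap.inr K (unitPart K n d) (M.X n d)
      map_ρ := fun n d σ x => Prod.ext rfl rfl }

theorem toSqZero_gen {n d : ℕ} (x : M.X n d) :
    ((toSqZero M).app n d ((freeGen M).app n d x)).2 = x := rfl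

theorem toSqZero_weight {r n d : ℕ} {p : (freeOperad M).X n d} (h : HasWeight r p)
    (hr : 1 ≤ r) : (((toSqZero M).app n d p).1 : K) = 0 := by
  induction h with
  | zero => rw [map_zero]; rfl
  | add _ _ hp hq =>
    rw [map_add]
    exact (congrArg₂ (· + ·) (hp hr) (hq hr)).trans (add_zero 0)
  | smul c _ hp =>
    rw [map_smul]
    exact (congrArg (c * ·) (hp hr)).trans (mul_zero c)
  | act σ _ hp => rw [(toSqZero M).map_ρ]; exact hp hr
  | one => exact absurd hr (by decide)
  | gen x => rfl
  | @circ r s m n k a b c i hk hc p q wp wq hp hq =>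
    rw [(toSqZero M).map_circ]
    change (((toSqZero M).app m a p).1 : K) * ((toSqZero M).app n b q).1 = 0
    rcases Nat.eq_zero_or_pos r with h0 | h0
    · rw [hq (by omega), mul_zero]
    · rw [hp h0, zero_mul]

theorem toSqZero_augIdeal {n d : ℕ} {p : (freeOperad M).X n d} (hp : p ∈ augIdeal M n d) :
    (((toSqZero M).app n d p).1 : K) = 0 := by
  refine augIdeal_induction (C := fun p => (((toSqZero M).app n d p).1 : K) = 0) ?_ ?_ ?_ hp
  · rw [map_zero]; rfl
  · intro p q hp hq
    rw [map_add]
    exact (congrArg₂ (· + ·) hp hq).trans (add_zero 0)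
  · intro r p hr h
    exact toSqZero_weight h hr

theorem toSqZero_decomposables {n d : ℕ} {p : (freeOperad M).X n d}
    (hp : p ∈ decomposables M n d) : ((toSqZero M).app n d p).2 = 0 := by
  induction hp using Submodule.span_induction with
  | mem z h =>
    obtain ⟨m, l, a, b, i, hk, hc, σ, p, hp, q, hq, rfl⟩ := h
    rw [(toSqZero M).map_ρ, (toSqZero M).map_circ]
    change M.ρ n d σ ((((toSqZero M).app l b q).1 : K) • _ +
      (((toSqZero M).app m a p).1 : K) • _) = 0
    rw [toSqZero_augIdeal hp, toSqZero_augIdeal hq, zero_smul, zero_smul, add_zero, map_zero]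
  | zero => rw [map_zero]; rfl
  | add x y _ _ hx hy =>
    rw [map_add]
    exact (congrArg₂ (· + ·) hx hy).trans (add_zero 0)
  | smul c x _ hx =>
    rw [map_smul]
    exact (congrArg (c • ·) hx).trans (smul_zero c)

theorem decomposables_le_augIdeal {n d : ℕ} : decomposables M n d ≤ augIdeal M n d := by
  have circ_mem : ∀ {m l k a b c : ℕ} (i : Fin m) (hk : m + l = k + 1) (hc : a + b = c)
      {p : (freeOperad M).X m a} {q : (freeOperad M).X l b}, p ∈ augIdeal M m a →
      q ∈ augIdeal M l b → ∀ σ, (freeOperad M).ρ k c σ ((freeOperad M).circ i hk hc p q) ∈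
        augIdeal M k c := by
    intro m l k a b c i hk hc p q hp hq σ
    refine augIdeal_induction
      (C := fun p => (freeOperad M).ρ k c σ ((freeOperad M).circ i hk hc p q) ∈ augIdeal M k c)
      (by simp) (fun p p' h h' => ?_) (fun r p hr hw => ?_) hp
    · rw [map_add, LinearMap.add_apply, map_add]
      exact Submodule.add_mem _ h h'
    refine augIdeal_induction
      (C := fun q => (freeOperad M).ρ k c σ ((freeOperad M).circ i hk hc p q) ∈ augIdeal M k c)
      (by simp) (fun q q' h h' => ?_) (fun s q hs hw' => ?_) hq
    · rw [map_add, map_add]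
      exact Submodule.add_mem _ h h'
    exact mem_augIdeal_of_weight (r := r + s) (by omega)
      (HasWeight.act σ (HasWeight.circ i hk hc hw hw'))
  rw [decomposables, Submodule.span_le]
  rintro _ ⟨m, l, a, b, i, hk, hc, σ, p, hp, q, hq, rfl⟩
  exact circ_mem i hk hc hp hq σ

variable (M) in
/-- The map `M → F(M) → Indec` from the generators to the indecomposable quotient. -/
def genToIndec (n d : ℕ) : M.X n d →ₗ[K] Indec M n d :=
  (Submodule.mkQ _).comp
    (((freeGen M).app n d).codRestrict (augIdeal M n d) (fun x => gen_mem_augIdeal x))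

theorem genToIndec_bijective (n d : ℕ) : Function.Bijective (genToIndec M n d) := by
  constructor
  · rw [← LinearMap.ker_eq_bot, LinearMap.ker_eq_bot']
    intro x hx
    have h : (freeGen M).app n d x ∈ decomposables M n d := by
      have h' := (Submodule.Quotient.mk_eq_zero _).1 hx
      exact h'
    exact (toSqZero_gen x).symm.trans (toSqZero_decomposables h)
  · intro y
    obtain ⟨⟨p, hp⟩, rfl⟩ := Submodule.Quotient.mk_surjective _ y
    obtain ⟨_, ⟨x, rfl⟩, z, hz, h⟩ := Submodule.mem_sup.1 (augIdeal_le hp)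
    refine ⟨x, ?_⟩
    refine (Submodule.Quotient.eq _).2 ?_
    change (freeGen M).app n d x - p ∈ decomposables M n d
    rw [← h, sub_add_cancel_left]
    exact Submodule.neg_mem _ hz

variable (M) in
/-- The identification of `M` with the indecomposable quotient of `F(M)`. -/
noncomputable def indecEquiv (n d : ℕ) : M.X n d ≃ₗ[K] Indec M n d :=
  LinearEquiv.ofBijective (genToIndec M n d) (genToIndec_bijective n d)

/-! Quasi-free operads. -/

/-- The quasi-free operad with underlying graded operad `F(M)`: a differential on `F(M)` is any
operad derivation of degree `-1` and square zero, so that `δ = δ_M + d_θ` for the canonical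
differential `δ_M` of the free operad on a dg-`Σ_*`-module `M` and a derivation `d_θ` such that
`δ² = 0` is included. -/
def quasiFree (M : GradedSigmaModule.{u, v} K) (D : (freeOperad M).Differential) :
    DGOperad.{u, max u v} K := ⟨freeOperad M, D⟩

theorem weight_low (hM : M.IsReduced) {r n d : ℕ} {p : (freeOperad M).X n d}
    (h : HasWeight r p) : (n = 0 → p = 0) ∧ (n = 1 → 1 ≤ r → p = 0) := by
  induction h with
  | zero => exact ⟨fun _ => rfl, fun _ _ => rfl⟩
  | add _ _ hp hq =>
    refine ⟨fun h => ?_, fun h h' => ?_⟩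
    · rw [hp.1 h, hq.1 h, add_zero]
    · rw [hp.2 h h', hq.2 h h', add_zero]
  | smul c _ hp =>
    refine ⟨fun h => ?_, fun h h' => ?_⟩
    · rw [hp.1 h, smul_zero]
    · rw [hp.2 h h', smul_zero]
  | act σ _ hp =>
    refine ⟨fun h => ?_, fun h h' => ?_⟩
    · rw [hp.1 h, map_zero]
    · rw [hp.2 h h', map_zero]
  | one => exact ⟨fun h => absurd h (by decide), fun _ h => absurd h (by decide)⟩
  | @gen n d x =>
    refine ⟨?_, ?_⟩
    · rintro rfl
      have := hM.arity_zero d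
      rw [Subsingleton.elim x 0, map_zero]
    · rintro rfl _
      have := hM.arity_one d
      rw [Subsingleton.elim x 0, map_zero]
  | @circ r s m n k a b c i hk hc p q wp wq hp hq =>
    have hi := i.2
    refine ⟨fun h => ?_, fun h h' => ?_⟩
    · rw [hq.1 (by omega), map_zero]
    · rcases Nat.eq_zero_or_pos n with hn | hn
      · rw [hq.1 hn, map_zero]
      · rcases Nat.eq_zero_or_pos r with hr | hr
        · rw [hq.2 (by omega) (by omega), map_zero]
        · rw [hp.2 (by omega) hr, map_zero, LinearMap.zero_apply]

theorem augIdeal_low (hM : M.IsReduced) {n d : ℕ} (hn : n ≤ 1) {p : (freeOperad M).X n d}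
    (hp : p ∈ augIdeal M n d) : p = 0 := by
  refine augIdeal_induction (C := fun p => p = 0) rfl ?_ ?_ hp
  · rintro p q rfl rfl
    exact add_zero 0
  · intro r p hr h
    rcases Nat.eq_zero_or_pos n with h0 | h0
    · exact (weight_low hM h).1 h0
    · exact (weight_low hM h).2 (by omega) hr

/-- The decomposition `F(M) = I ⊕ augIdeal`. -/
theorem exists_scalar_add (n d : ℕ) (p : (freeOperad M).X n d) :
    ∃ s t, IsScalar s ∧ t ∈ augIdeal M n d ∧ p = s + t := by
  have key : ∀ {r n d : ℕ} {p : (freeOperad M).X n d}, HasWeight r p →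
      ∃ s t, IsScalar s ∧ t ∈ augIdeal M n d ∧ p = s + t := by
    intro r n d p h
    rcases Nat.eq_zero_or_pos r with hr | hr
    · exact ⟨p, 0, (weight_cases h).1 hr, Submodule.zero_mem _, (add_zero p).symm⟩
    · exact ⟨0, p, IsScalar.zero, mem_augIdeal_of_weight hr h, (zero_add p).symm⟩
  have hsup : ∀ n d (p : (freeOperad M).X n d), p ∈ ⨆ r, weightPart M r n d := by
    refine freeOperad_induction ?_ ?_ ?_ ?_ ?_ ?_ ?_
    · intro n d
      exact Submodule.zero_mem _
    · intro n d p q hp hq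
      exact Submodule.add_mem _ hp hq
    · intro n d c p hp
      exact Submodule.smul_mem _ c hp
    · intro n d σ p hp
      refine Submodule.iSup_induction _
        (motive := fun p => (freeOperad M).ρ n d σ p ∈ ⨆ r, weightPart M r n d) hp ?_ ?_ ?_
      · intro r x hx
        exact Submodule.mem_iSup_of_mem r (HasWeight.act σ hx)
      · rw [map_zero]
        exact Submodule.zero_mem _
      · intro x y hx hy
        rw [map_add]
        exact Submodule.add_mem _ hx hy
    · intro n d x
      exact Submodule.mem_iSup_of_mem 1 (HasWeight.gen x)
    · exact Submodule.mem_iSup_of_mem 0 HasWeight.one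
    · intro m n k a b c i hk hc p q hp hq
      refine Submodule.iSup_induction _
        (motive := fun p => (freeOperad M).circ i hk hc p q ∈ ⨆ r, weightPart M r k c) hp ?_ ?_ ?_
      · intro r x hx
        refine Submodule.iSup_induction _
          (motive := fun q => (freeOperad M).circ i hk hc x q ∈ ⨆ r, weightPart M r k c) hq
          ?_ ?_ ?_
        · intro s y hy
          exact Submodule.mem_iSup_of_mem (r + s) (HasWeight.circ i hk hc hx hy)
        · rw [map_zero]
          exact Submodule.zero_mem _
        · intro x y hx hy
          rw [map_add]
          exact Submodule.add_mem _ hx hy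
      · rw [map_zero]
        exact Submodule.zero_mem _
      · intro x y hx hy
        rw [map_add]
        exact Submodule.add_mem _ hx hy
  refine Submodule.iSup_induction _
    (motive := fun p => ∃ s t, IsScalar s ∧ t ∈ augIdeal M n d ∧ p = s + t) (hsup n d p)
    (fun r x hx => key hx) ⟨0, 0, IsScalar.zero, Submodule.zero_mem _, (add_zero 0).symm⟩ ?_
  rintro x y ⟨s, t, hs, ht, rfl⟩ ⟨s', t', hs', ht', rfl⟩
  exact ⟨s + s', t + t', hs.add hs', Submodule.add_mem _ ht ht', by abel⟩

theorem augIdeal_high {n d : ℕ} (hn : 2 ≤ n) (p : (freeOperad M).X n d) : p ∈ augIdeal M n d := by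
  obtain ⟨s, t, hs, ht, rfl⟩ := exists_scalar_add n d p
  cases hs with
  | zero => rwa [zero_add]
  | smul_one c => exact absurd hn (by decide)

/-- If `M(0) = M(1) = 0`, then every differential of `F(M)` preserves the augmentation ideal. -/
theorem d_mem_augIdeal (hM : M.IsReduced) (D : (freeOperad M).Differential) (n a : ℕ)
    (p : (freeOperad M).X n (a + 1)) (hp : p ∈ augIdeal M n (a + 1)) :
    D.d n a p ∈ augIdeal M n a := by
  rcases Nat.lt_or_ge 1 n with hn | hn
  · exact augIdeal_high hn _
  · rw [augIdeal_low hM hn hp, map_zero]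
    exact Submodule.zero_mem _

theorem d_mem_decomposables (hM : M.IsReduced) (D : (freeOperad M).Differential) (n a : ℕ)
    (p : (freeOperad M).X n (a + 1)) (hp : p ∈ decomposables M n (a + 1)) :
    D.d n a p ∈ decomposables M n a := by
  induction hp using Submodule.span_induction with
  | mem z h =>
    obtain ⟨m, l, b, c, i, hk, hc, σ, x, hx, y, hy, rfl⟩ := h
    rw [D.d_ρ]
    refine act_mem_decomposables σ ?_
    rcases b with _ | b
    · rcases c with _ | c
      · omega
      · obtain rfl : c = a := by omega
        rw [D.d_circ_right i hk hc (by omega)]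
        exact circ_mem_decomposables i hk _ hx (d_mem_augIdeal hM D _ _ _ hy)
    · rcases c with _ | c
      · obtain rfl : b = a := by omega
        rw [D.d_circ_left i hk hc (by omega)]
        exact circ_mem_decomposables i hk _ (d_mem_augIdeal hM D _ _ _ hx) hy
      · rw [D.d_circ i hk hc (by omega) (by omega)]
        exact Submodule.add_mem _
          (circ_mem_decomposables i hk _ (d_mem_augIdeal hM D _ _ _ hx) hy)
          (Submodule.smul_mem _ _
            (circ_mem_decomposables i hk _ hx (d_mem_augIdeal hM D _ _ _ hy)))
  | zero => rw [map_zero]; exact Submodule.zero_mem _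
  | add x y _ _ hx hy => rw [map_add]; exact Submodule.add_mem _ hx hy
  | smul c x _ hx => rw [map_smul]; exact Submodule.smul_mem _ c hx

/-- The differential of the indecomposable quotient induced by the differential of a quasi-free
operad. -/
def indecD (hM : M.IsReduced) (D : (freeOperad M).Differential) (n a : ℕ) :
    Indec M n (a + 1) →ₗ[K] Indec M n a :=
  Submodule.mapQ _ _ ((D.d n a).restrict (d_mem_augIdeal hM D n a))
    (fun p hp => d_mem_decomposables hM D n a p hp)

theorem indecD_indecD (hM : M.IsReduced) (D : (freeOperad M).Differential) (n a : ℕ)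
    (y : Indec M n (a + 1 + 1)) : indecD hM D n a (indecD hM D n (a + 1) y) = 0 := by
  obtain ⟨p, rfl⟩ := Submodule.Quotient.mk_surjective _ y
  refine (Submodule.Quotient.mk_eq_zero _).2 ?_
  change D.d n a (D.d n (a + 1) p) ∈ decomposables M n a
  rw [D.d_d]
  exact Submodule.zero_mem _

/-- The differential of `M` given by the identification of `M` with the indecomposable quotient of a
quasi-free operad. -/
noncomputable def genD (hM : M.IsReduced) (D : (freeOperad M).Differential) (n a : ℕ) :
    M.X n (a + 1) →ₗ[K] M.X n a :=
  (indecEquiv M n a).symm.toLinearMap ∘ₗ indecD hM D n a ∘ₗ (indecEquiv M n (a + 1)).toLinearMap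

/-- The chain complex `M(n)`, with the differential given by the identification of `M` with the
indecomposable quotient of a quasi-free operad. -/
noncomputable def genComplex (hM : M.IsReduced) (D : (freeOperad M).Differential) (n : ℕ) :
    ChainComplex (ModuleCat.{v} K) ℕ :=
  ChainComplex.of (fun d => ModuleCat.of K (M.X n d)) (fun d => ModuleCat.ofHom (genD hM D n d))
    (fun d => by
      ext x
      change genD hM D n d (genD hM D n (d + 1) x) = 0
      simp [genD, indecD_indecD])

variable {M' : GradedSigmaModule.{u, v} K}

/-- A morphism between free operads preserves augmentation ideals. -/
def PreservesAug (φ : GradedOperad.Hom (freeOperad M) (freeOperad M')) : Prop :=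
  ∀ n d, ∀ p ∈ augIdeal M n d, φ.app n d p ∈ augIdeal M' n d

theorem map_mem_decomposables {φ : GradedOperad.Hom (freeOperad M) (freeOperad M')}
    (hφ : PreservesAug φ) (n d : ℕ) (p : (freeOperad M).X n d) (hp : p ∈ decomposables M n d) :
    φ.app n d p ∈ decomposables M' n d := by
  induction hp using Submodule.span_induction with
  | mem z h =>
    obtain ⟨m, l, b, c, i, hk, hc, σ, p, hp, q, hq, rfl⟩ := h
    rw [φ.map_ρ, φ.map_circ]
    exact act_mem_decomposables σ (circ_mem_decomposables i hk hc (hφ _ _ p hp) (hφ _ _ q hq))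
  | zero => rw [map_zero]; exact Submodule.zero_mem _
  | add x y _ _ hx hy => rw [map_add]; exact Submodule.add_mem _ hx hy
  | smul c x _ hx => rw [map_smul]; exact Submodule.smul_mem _ c hx

/-- The map of indecomposable quotients induced by a morphism which preserves augmentation
ideals. -/
def indecMap (φ : GradedOperad.Hom (freeOperad M) (freeOperad M')) (hφ : PreservesAug φ)
    (n d : ℕ) : Indec M n d →ₗ[K] Indec M' n d :=
  Submodule.mapQ _ _ ((φ.app n d).restrict (hφ n d))
    (fun p hp => map_mem_decomposables hφ n d p hp)

/-- The map `M → M'` given by the induced map of indecomposable quotients. -/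
noncomputable def genMap (φ : GradedOperad.Hom (freeOperad M) (freeOperad M'))
    (hφ : PreservesAug φ) (n d : ℕ) : M.X n d →ₗ[K] M'.X n d :=
  (indecEquiv M' n d).symm.toLinearMap ∘ₗ indecMap φ hφ n d ∘ₗ (indecEquiv M n d).toLinearMap

theorem indecMap_indecD (hM : M.IsReduced) (hM' : M'.IsReduced)
    {D : (freeOperad M).Differential} {D' : (freeOperad M').Differential}
    (φ : DGOperad.Hom (quasiFree M D) (quasiFree M' D')) (hφ : PreservesAug φ.toOperadHom)
    (n a : ℕ) (y : Indec M n (a + 1)) :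
    indecMap φ.toOperadHom hφ n a (indecD hM D n a y) =
      indecD hM' D' n a (indecMap φ.toOperadHom hφ n (a + 1) y) := by
  obtain ⟨p, rfl⟩ := Submodule.Quotient.mk_surjective _ y
  exact congrArg (Submodule.Quotient.mk) (Subtype.ext (φ.map_d n a p.1))

/-- The chain map `M(n) → M'(n)` induced by a morphism of quasi-free operads. -/
noncomputable def genChainMap (hM : M.IsReduced) (hM' : M'.IsReduced)
    {D : (freeOperad M).Differential} {D' : (freeOperad M').Differential}
    (φ : DGOperad.Hom (quasiFree M D) (quasiFree M' D')) (hφ : PreservesAug φ.toOperadHom)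
    (n : ℕ) : genComplex hM D n ⟶ genComplex hM' D' n :=
  ChainComplex.ofHom (fun d => ModuleCat.ofHom (genMap φ.toOperadHom hφ n d))
    (fun d => by
      simp only [genComplex, ChainComplex.of_d]
      ext x
      change genD hM' D' n d (genMap φ.toOperadHom hφ n (d + 1) x) =
        genMap φ.toOperadHom hφ n d (genD hM D n d x)
      simp [genD, genMap, indecMap_indecD hM hM'])

end Free

/-! An element of `F(M)(n)` is a combination of trees with inputs numbered by `Fin n`. For a set `U`
of inputs let `D_U` be the span of the composites `σ (p ∘_i q)`, with `p` and `q` of arity at least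
two, such that the block of the composite (the set of the inputs of `q`) meets `U`; this is `decomp
n (Meets n U)`. As `M(0) = M(1) = 0`, for `n ≥ 2` the quotient `F(M)(n) / D_U` is `F(M)(n)` when `U`
is empty and `M(n)` when `U` contains all inputs. Every differential and every morphism of operads
respects `D_U`, because it turns a composite into composites of the same shape. Thus it suffices to
compare the quotients when one input `u` is added to `U`.

The composites whose block contains `u` are sorted by the size `b` of the block (`MeetsAbove`). For
`2 ≤ b < n` and `m = n + 1 - b` there is an exact sequence whose kernel term is the sum, over the
blocks `B` of size `b` containing `u` and disjoint from `U`, of the complexes `(F(M)(m) / D_V) ⊗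
F(M)(b)`, where `V` consists of the point to which `B` is contracted and of the inputs which come
from `U`. The other two terms are the quotients of `F(M)(n)` for `b + 1` and for `b`
(`exact_blocksMap`, `blocksMap_injective`). A composite with a given block determines its two
factors up to permutations which a fixed choice of `σ` absorbs. No coinvariants under symmetric
groups appear, so projectivity over `K` is enough.

Injectivity on the left is the point where freeness is used. The universal property gives a map
`cut` on `F(M)`, which sends a tree to the sum over its internal edges of the pair of trees obtained
by cutting the edge. It satisfies `cut (p ∘_i q) = cut p ∘_i q + p ∘_i cut q + p ⊗ q` and vanishes
on generators. To construct it, the operations with labelled inputs are organised into an operad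
`cutExt` of pairs (operation, combination of cut pairs), and `x ↦ (x, 0)` is extended from `M` to
`F(M)`. Reading off the pairs labelled by a given block, modulo `D_V`, kills all terms but `p ⊗ q`
(`splitPair_cut`) and inverts the map from the kernel term.

The rest is an induction on the arity `n`, since `m` and `b` are smaller than `n`. The exact
sequences show that all quotients are projective (`projective_quot`). Homology isomorphisms between
projective complexes bounded below are homotopy equivalences, hence stable under tensor products
(`IsHomologyIso.tensor`), so the kernel terms are covered by the induction hypothesis. The five
lemma then makes the statements for `b` and `b + 1` equivalent (`isHomologyIso_step`); chaining
these equivalences links `U = ∅` to the set of all inputs, that is, `φ` to the map on generators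
(`isHomologyIso_total_iff`). In arities `0` and `1` the free operads are `0` and `K`, and there is
nothing to compare. -/

/-! ### Inputs of partial composites, and words on these inputs. -/

section Insertion

/-- The place in a partial composite `p ∘_i q` of an input `a ≠ i` of `p`. -/
noncomputable def inL {m n k : ℕ} (i : Fin m) (hk : m + n = k + 1) (a : Fin m) (h : a ≠ i) :
    Fin k := insertEquiv i hk (Sum.inl ⟨a, h⟩)

/-- The place in a partial composite `p ∘_i q` of an input of `q`. -/
noncomputable def inR {m n k : ℕ} (i : Fin m) (hk : m + n = k + 1) (j : Fin n) : Fin k :=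
  insertEquiv i hk (Sum.inr j)

theorem inL_val {m n k : ℕ} (i : Fin m) (hk : m + n = k + 1) (a : Fin m) (h : a ≠ i) :
    (inL i hk a h : ℕ) = if (a : ℕ) < i then (a : ℕ) else a + n - 1 := rfl

theorem inR_val {m n k : ℕ} (i : Fin m) (hk : m + n = k + 1) (j : Fin n) :
    (inR i hk j : ℕ) = i + j := rfl

theorem ins_cases {m n k : ℕ} (i : Fin m) (hk : m + n = k + 1) (x : Fin k) :
    (∃ a h, x = inL i hk a h) ∨ ∃ j, x = inR i hk j := by
  obtain ⟨y | y, rfl⟩ := (insertEquiv i hk).surjective x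
  · exact Or.inl ⟨y.1, y.2, rfl⟩
  · exact Or.inr ⟨y, rfl⟩

theorem inL_ne_inR {m n k : ℕ} (i : Fin m) (hk : m + n = k + 1) (a : Fin m) (h : a ≠ i)
    (j : Fin n) : inL i hk a h ≠ inR i hk j := fun e => by
  have := (insertEquiv i hk).injective e
  simp at this

theorem inL_inj {m n k : ℕ} (i : Fin m) (hk : m + n = k + 1) {a b : Fin m} {h : a ≠ i}
    {h' : b ≠ i} : inL i hk a h = inL i hk b h' ↔ a = b := by
  simp [inL]

theorem inR_inj {m n k : ℕ} (i : Fin m) (hk : m + n = k + 1) {a b : Fin n} :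
    inR i hk a = inR i hk b ↔ a = b := by
  simp [inR]

/-- An input of a nested composite comes from the outer, the middle or the inner operation. Here and
in the next two lemmas its place is seen to be independent of the bracketing, one lemma for each
origin. -/
theorem inL_assoc {m n s k l t : ℕ} (i : Fin m) (j : Fin n) (hk : m + n = k + 1)
    (ht : k + s = t + 1) (hl : n + s = l + 1) (ht' : m + l = t + 1) (a : Fin m) (h : a ≠ i) :
    inL (inR i hk j) ht (inL i hk a h) (inL_ne_inR _ _ _ _ _) = inL i ht' a h := by
  apply Fin.ext
  have h' : (a : ℕ) ≠ i := fun e => h (Fin.ext e)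
  simp only [inL_val, inR_val]
  have := j.2
  split_ifs <;> omega

theorem inL_inR_assoc {m n s k l t : ℕ} (i : Fin m) (j : Fin n) (hk : m + n = k + 1)
    (ht : k + s = t + 1) (hl : n + s = l + 1) (ht' : m + l = t + 1) (b : Fin n) (h : b ≠ j)
    (h' : inR i hk b ≠ inR i hk j) :
    inL (inR i hk j) ht (inR i hk b) h' = inR i ht' (inL j hl b h) := by
  apply Fin.ext
  have h₁ : (b : ℕ) ≠ j := fun e => h (Fin.ext e)
  have h₂ := inR_val i hk b
  have h₃ := inR_val i hk j
  rw [inL_val, inR_val i ht', inL_val]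
  by_cases hb : (b : ℕ) < j
  · rw [if_pos hb, if_pos (by omega), h₂]
  · rw [if_neg hb, if_neg (by omega), h₂]
    omega

theorem inR_assoc {m n s k l t : ℕ} (i : Fin m) (j : Fin n) (hk : m + n = k + 1)
    (ht : k + s = t + 1) (hl : n + s = l + 1) (ht' : m + l = t + 1) (c : Fin s) :
    inR (inR i hk j) ht c = inR i ht' (inR j hl c) := by
  apply Fin.ext
  simp only [inR_val]
  omega

/-- Parallel composites. Only `i₁ ≠ i₂` is assumed, so that exchanging the two positions yields the
remaining cases and no order of the inputs has to be followed. -/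
theorem inL_comm {m n₁ n₂ k₁ k₂ t : ℕ} {i₁ i₂ : Fin m} (h₁₂ : i₁ ≠ i₂)
    (hk₁ : m + n₁ = k₁ + 1) (ht₁ : k₁ + n₂ = t + 1) (hk₂ : m + n₂ = k₂ + 1)
    (ht₂ : k₂ + n₁ = t + 1) (a : Fin m) (h₁ : a ≠ i₁) (h₂ : a ≠ i₂)
    (h₁' : inL i₁ hk₁ a h₁ ≠ inL i₁ hk₁ i₂ h₁₂.symm)
    (h₂' : inL i₂ hk₂ a h₂ ≠ inL i₂ hk₂ i₁ h₁₂) :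
    inL (inL i₁ hk₁ i₂ h₁₂.symm) ht₁ (inL i₁ hk₁ a h₁) h₁' =
      inL (inL i₂ hk₂ i₁ h₁₂) ht₂ (inL i₂ hk₂ a h₂) h₂' := by
  apply Fin.ext
  have e₁ : (a : ℕ) ≠ i₁ := fun e => h₁ (Fin.ext e)
  have e₂ : (a : ℕ) ≠ i₂ := fun e => h₂ (Fin.ext e)
  have e₃ : (i₁ : ℕ) ≠ i₂ := fun e => h₁₂ (Fin.ext e)
  simp only [inL_val]
  split_ifs <;> omega

theorem inL_inR_comm {m n₁ n₂ k₁ k₂ t : ℕ} {i₁ i₂ : Fin m} (h₁₂ : i₁ ≠ i₂)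
    (hk₁ : m + n₁ = k₁ + 1) (ht₁ : k₁ + n₂ = t + 1) (hk₂ : m + n₂ = k₂ + 1)
    (ht₂ : k₂ + n₁ = t + 1) (c : Fin n₁)
    (h' : inR i₁ hk₁ c ≠ inL i₁ hk₁ i₂ h₁₂.symm) :
    inL (inL i₁ hk₁ i₂ h₁₂.symm) ht₁ (inR i₁ hk₁ c) h' =
      inR (inL i₂ hk₂ i₁ h₁₂) ht₂ c := by
  apply Fin.ext
  have e₃ : (i₁ : ℕ) ≠ i₂ := fun e => h₁₂ (Fin.ext e)
  have := c.2
  simp only [inL_val, inR_val]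
  split_ifs <;> omega

theorem permCirc_inL {m n k : ℕ} (σ : Equiv.Perm (Fin m)) (i : Fin m)
    (τ : Equiv.Perm (Fin n)) (hk : m + n = k + 1) (a : Fin m) (h : a ≠ i) :
    permCirc σ i τ hk (inL i hk a h) = inL (σ i) hk (σ a) (fun e => h (σ.injective e)) :=
  permCirc_inl σ i τ hk ⟨a, h⟩

theorem permCirc_inR {m n k : ℕ} (σ : Equiv.Perm (Fin m)) (i : Fin m)
    (τ : Equiv.Perm (Fin n)) (hk : m + n = k + 1) (j : Fin n) :
    permCirc σ i τ hk (inR i hk j) = inR (σ i) hk (τ j) :=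
  permCirc_inr σ i τ hk j

/-- The word on the inputs of `p ∘_i q` given by a word on the inputs of `p` and a word on the
inputs of `q`. -/
noncomputable def graftWord {L : Type*} {m n k : ℕ} (i : Fin m) (hk : m + n = k + 1)
    (a : Fin m → L) (b : Fin n → L) : Fin k → L :=
  fun x => Sum.elim (fun y : {y : Fin m // y ≠ i} => a y.1) b ((insertEquiv i hk).symm x)

@[simp] theorem graftWord_inL {L : Type*} {m n k : ℕ} (i : Fin m) (hk : m + n = k + 1)
    (a : Fin m → L) (b : Fin n → L) (y : Fin m) (h : y ≠ i) :
    graftWord i hk a b (inL i hk y h) = a y := by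
  simp [graftWord, inL]

@[simp] theorem graftWord_inR {L : Type*} {m n k : ℕ} (i : Fin m) (hk : m + n = k + 1)
    (a : Fin m → L) (b : Fin n → L) (y : Fin n) :
    graftWord i hk a b (inR i hk y) = b y := by
  simp [graftWord, inR]

theorem word_ext {L : Type*} {m n k : ℕ} (i : Fin m) (hk : m + n = k + 1) {f g : Fin k → L}
    (hl : ∀ a h, f (inL i hk a h) = g (inL i hk a h))
    (hr : ∀ j, f (inR i hk j) = g (inR i hk j)) : f = g := by
  funext x
  obtain ⟨a, h, rfl⟩ | ⟨j, rfl⟩ := ins_cases i hk x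
  · exact hl a h
  · exact hr j

/-- The letter at the grafted input `i` is never read, so a map of labels may take any value there.
-/
theorem graftWord_congr {L : Type*} {m n k : ℕ} (i : Fin m) (hk : m + n = k + 1)
    {a a' : Fin m → L} {b b' : Fin n → L} (ha : ∀ y, y ≠ i → a y = a' y) (hb : b = b') :
    graftWord i hk a b = graftWord i hk a' b' :=
  word_ext i hk (fun y h => by simp [ha y h]) (fun y => by simp [hb])

theorem comp_graftWord {L L' : Type*} {m n k : ℕ} (i : Fin m) (hk : m + n = k + 1)
    (f : L → L') (a : Fin m → L) (b : Fin n → L) :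
    f ∘ graftWord i hk a b = graftWord i hk (f ∘ a) (f ∘ b) :=
  word_ext i hk (fun y h => by simp) (fun y => by simp)

theorem graftWord_permCirc {L : Type*} {m n k : ℕ} (σ : Equiv.Perm (Fin m)) (i : Fin m)
    (τ : Equiv.Perm (Fin n)) (hk : m + n = k + 1) (a : Fin m → L) (b : Fin n → L) :
    graftWord (σ i) hk a b ∘ permCirc σ i τ hk = graftWord i hk (a ∘ σ) (b ∘ τ) :=
  word_ext i hk (fun y h => by simp [permCirc_inL]) (fun y => by simp [permCirc_inR])

theorem graftWord_assoc {L : Type*} {m n s k l t : ℕ} (i : Fin m) (j : Fin n)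
    (hk : m + n = k + 1) (ht : k + s = t + 1) (hl : n + s = l + 1) (ht' : m + l = t + 1)
    (a : Fin m → L) (b : Fin n → L) (c : Fin s → L) :
    graftWord (inR i hk j) ht (graftWord i hk a b) c =
      graftWord i ht' a (graftWord j hl b c) := by
  refine word_ext i ht' (fun y h => ?_) (fun y => ?_)
  · rw [← inL_assoc i j hk ht hl ht']
    simp only [graftWord_inL]
    rw [inL_assoc i j hk ht hl ht', graftWord_inL]
  · obtain ⟨y, h, rfl⟩ | ⟨y, rfl⟩ := ins_cases j hl y
    · have h' : inR i hk y ≠ inR i hk j := fun e => h ((inR_inj i hk).1 e)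
      rw [graftWord_inR, graftWord_inL, ← inL_inR_assoc i j hk ht hl ht' y h h', graftWord_inL,
        graftWord_inR]
    · rw [graftWord_inR, graftWord_inR, ← inR_assoc i j hk ht hl ht', graftWord_inR]

theorem graftWord_comm {L : Type*} {m n₁ n₂ k₁ k₂ t : ℕ} {i₁ i₂ : Fin m} (h₁₂ : i₁ ≠ i₂)
    (hk₁ : m + n₁ = k₁ + 1) (ht₁ : k₁ + n₂ = t + 1) (hk₂ : m + n₂ = k₂ + 1)
    (ht₂ : k₂ + n₁ = t + 1) (a : Fin m → L) (b : Fin n₁ → L) (c : Fin n₂ → L) :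
    graftWord (inL i₁ hk₁ i₂ h₁₂.symm) ht₁ (graftWord i₁ hk₁ a b) c =
      graftWord (inL i₂ hk₂ i₁ h₁₂) ht₂ (graftWord i₂ hk₂ a c) b := by
  refine word_ext (inL i₁ hk₁ i₂ h₁₂.symm) ht₁ (fun y h => ?_) (fun y => ?_)
  · obtain ⟨y, h', rfl⟩ | ⟨y, rfl⟩ := ins_cases i₁ hk₁ y
    · have h₂ : y ≠ i₂ := by
        rintro rfl
        exact h rfl
      have h₂' : inL i₂ hk₂ y h₂ ≠ inL i₂ hk₂ i₁ h₁₂ := fun e => h' ((inL_inj i₂ hk₂).1 e)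
      rw [graftWord_inL, graftWord_inL, inL_comm h₁₂ hk₁ ht₁ hk₂ ht₂ y h' h₂ h h₂', graftWord_inL,
        graftWord_inL]
    · rw [graftWord_inL, graftWord_inR, inL_inR_comm h₁₂ hk₁ ht₁ hk₂ ht₂, graftWord_inR]
  · rw [graftWord_inR, ← inL_inR_comm h₁₂.symm hk₂ ht₂ hk₁ ht₁ y (inL_ne_inR _ _ _ _ _).symm,
      graftWord_inL, graftWord_inR]

end Insertion

/-! ### The operad axioms in terms of `inL` and `inR`. -/

section OperadLaws

variable {K : Type u} [CommRing K] (P : GradedOperad.{u, v} K)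

theorem GradedOperad.circ_assoc' {m n s k l t a b c e f g : ℕ} (i : Fin m) (j : Fin n)
    (hk : m + n = k + 1) (ht : k + s = t + 1) (hl : n + s = l + 1) (ht' : m + l = t + 1)
    (he : a + b = e) (hg : e + c = g) (hf : b + c = f) (hg' : a + f = g)
    (p : P.X m a) (q : P.X n b) (r : P.X s c) :
    P.circ (inR i hk j) ht hg (P.circ i hk he p q) r =
      P.circ i ht' hg' p (P.circ j hl hf q r) :=
  P.circ_assoc i j _ (inR_val i hk j) hk ht hl ht' he hg hf hg' p q r

/-- For `i₂ < i₁` this is the axiom with the two inner operations exchanged, read backwards; the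
sign changes sides because its square is `1`. -/
theorem GradedOperad.circ_comm' {m n₁ n₂ k₁ k₂ t a b₁ b₂ e₁ e₂ g : ℕ} {i₁ i₂ : Fin m}
    (h₁₂ : i₁ ≠ i₂) (hk₁ : m + n₁ = k₁ + 1) (ht₁ : k₁ + n₂ = t + 1)
    (hk₂ : m + n₂ = k₂ + 1) (ht₂ : k₂ + n₁ = t + 1)
    (he₁ : a + b₁ = e₁) (hg₁ : e₁ + b₂ = g) (he₂ : a + b₂ = e₂) (hg₂ : e₂ + b₁ = g)
    (p : P.X m a) (q₁ : P.X n₁ b₁) (q₂ : P.X n₂ b₂) :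
    P.circ (inL i₁ hk₁ i₂ h₁₂.symm) ht₁ hg₁ (P.circ i₁ hk₁ he₁ p q₁) q₂ =
      (-1 : K) ^ (b₁ * b₂) • P.circ (inL i₂ hk₂ i₁ h₁₂) ht₂ hg₂ (P.circ i₂ hk₂ he₂ p q₂) q₁ := by
  have h : (i₁ : ℕ) ≠ i₂ := fun e => h₁₂ (Fin.ext e)
  rcases lt_or_gt_of_ne h₁₂ with hlt | hlt
  · have hlt' : (i₁ : ℕ) < i₂ := hlt
    refine P.circ_comm i₁ i₂ hlt _ ?_ _ ?_ hk₁ ht₁ hk₂ ht₂ he₁ hg₁ he₂ hg₂ p q₁ q₂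
    · rw [inL_val, if_neg (by omega)]
      omega
    · rw [inL_val, if_pos hlt']
  · have hlt' : (i₂ : ℕ) < i₁ := hlt
    rw [P.circ_comm i₂ i₁ hlt (inL i₂ hk₂ i₁ h₁₂) (by rw [inL_val, if_neg (by omega)]; omega)
      (inL i₁ hk₁ i₂ h₁₂.symm) (by rw [inL_val, if_pos hlt']) hk₂ ht₂ hk₁ ht₁ he₂ hg₂ he₁ hg₁ p q₂
      q₁, smul_smul, mul_comm b₂ b₁, ← mul_pow]
    simp

end OperadLaws

/-! ### Operations with labelled inputs, and substitution for a variable. -/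

section Labelled

variable {K : Type u} [CommRing K] (P : GradedOperad.{u, v} K) (L : Type)

open scoped Classical in
/-- The relations which identify `(σ p)(x_{w 0}, …)` with `p(x_{w (σ 0)}, …)`. -/
def labelRel : Submodule K
    (DirectSum (Σ n : ℕ, ℕ × (Fin n → L)) (fun x => P.X x.1 x.2.1)) :=
  Submodule.span K {z | ∃ (n d : ℕ) (w : Fin n → L) (σ : Equiv.Perm (Fin n)) (p : P.X n d),
    z = DirectSum.lof K (Σ n : ℕ, ℕ × (Fin n → L)) (fun x => P.X x.1 x.2.1)
        ⟨n, d, w⟩ (P.ρ n d σ p) -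
      DirectSum.lof K (Σ n : ℕ, ℕ × (Fin n → L)) (fun x => P.X x.1 x.2.1) ⟨n, d, w ∘ σ⟩ p}

/-- The free `P`-algebra on a set of variables `L`: the module of operations with inputs labelled
by elements of `L`. -/
abbrev LabelledOps : Type v :=
  (DirectSum (Σ n : ℕ, ℕ × (Fin n → L)) (fun x => P.X x.1 x.2.1)) ⧸ labelRel P L

variable {P L}

/-- The operation `p` with inputs labelled by the word `w`. -/
noncomputable def lab {n d : ℕ} (w : Fin n → L) : P.X n d →ₗ[K] LabelledOps P L := by
  classical
  exact (labelRel P L).mkQ ∘ₗ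
    DirectSum.lof K (Σ n : ℕ, ℕ × (Fin n → L)) (fun x => P.X x.1 x.2.1) ⟨n, d, w⟩

theorem lab_act {n d : ℕ} (w : Fin n → L) (σ : Equiv.Perm (Fin n)) (p : P.X n d) :
    lab w (P.ρ n d σ p) = lab (w ∘ σ) p :=
  (Submodule.Quotient.eq _).2 (Submodule.subset_span ⟨n, d, w, σ, p, rfl⟩)

variable {N : Type*} [AddCommGroup N] [Module K N]

/-- The linear map out of the free `P`-algebra given by equivariant values on the labelled
operations. -/
noncomputable def labLift (g : ∀ n d (_ : Fin n → L), P.X n d →ₗ[K] N)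
    (hg : ∀ n d (w : Fin n → L) (σ : Equiv.Perm (Fin n)) (p : P.X n d),
      g n d w (P.ρ n d σ p) = g n d (w ∘ σ) p) : LabelledOps P L →ₗ[K] N := by
  classical
  exact (labelRel P L).liftQ (DirectSum.toModule K _ N (fun x => g x.1 x.2.1 x.2.2)) (by
    rw [labelRel, Submodule.span_le]
    rintro _ ⟨n, d, w, σ, p, rfl⟩
    rw [SetLike.mem_coe, LinearMap.mem_ker, map_sub, DirectSum.toModule_lof,
      DirectSum.toModule_lof, hg, sub_self])

theorem labLift_lab (g : ∀ n d (_ : Fin n → L), P.X n d →ₗ[K] N)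
    (hg : ∀ n d (w : Fin n → L) (σ : Equiv.Perm (Fin n)) (p : P.X n d),
      g n d w (P.ρ n d σ p) = g n d (w ∘ σ) p) {n d : ℕ} (w : Fin n → L) (p : P.X n d) :
    labLift g hg (lab w p) = g n d w p := by
  classical
  exact DirectSum.toModule_lof K (ι := Σ n : ℕ, ℕ × (Fin n → L)) (M := fun x => P.X x.1 x.2.1)
    (φ := fun x => g x.1 x.2.1 x.2.2) ⟨n, d, w⟩ p

/-- The labelled operations span, so identities between the maps defined below are checked on `lab w
p`. -/
theorem lab_hom_ext {f g : LabelledOps P L →ₗ[K] N}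
    (h : ∀ n d (w : Fin n → L) (p : P.X n d), f (lab w p) = g (lab w p)) : f = g := by
  classical
  refine Submodule.linearMap_qext _ (DirectSum.linearMap_ext K (fun x => ?_))
  ext p
  exact h x.1 x.2.1 x.2.2 p

variable {L' L'' : Type}

/-- The effect of a map of labels. -/
noncomputable def relabel (f : L → L') : LabelledOps P L →ₗ[K] LabelledOps P L' :=
  labLift (fun _ _ w => lab (f ∘ w)) (fun _ _ w σ p => lab_act (f ∘ w) σ p)

@[simp] theorem relabel_lab (f : L → L') {n d : ℕ} (w : Fin n → L) (p : P.X n d) :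
    relabel f (lab w p) = lab (f ∘ w) p := labLift_lab _ _ w p

/-- Multiplication of the elements of degree `d` by `(-1) ^ (d * b)`. -/
noncomputable def par (b : ℕ) : LabelledOps P L →ₗ[K] LabelledOps P L :=
  labLift (fun _ d w => (-1 : K) ^ (d * b) • lab w) (fun _ _ w σ p => by
    simp [lab_act])

@[simp] theorem par_lab (b : ℕ) {n d : ℕ} (w : Fin n → L) (p : P.X n d) :
    par b (lab w p) = (-1 : K) ^ (d * b) • lab w p := labLift_lab _ _ w p

/-- The partial composite `p ∘_i q` with inputs labelled by words. -/
noncomputable def graft {m n a b : ℕ} (i : Fin m) (u : Fin m → L) (w : Fin n → L) :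
    P.X m a →ₗ[K] P.X n b →ₗ[K] LabelledOps P L :=
  (P.circ i (k := m + n - 1) (c := a + b) (by have := i.2; omega) rfl).compr₂
    (lab (graftWord i (by have := i.2; omega) u w))

/-- The definition of `graft` fixes the arity `m + n - 1`; with this lemma, any index equal to it
can be used. The subtraction is harmless since `i` forces `m ≥ 1`. -/
theorem graft_eq {m n k a b c : ℕ} (i : Fin m) (hk : m + n = k + 1) (hc : a + b = c)
    (u : Fin m → L) (w : Fin n → L) (p : P.X m a) (q : P.X n b) :
    graft i u w p q = lab (graftWord i hk u w) (P.circ i hk hc p q) := by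
  obtain rfl : k = m + n - 1 := by omega
  subst hc
  rfl

theorem graft_congr {m n a b : ℕ} (i : Fin m) {u u' : Fin m → L} {w w' : Fin n → L}
    (p : P.X m a) (q : P.X n b) (hu : ∀ y, y ≠ i → u y = u' y) (hw : w = w') :
    graft i u w p q = graft i u' w' p q := by
  have hk : m + n = (m + n - 1) + 1 := by
    have := i.2
    omega
  rw [graft_eq i hk rfl, graft_eq i hk rfl, graftWord_congr i hk hu hw]

theorem relabel_graft (f : L → L') {m n a b : ℕ} (i : Fin m) (u : Fin m → L) (w : Fin n → L)
    (p : P.X m a) (q : P.X n b) :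
    relabel f (graft i u w p q) = graft i (f ∘ u) (f ∘ w) p q := by
  have hk : m + n = (m + n - 1) + 1 := by
    have := i.2
    omega
  rw [graft_eq i hk rfl, graft_eq i hk rfl, relabel_lab, comp_graftWord]

theorem par_graft (e : ℕ) {m n a b : ℕ} (i : Fin m) (u : Fin m → L) (w : Fin n → L)
    (p : P.X m a) (q : P.X n b) :
    par e (graft i u w p q) = (-1 : K) ^ ((a + b) * e) • graft i u w p q := by
  have hk : m + n = (m + n - 1) + 1 := by
    have := i.2
    omega
  rw [graft_eq i hk rfl, par_lab]

theorem graft_act {m n a b : ℕ} (i : Fin m) (u : Fin m → L) (w : Fin n → L)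
    (σ : Equiv.Perm (Fin m)) (τ : Equiv.Perm (Fin n)) (p : P.X m a) (q : P.X n b) :
    graft (σ i) u w (P.ρ m a σ p) (P.ρ n b τ q) = graft i (u ∘ σ) (w ∘ τ) p q := by
  have hk : m + n = (m + n - 1) + 1 := by
    have := i.2
    omega
  rw [graft_eq (σ i) hk rfl, graft_eq i hk rfl, P.circ_equivariant, lab_act, graftWord_permCirc]

theorem graft_act_left {m n a b : ℕ} (i : Fin m) (u : Fin m → L) (w : Fin n → L)
    (σ : Equiv.Perm (Fin m)) (p : P.X m a) (q : P.X n b) :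
    graft (σ i) u w (P.ρ m a σ p) q = graft i (u ∘ σ) w p q := by
  simpa using graft_act i u w σ 1 p q

theorem graft_act_right {m n a b : ℕ} (i : Fin m) (u : Fin m → L) (w : Fin n → L)
    (τ : Equiv.Perm (Fin n)) (p : P.X m a) (q : P.X n b) :
    graft i u w p (P.ρ n b τ q) = graft i u (w ∘ τ) p q := by
  simpa using graft_act i u w 1 τ p q

open scoped Classical in
/-- The derivation of the free `P`-algebra over a map `f` of variables, which sends the variable
`z` to the labelled operation `q`. -/
noncomputable def plug (z : L) (f : L → L') {n b : ℕ} (w : Fin n → L') (q : P.X n b) :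
    LabelledOps P L →ₗ[K] LabelledOps P L' :=
  labLift (fun m _ v => ∑ i : Fin m, if v i = z then (graft i (f ∘ v) w).flip q else 0)
    (fun m d v σ p => by
      simp only [LinearMap.sum_apply]
      -- The inputs of `σ p` are enumerated as `σ i`, which matches the summands through the
      -- equivariance of `graft`.
      rw [← Equiv.sum_comp σ]
      refine Finset.sum_congr rfl (fun i _ => ?_)
      by_cases h : v (σ i) = z
      · simp only [Function.comp, h, if_true]
        exact graft_act_left i (f ∘ v) w σ p q
      · simp [Function.comp, h])

open scoped Classical in
theorem plug_lab (z : L) (f : L → L') {n b : ℕ} (w : Fin n → L') (q : P.X n b) {m a : ℕ}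
    (v : Fin m → L) (p : P.X m a) :
    plug z f w q (lab v p) = ∑ i : Fin m, if v i = z then graft i (f ∘ v) w p q else 0 := by
  rw [plug, labLift_lab, LinearMap.sum_apply]
  refine Finset.sum_congr rfl (fun i _ => ?_)
  split_ifs <;> rfl

theorem plug_lab_of_notMem (z : L) (f : L → L') {n b : ℕ} (w : Fin n → L') (q : P.X n b)
    {m a : ℕ} (v : Fin m → L) (hv : ∀ i, v i ≠ z) (p : P.X m a) :
    plug z f w q (lab v p) = 0 := by
  rw [plug_lab]
  exact Finset.sum_eq_zero (fun i _ => if_neg (hv i))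

theorem plug_lab_of_unique (z : L) (f : L → L') {n b : ℕ} (w : Fin n → L') (q : P.X n b)
    {m a : ℕ} (v : Fin m → L) (i : Fin m) (hi : v i = z) (hv : ∀ j, v j = z → j = i)
    (p : P.X m a) : plug z f w q (lab v p) = graft i (f ∘ v) w p q := by
  rw [plug_lab, Finset.sum_eq_single i (fun j _ hj => if_neg (fun h => hj (hv j h)))
    (fun h => absurd (Finset.mem_univ _) h), if_pos hi]

theorem plug_add (z : L) (f : L → L') {n b : ℕ} (w : Fin n → L') (q q' : P.X n b) :
    plug z f w (q + q') = plug z f w q + plug z f w q' :=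
  lab_hom_ext (fun m a v p => by
    classical
    rw [LinearMap.add_apply, plug_lab, plug_lab, plug_lab, ← Finset.sum_add_distrib]
    refine Finset.sum_congr rfl (fun i _ => ?_)
    split_ifs <;> simp)

theorem plug_smul (z : L) (f : L → L') {n b : ℕ} (w : Fin n → L') (c : K) (q : P.X n b) :
    plug z f w (c • q) = c • plug z f w q :=
  lab_hom_ext (fun m a v p => by
    classical
    rw [LinearMap.smul_apply, plug_lab, plug_lab, Finset.smul_sum]
    refine Finset.sum_congr rfl (fun i _ => ?_)
    split_ifs <;> simp)

theorem plug_act (z : L) (f : L → L') {n b : ℕ} (w : Fin n → L') (τ : Equiv.Perm (Fin n))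
    (q : P.X n b) : plug z f w (P.ρ n b τ q) = plug z f (w ∘ τ) q :=
  lab_hom_ext (fun m a v p => by
    classical
    rw [plug_lab, plug_lab]
    refine Finset.sum_congr rfl (fun i _ => ?_)
    rw [graft_act_right])

theorem plug_comp_relabel {L₀ : Type} (g : L₀ → L) (z : L₀) (z' : L) (hz : ∀ x, g x = z' ↔ x = z)
    (f : L → L') {n b : ℕ} (w : Fin n → L') (q : P.X n b) :
    plug z' f w q ∘ₗ relabel g = plug z (f ∘ g) w q :=
  lab_hom_ext (fun m a v p => by
    classical
    rw [LinearMap.comp_apply, relabel_lab, plug_lab, plug_lab]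
    refine Finset.sum_congr rfl (fun i _ => ?_)
    simp only [Function.comp_apply, hz, Function.comp_assoc])

theorem relabel_comp_plug (g : L' → L'') (z : L) (f : L → L') {n b : ℕ} (w : Fin n → L')
    (q : P.X n b) : relabel g ∘ₗ plug z f w q = plug z (g ∘ f) (g ∘ w) q :=
  lab_hom_ext (fun m a v p => by
    classical
    rw [LinearMap.comp_apply, plug_lab, plug_lab, map_sum]
    refine Finset.sum_congr rfl (fun i _ => ?_)
    split_ifs
    · rw [relabel_graft]
      rfl
    · rw [map_zero])

theorem plug_comp_relabel_eq_zero {L₀ : Type} (g : L₀ → L) (z' : L) (hz : ∀ x, g x ≠ z')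
    (f : L → L') {n b : ℕ} (w : Fin n → L') (q : P.X n b) :
    plug z' f w q ∘ₗ relabel g = 0 :=
  lab_hom_ext (fun m a v p => by
    rw [LinearMap.comp_apply, relabel_lab, LinearMap.zero_apply]
    exact plug_lab_of_notMem _ _ _ _ _ (fun i => hz _) _)

theorem relabel_comp_relabel (g : L' → L'') (f : L → L') :
    relabel (P := P) g ∘ₗ relabel f = relabel (g ∘ f) :=
  lab_hom_ext (fun m a v p => by simp [Function.comp_assoc])

theorem relabel_id : relabel (P := P) (id : L → L) = LinearMap.id :=
  lab_hom_ext (fun m a v p => by simp)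

theorem relabel_comp_par (b : ℕ) (f : L → L') :
    relabel (P := P) f ∘ₗ par b = par b ∘ₗ relabel f :=
  lab_hom_ext (fun m a v p => by simp)

theorem par_comp_par (b c : ℕ) : par (P := P) (L := L) b ∘ₗ par c = par (b + c) :=
  lab_hom_ext (fun m a v p => by simp [smul_smul, ← pow_add, mul_add, add_comm])

/-- Substituting `q` raises the degree by `b`, which changes the sign `(-1) ^ (d * e)` by `(-1) ^ (b
* e)`. -/
theorem plug_comp_par (e : ℕ) (z : L) (f : L → L') {n b : ℕ} (w : Fin n → L') (q : P.X n b) :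
    par e ∘ₗ plug z f w q = (-1 : K) ^ (b * e) • (plug z f w q ∘ₗ par e) :=
  lab_hom_ext (fun m a v p => by
    classical
    simp only [LinearMap.comp_apply, LinearMap.smul_apply, par_lab, map_smul, plug_lab, map_sum,
      Finset.smul_sum]
    refine Finset.sum_congr rfl (fun i _ => ?_)
    split_ifs
    · rw [par_graft, smul_smul, ← pow_add, add_mul, add_comm]
    · simp)

end Labelled

/-! ### Associativity and commutation rules for labelled composites. -/

section LabelledComposites

theorem add_eq_pred_add_one {m : ℕ} (i : Fin m) (n : ℕ) : m + n = (m + n - 1) + 1 := by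
  have := i.2
  omega

variable {K : Type u} [CommRing K] {P : GradedOperad.{u, v} K} {L L' L'' : Type}

theorem graft_assoc {m n s k l a b c e f : ℕ} (i : Fin m) (j : Fin n)
    (hk : m + n = k + 1) (hl : n + s = l + 1) (he : a + b = e) (hf : b + c = f)
    (u : Fin m → L) (w : Fin n → L) (x : Fin s → L) (p : P.X m a) (q : P.X n b) (r : P.X s c) :
    graft (inR i hk j) (graftWord i hk u w) x (P.circ i hk he p q) r =
      graft i u (graftWord j hl w x) p (P.circ j hl hf q r) := by
  have hi := i.2
  have hj := j.2
  have ht : k + s = (m + l - 1) + 1 := by omega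
  have ht' : m + l = (m + l - 1) + 1 := by omega
  rw [graft_eq _ ht rfl, graft_eq i ht' (show a + f = e + c by omega),
    P.circ_assoc' i j hk ht hl ht' he rfl hf (by omega), graftWord_assoc i j hk ht hl ht']

theorem graft_comm {m n₁ n₂ k₁ k₂ a b₁ b₂ e₁ e₂ : ℕ} {i₁ i₂ : Fin m} (h₁₂ : i₁ ≠ i₂)
    (hk₁ : m + n₁ = k₁ + 1) (hk₂ : m + n₂ = k₂ + 1) (he₁ : a + b₁ = e₁) (he₂ : a + b₂ = e₂)
    (u : Fin m → L) (w₁ : Fin n₁ → L) (w₂ : Fin n₂ → L)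
    (p : P.X m a) (q₁ : P.X n₁ b₁) (q₂ : P.X n₂ b₂) :
    graft (inL i₁ hk₁ i₂ h₁₂.symm) (graftWord i₁ hk₁ u w₁) w₂ (P.circ i₁ hk₁ he₁ p q₁) q₂ =
      (-1 : K) ^ (b₁ * b₂) •
        graft (inL i₂ hk₂ i₁ h₁₂) (graftWord i₂ hk₂ u w₂) w₁ (P.circ i₂ hk₂ he₂ p q₂) q₁ := by
  have h1 := i₁.2
  have h2 := i₂.2
  have h3 : (i₁ : ℕ) ≠ i₂ := fun e => h₁₂ (Fin.ext e)
  have ht₁ : k₁ + n₂ = (k₁ + n₂ - 1) + 1 := by omega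
  have ht₂ : k₂ + n₁ = (k₁ + n₂ - 1) + 1 := by omega
  rw [graft_eq _ ht₁ rfl, graft_eq _ ht₂ (show e₂ + b₁ = e₁ + b₂ by omega),
    P.circ_comm' h₁₂ hk₁ ht₁ hk₂ ht₂ he₁ rfl he₂ (by omega), graftWord_comm h₁₂ hk₁ ht₁ hk₂ ht₂,
    map_smul]

-- An input of `p ∘_i q` with label `z` is either an input of `p` other than `i` or an input of `q`.
-- The two sums correspond to parallel and to nested substitutions.
open scoped Classical in
theorem plug_graft (z : L) (f : L → L') {m n s k a b c e : ℕ} (i : Fin m) (hk : m + n = k + 1)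
    (he : a + b = e) (u : Fin m → L) (w : Fin n → L) (x : Fin s → L')
    (p : P.X m a) (q : P.X n b) (r : P.X s c) :
    plug z f x r (graft i u w p q) =
      (∑ j : Fin m, if h : j ≠ i ∧ u j = z then
        graft (inL i hk j h.1) (graftWord i hk (f ∘ u) (f ∘ w)) x (P.circ i hk he p q) r else 0) +
      ∑ l : Fin n, if w l = z then
        graft (inR i hk l) (graftWord i hk (f ∘ u) (f ∘ w)) x (P.circ i hk he p q) r else 0 := by
  rw [graft_eq i hk he, plug_lab, comp_graftWord, ← (insertEquiv i hk).sum_comp,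
    Fintype.sum_sum_type]
  congr 1
  · rw [← Finset.sum_subset (Finset.subset_univ (Finset.univ.filter (fun j => j ≠ i)))
      (fun j _ hj => ?_), Finset.sum_subtype (p := fun j => j ≠ i) _ (by simp)]
    · refine Finset.sum_congr rfl (fun y _ => ?_)
      have h1 : graftWord i hk u w (insertEquiv i hk (Sum.inl y)) = u y.1 :=
        graftWord_inL i hk u w y.1 y.2
      rw [h1]
      by_cases h : u y.1 = z
      · rw [if_pos h, dif_pos ⟨y.2, h⟩]
        rfl
      · rw [if_neg h, dif_neg (fun h' => h h'.2)]
    · exact dif_neg (fun h => hj (by simpa using h.1))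
  · refine Finset.sum_congr rfl (fun y _ => ?_)
    have h1 : graftWord i hk u w (insertEquiv i hk (Sum.inr y)) = w y :=
      graftWord_inR i hk u w y
    rw [h1]
    rfl

/-- After the first substitution the variable `z'` occurs only at the input `j` of the inserted copy
of `q`, so the second substitution takes place inside `q`. -/
theorem plug_comp_plug_assoc (z : L) (f : L → L') {n b : ℕ} (w : Fin n → L') (q : P.X n b)
    (z' : L') (f' : L' → L'') {s c : ℕ} (x : Fin s → L'') (r : P.X s c) (j : Fin n)
    (hf : ∀ y, f y ≠ z') (hw : ∀ y, w y = z' ↔ y = j) {l g : ℕ} (hl : n + s = l + 1)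
    (hg : b + c = g) :
    plug z' f' x r ∘ₗ plug z f w q =
      plug z (f' ∘ f) (graftWord j hl (f' ∘ w) x) (P.circ j hl hg q r) :=
  lab_hom_ext (fun m a v p => by
    classical
    rw [LinearMap.comp_apply, plug_lab, plug_lab, map_sum]
    refine Finset.sum_congr rfl (fun i _ => ?_)
    split_ifs with hi
    · have hk : m + n = (m + n - 1) + 1 := by
        have := i.2
        omega
      rw [plug_graft z' f' i hk rfl, Finset.sum_eq_zero, zero_add, Finset.sum_eq_single j,
        if_pos ((hw j).2 rfl), graft_assoc i j hk hl rfl hg]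
      · rfl
      · intro y _ hy
        exact if_neg (fun h => hy ((hw y).1 h))
      · intro h
        exact absurd (Finset.mem_univ _) h
      · intro y _
        exact dif_neg (fun h => hf _ h.2)
    · rw [map_zero])

/-- By `hw₁` and `hw₂` neither substitution acts on the operation inserted by the other one. Both
sides are then sums over the pairs of distinct inputs labelled `z₁` and `z₂`, and the parallel
composition axiom compares the summands. -/
theorem plug_comp_plug_comm {L₁ L₂ : Type} (z₁ z₂ : L) (f₁ : L → L₁)
    (f₂ : L → L₂) {n₁ b₁ n₂ b₂ : ℕ} (w₁ : Fin n₁ → L₁) (w₂ : Fin n₂ → L₂) (q₁ : P.X n₁ b₁)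
    (q₂ : P.X n₂ b₂) (z₁' : L₂) (z₂' : L₁) (f₁' : L₂ → L') (f₂' : L₁ → L')
    (h₁ : ∀ y, f₁ y = z₂' ↔ y = z₂) (h₂ : ∀ y, f₂ y = z₁' ↔ y = z₁)
    (hw₁ : ∀ y, w₁ y ≠ z₂') (hw₂ : ∀ y, w₂ y ≠ z₁') (hf : f₂' ∘ f₁ = f₁' ∘ f₂) :
    plug z₂' f₂' (f₁' ∘ w₂) q₂ ∘ₗ plug z₁ f₁ w₁ q₁ =
      (-1 : K) ^ (b₁ * b₂) • (plug z₁' f₁' (f₂' ∘ w₁) q₁ ∘ₗ plug z₂ f₂ w₂ q₂) :=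
  lab_hom_ext (fun m a v p => by
    classical
    rw [LinearMap.smul_apply, LinearMap.comp_apply, LinearMap.comp_apply, plug_lab, plug_lab,
      map_sum, map_sum, Finset.smul_sum]
    have e₁ : ∀ i : Fin m, plug z₂' f₂' (f₁' ∘ w₂) q₂
        (if v i = z₁ then graft i (f₁ ∘ v) w₁ p q₁ else 0) =
        ∑ j : Fin m, if h : j ≠ i ∧ v i = z₁ ∧ v j = z₂ then
          graft (inL i (add_eq_pred_add_one i n₁) j h.1)
            (graftWord i (add_eq_pred_add_one i n₁) (f₂' ∘ f₁ ∘ v) (f₂' ∘ w₁)) (f₁' ∘ w₂)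
            (P.circ i (add_eq_pred_add_one i n₁) rfl p q₁) q₂ else 0 := by
      intro i
      have hk := add_eq_pred_add_one i n₁
      split_ifs with hi
      · rw [plug_graft z₂' f₂' i hk rfl, Finset.sum_eq_zero (s := (Finset.univ : Finset (Fin n₁)))
          (fun l _ => if_neg (hw₁ l)), add_zero]
        refine Finset.sum_congr rfl (fun j _ => ?_)
        by_cases h : j ≠ i ∧ v j = z₂
        · rw [dif_pos ⟨h.1, (h₁ _).2 h.2⟩, dif_pos ⟨h.1, hi, h.2⟩]
        · rw [dif_neg (fun h' => h ⟨h'.1, (h₁ _).1 h'.2⟩), dif_neg (fun h' => h ⟨h'.1, h'.2.2⟩)]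
      · rw [map_zero, Finset.sum_eq_zero]
        intro j _
        exact dif_neg (fun h => hi h.2.1)
    have e₂ : ∀ j : Fin m, plug z₁' f₁' (f₂' ∘ w₁) q₁
        (if v j = z₂ then graft j (f₂ ∘ v) w₂ p q₂ else 0) =
        ∑ i : Fin m, if h : i ≠ j ∧ v j = z₂ ∧ v i = z₁ then
          graft (inL j (add_eq_pred_add_one j n₂) i h.1)
            (graftWord j (add_eq_pred_add_one j n₂) (f₁' ∘ f₂ ∘ v) (f₁' ∘ w₂)) (f₂' ∘ w₁)
            (P.circ j (add_eq_pred_add_one j n₂) rfl p q₂) q₁ else 0 := by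
      intro i
      have hk := add_eq_pred_add_one i n₂
      split_ifs with hi
      · rw [plug_graft z₁' f₁' i hk rfl, Finset.sum_eq_zero (s := (Finset.univ : Finset (Fin n₂)))
          (fun l _ => if_neg (hw₂ l)), add_zero]
        refine Finset.sum_congr rfl (fun j _ => ?_)
        by_cases h : j ≠ i ∧ v j = z₁
        · rw [dif_pos ⟨h.1, (h₂ _).2 h.2⟩, dif_pos ⟨h.1, hi, h.2⟩]
        · rw [dif_neg (fun h' => h ⟨h'.1, (h₂ _).1 h'.2⟩), dif_neg (fun h' => h ⟨h'.1, h'.2.2⟩)]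
      · rw [map_zero, Finset.sum_eq_zero]
        intro j _
        exact dif_neg (fun h => hi h.2.1)
    simp only [e₁, e₂, Finset.smul_sum]
    rw [Finset.sum_comm]
    refine Finset.sum_congr rfl (fun j _ => Finset.sum_congr rfl (fun i _ => ?_))
    by_cases h : j ≠ i ∧ v i = z₁ ∧ v j = z₂
    · rw [dif_pos h, dif_pos ⟨h.1.symm, h.2.2, h.2.1⟩, ← Function.comp_assoc, hf,
        graft_comm h.1.symm]
      rfl
    · rw [dif_neg h, dif_neg (fun h' => h ⟨h'.1.symm, h'.2.2, h'.2.1⟩), smul_zero])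

/-- The map which sends a labelled operation `q` to the labelled composite `p ∘_i q`. -/
noncomputable def graftOnto {m a : ℕ} (i : Fin m) (u : Fin m → L') (g : L → L') (p : P.X m a) :
    LabelledOps P L →ₗ[K] LabelledOps P L' :=
  labLift (fun _ _ v => graft i u (g ∘ v) p) (fun _ _ v τ q => graft_act_right i u (g ∘ v) τ p q)

@[simp] theorem graftOnto_lab {m a : ℕ} (i : Fin m) (u : Fin m → L') (g : L → L') (p : P.X m a)
    {n b : ℕ} (v : Fin n → L) (q : P.X n b) :
    graftOnto i u g p (lab v q) = graft i u (g ∘ v) p q := labLift_lab _ _ v q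

theorem graftOnto_add {m a : ℕ} (i : Fin m) (u : Fin m → L') (g : L → L') (p p' : P.X m a) :
    graftOnto i u g (p + p') = graftOnto i u g p + graftOnto i u g p' :=
  lab_hom_ext (fun n b v q => by simp)

theorem graftOnto_smul {m a : ℕ} (i : Fin m) (u : Fin m → L') (g : L → L') (c : K)
    (p : P.X m a) : graftOnto i u g (c • p) = c • graftOnto i u g p :=
  lab_hom_ext (fun n b v q => by simp)

theorem graftOnto_act {m a : ℕ} (i : Fin m) (u : Fin m → L') (g : L → L')
    (σ : Equiv.Perm (Fin m)) (p : P.X m a) :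
    graftOnto (σ i) u g (P.ρ m a σ p) = graftOnto i (u ∘ σ) g p :=
  lab_hom_ext (fun n b v q => by
    rw [graftOnto_lab, graftOnto_lab, graft_act_left])

theorem relabel_comp_graftOnto {m a : ℕ} (f : L' → L'') (i : Fin m) (u : Fin m → L')
    (g : L → L') (p : P.X m a) :
    relabel f ∘ₗ graftOnto i u g p = graftOnto i (f ∘ u) (f ∘ g) p :=
  lab_hom_ext (fun n b v q => by
    rw [LinearMap.comp_apply, graftOnto_lab, graftOnto_lab, relabel_graft]
    rfl)

theorem graftOnto_comp_relabel {m a : ℕ} (i : Fin m) (u : Fin m → L'')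
    (g : L' → L'') (h : L → L') (p : P.X m a) :
    graftOnto i u g p ∘ₗ relabel h = graftOnto i u (g ∘ h) p :=
  lab_hom_ext (fun n b v q => by
    rw [LinearMap.comp_apply, graftOnto_lab, relabel_lab, graftOnto_lab]
    rfl)

theorem graftOnto_comp_graftOnto {m n k a b e : ℕ} (i : Fin m) (j : Fin n) (hk : m + n = k + 1)
    (he : a + b = e) (u : Fin m → L'') (w : Fin n → L') (g₁ : L' → L'') (g₂ : L → L')
    (p : P.X m a) (q : P.X n b) :
    graftOnto i u g₁ p ∘ₗ graftOnto j w g₂ q =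
      graftOnto (inR i hk j) (graftWord i hk u (g₁ ∘ w)) (g₁ ∘ g₂) (P.circ i hk he p q) :=
  lab_hom_ext (fun s c v r => by
    have hl : n + s = (n + s - 1) + 1 := by
      have := j.2
      omega
    rw [LinearMap.comp_apply, graftOnto_lab, graftOnto_lab, graft_eq j hl rfl, graftOnto_lab,
      comp_graftWord, graft_assoc i j hk hl he rfl]
    rfl)

/-- By `hu` the variable `z'` labels no free input of `p`, so every substitution happens inside the
grafted operation and associativity applies. -/
theorem plug_comp_graftOnto {m a s c : ℕ} {L₀ : Type} (z : L) (z' : L') (f' : L' → L'')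
    (x : Fin s → L'') (r : P.X s c) (i : Fin m) (u : Fin m → L') (g : L → L') (p : P.X m a)
    (f : L → L₀) (x₀ : Fin s → L₀) (g' : L₀ → L'') (hu : ∀ y, y ≠ i → u y ≠ z')
    (hg : ∀ y, g y = z' ↔ y = z) (hfg : g' ∘ f = f' ∘ g) (hx : g' ∘ x₀ = x) :
    plug z' f' x r ∘ₗ graftOnto i u g p =
      graftOnto i (f' ∘ u) g' p ∘ₗ plug z f x₀ r :=
  lab_hom_ext (fun n b v q => by
    classical
    have hk := add_eq_pred_add_one i n
    rw [LinearMap.comp_apply, LinearMap.comp_apply, graftOnto_lab, plug_graft z' f' i hk rfl,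
      plug_lab, map_sum, Finset.sum_eq_zero, zero_add]
    · refine Finset.sum_congr rfl (fun l _ => ?_)
      have hl : n + s = (n + s - 1) + 1 := by
        have := l.2
        omega
      simp only [Function.comp_apply, hg]
      split_ifs with h
      · rw [graft_eq l hl rfl, graftOnto_lab, graft_assoc i l hk hl rfl rfl, comp_graftWord, hx]
        change _ = graft i (f' ∘ u) (graftWord l hl ((g' ∘ f) ∘ v) x) p (P.circ l hl rfl q r)
        rw [hfg]
        rfl
      · rw [map_zero]
    · intro y _
      exact dif_neg (fun h => hu y h.1 h.2))

/-- The opposite situation: `z'` labels exactly one free input of `p` and none of the grafted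
operation. The operation `r` is moved past the grafted one, and since the degree of the latter
varies, the sign is recorded by `par c`. -/
theorem plug_comp_graftOnto_comm {m a s c k e : ℕ} (z' : L') (f' : L' → L'')
    (x : Fin s → L'') (r : P.X s c) {i₁ i₂ : Fin m} (h₁₂ : i₁ ≠ i₂) (u : Fin m → L') (g : L → L')
    (p : P.X m a) (hu : ∀ y, y ≠ i₁ → (u y = z' ↔ y = i₂)) (hg : ∀ y, g y ≠ z')
    (hk : m + s = k + 1) (he : a + c = e) :
    plug z' f' x r ∘ₗ graftOnto i₁ u g p =
      graftOnto (inL i₂ hk i₁ h₁₂) (graftWord i₂ hk (f' ∘ u) x) (f' ∘ g) (P.circ i₂ hk he p r) ∘ₗ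
        par c :=
  lab_hom_ext (fun n b v q => by
    classical
    have hk' := add_eq_pred_add_one i₁ n
    have hg' : ∀ l, (g ∘ v) l ≠ z' := fun l => hg (v l)
    rw [LinearMap.comp_apply, LinearMap.comp_apply, graftOnto_lab, plug_graft z' f' i₁ hk' rfl,
      par_lab, map_smul, graftOnto_lab,
      Finset.sum_eq_zero (s := (Finset.univ : Finset (Fin n))) (fun l _ => if_neg (hg' l)),
      add_zero, Finset.sum_eq_single i₂, dif_pos ⟨h₁₂.symm, (hu _ h₁₂.symm).2 rfl⟩,
      graft_comm h₁₂ hk' hk rfl he]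
    · rfl
    · intro y _ hy
      exact dif_neg (fun h => hy ((hu y h.1).1 h.2))
    · intro h
      exact absurd (Finset.mem_univ _) h)

end LabelledComposites

/-! ### Labels `Option (Fin n)`: the inputs together with a cut edge. -/

section Shift

/-- The map of input labels induced by a partial composite `p ∘_i q`, on the inputs of `p`. The
label `none` is fixed, and the input `i` is sent to `none`. -/
noncomputable def outerLabel {m n k : ℕ} (i : Fin m) (hk : m + n = k + 1) :
    Option (Fin m) → Option (Fin k)
  | none => none
  | some a => if h : a = i then none else some (inL i hk a h)

@[simp] theorem outerLabel_none {m n k : ℕ} (i : Fin m) (hk : m + n = k + 1) :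
    outerLabel i hk none = none := rfl

@[simp] theorem outerLabel_self {m n k : ℕ} (i : Fin m) (hk : m + n = k + 1) :
    outerLabel i hk (some i) = none := dif_pos rfl

theorem outerLabel_some {m n k : ℕ} (i : Fin m) (hk : m + n = k + 1) (a : Fin m) (h : a ≠ i) :
    outerLabel i hk (some a) = some (inL i hk a h) := dif_neg h

/-- A substitution at an input of `q` leaves untouched everything that was relabelled by
`outerLabel`. The mixed terms in the associativity of `cutRight` vanish for this reason. -/
theorem outerLabel_ne_inR {m n k : ℕ} (i : Fin m) (hk : m + n = k + 1) (x : Option (Fin m))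
    (j : Fin n) : outerLabel i hk x ≠ some (inR i hk j) := by
  rcases x with _ | a
  · simp
  · by_cases h : a = i
    · subst h
      simp
    · rw [outerLabel_some i hk a h]
      exact fun e => inL_ne_inR i hk a h j (Option.some_injective _ e)

theorem outerLabel_assoc {m n s k l t : ℕ} (i : Fin m) (j : Fin n) (hk : m + n = k + 1)
    (ht : k + s = t + 1) (hl : n + s = l + 1) (ht' : m + l = t + 1) (x : Option (Fin m)) :
    outerLabel (inR i hk j) ht (outerLabel i hk x) = outerLabel i ht' x := by
  rcases x with _ | a
  · simp
  · by_cases h : a = i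
    · subst h
      simp
    · rw [outerLabel_some i hk a h, outerLabel_some _ ht _ (inL_ne_inR _ _ _ _ _),
        outerLabel_some i ht' a h, inL_assoc i j hk ht hl ht']

theorem outerLabel_map_inR {m n s k l t : ℕ} (i : Fin m) (j : Fin n) (hk : m + n = k + 1)
    (ht : k + s = t + 1) (hl : n + s = l + 1) (ht' : m + l = t + 1) (x : Option (Fin n)) :
    outerLabel (inR i hk j) ht (x.map (inR i hk)) = (outerLabel j hl x).map (inR i ht') := by
  rcases x with _ | a
  · simp
  · by_cases h : a = j
    · subst h
      simp
    · have h' : inR i hk a ≠ inR i hk j := fun e => h ((inR_inj i hk).1 e)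
      rw [outerLabel_some j hl a h, Option.map_some, Option.map_some,
        outerLabel_some _ ht _ h', inL_inR_assoc i j hk ht hl ht' a h h']

theorem outerLabel_eq_inL {m n k : ℕ} {i₁ i₂ : Fin m} (h₁₂ : i₁ ≠ i₂) (hk : m + n = k + 1)
    (x : Option (Fin m)) : outerLabel i₁ hk x = some (inL i₁ hk i₂ h₁₂.symm) ↔ x = some i₂ := by
  rcases x with _ | a
  · simp
  · by_cases h : a = i₁
    · subst h
      simp [h₁₂]
    · rw [outerLabel_some i₁ hk a h, Option.some_inj, inL_inj, Option.some_inj]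

theorem outerLabel_comm {m n₁ n₂ k₁ k₂ t : ℕ} {i₁ i₂ : Fin m} (h₁₂ : i₁ ≠ i₂)
    (hk₁ : m + n₁ = k₁ + 1) (ht₁ : k₁ + n₂ = t + 1) (hk₂ : m + n₂ = k₂ + 1)
    (ht₂ : k₂ + n₁ = t + 1) (x : Option (Fin m)) :
    outerLabel (inL i₁ hk₁ i₂ h₁₂.symm) ht₁ (outerLabel i₁ hk₁ x) =
      outerLabel (inL i₂ hk₂ i₁ h₁₂) ht₂ (outerLabel i₂ hk₂ x) := by
  rcases x with _ | a
  · simp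
  · by_cases h₁ : a = i₁
    · subst h₁
      rw [outerLabel_self, outerLabel_some i₂ hk₂ a h₁₂, outerLabel_self, outerLabel_none]
    · by_cases h₂ : a = i₂
      · subst h₂
        rw [outerLabel_self, outerLabel_some i₁ hk₁ a h₁, outerLabel_self, outerLabel_none]
      · have h₁' : inL i₁ hk₁ a h₁ ≠ inL i₁ hk₁ i₂ h₁₂.symm := fun e => h₂ ((inL_inj i₁ hk₁).1 e)
        have h₂' : inL i₂ hk₂ a h₂ ≠ inL i₂ hk₂ i₁ h₁₂ := fun e => h₁ ((inL_inj i₂ hk₂).1 e)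
        rw [outerLabel_some i₁ hk₁ a h₁, outerLabel_some i₂ hk₂ a h₂, outerLabel_some _ ht₁ _ h₁',
          outerLabel_some _ ht₂ _ h₂', inL_comm h₁₂ hk₁ ht₁ hk₂ ht₂ a h₁ h₂]

theorem outerLabel_inR_comm {m n₁ n₂ k₁ k₂ t : ℕ} {i₁ i₂ : Fin m} (h₁₂ : i₁ ≠ i₂)
    (hk₁ : m + n₁ = k₁ + 1) (ht₁ : k₁ + n₂ = t + 1) (hk₂ : m + n₂ = k₂ + 1)
    (ht₂ : k₂ + n₁ = t + 1) (x : Option (Fin n₁)) :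
    outerLabel (inL i₁ hk₁ i₂ h₁₂.symm) ht₁ (x.map (inR i₁ hk₁)) =
      x.map (inR (inL i₂ hk₂ i₁ h₁₂) ht₂) := by
  rcases x with _ | a
  · simp
  · rw [Option.map_some, Option.map_some, outerLabel_some _ ht₁ _ (inL_ne_inR _ _ _ _ _).symm,
      inL_inR_comm h₁₂ hk₁ ht₁ hk₂ ht₂]

theorem outerLabel_perm {m n k : ℕ} (σ : Equiv.Perm (Fin m)) (i : Fin m)
    (τ : Equiv.Perm (Fin n)) (hk : m + n = k + 1) (x : Option (Fin m)) :
    outerLabel (σ i) hk (x.map σ) = (outerLabel i hk x).map (permCirc σ i τ hk) := by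
  rcases x with _ | a
  · simp
  · by_cases h : a = i
    · subst h
      simp
    · rw [Option.map_some, outerLabel_some (σ i) hk _ (fun e => h (σ.injective e)),
        outerLabel_some i hk a h, Option.map_some, permCirc_inL]

/-- Grafting at an input of `q` gives the word that labels the inputs of the inner composite in the
other bracketing. The next two lemmas identify the word of the outer operation for nested and for
parallel composites. -/
theorem graftWord_outerLabel_inR {m n s k l t : ℕ} (i : Fin m) (j : Fin n) (hk : m + n = k + 1)
    (ht : k + s = t + 1) (hl : n + s = l + 1) (ht' : m + l = t + 1) :
    graftWord j hl (outerLabel (inR i hk j) ht ∘ some ∘ inR i hk) (some ∘ inR (inR i hk j) ht) =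
      some ∘ inR i ht' := by
  refine word_ext j hl (fun a h => ?_) (fun a => ?_)
  · rw [graftWord_inL, Function.comp_apply, Function.comp_apply, Function.comp_apply,
      ← Option.map_some, outerLabel_map_inR i j hk ht hl ht', outerLabel_some j hl a h,
      Option.map_some]
  · rw [graftWord_inR, Function.comp_apply, Function.comp_apply, inR_assoc i j hk ht hl ht']

theorem graftWord_outerLabel_outer {m n s k l t : ℕ} (i : Fin m) (j : Fin n) (hk : m + n = k + 1)
    (ht : k + s = t + 1) (hl : n + s = l + 1) (ht' : m + l = t + 1) :
    graftWord i hk (outerLabel i ht' ∘ some) (Option.map (inR i ht') ∘ outerLabel j hl ∘ some) =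
      outerLabel (inR i hk j) ht ∘ some := by
  refine word_ext i hk (fun a h => ?_) (fun a => ?_)
  · rw [graftWord_inL, Function.comp_apply, Function.comp_apply,
      ← outerLabel_assoc i j hk ht hl ht', outerLabel_some i hk a h]
  · rw [graftWord_inR, Function.comp_apply, Function.comp_apply, Function.comp_apply,
      ← outerLabel_map_inR i j hk ht hl ht', Option.map_some]

theorem graftWord_outerLabel_comm {m n₁ n₂ k₁ k₂ t : ℕ} {i₁ i₂ : Fin m} (h₁₂ : i₁ ≠ i₂)
    (hk₁ : m + n₁ = k₁ + 1) (ht₁ : k₁ + n₂ = t + 1) (hk₂ : m + n₂ = k₂ + 1)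
    (ht₂ : k₂ + n₁ = t + 1) :
    graftWord i₂ hk₂ (outerLabel (inL i₁ hk₁ i₂ h₁₂.symm) ht₁ ∘ outerLabel i₁ hk₁ ∘ some)
        (some ∘ inR (inL i₁ hk₁ i₂ h₁₂.symm) ht₁) = outerLabel (inL i₂ hk₂ i₁ h₁₂) ht₂ ∘ some := by
  refine word_ext i₂ hk₂ (fun a h => ?_) (fun a => ?_)
  · rw [graftWord_inL, Function.comp_apply, Function.comp_apply, Function.comp_apply,
      outerLabel_comm h₁₂ hk₁ ht₁ hk₂ ht₂, outerLabel_some i₂ hk₂ a h]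
  · rw [graftWord_inR, Function.comp_apply, Function.comp_apply, ← Option.map_some,
      ← outerLabel_inR_comm h₁₂.symm hk₂ ht₂ hk₁ ht₁, Option.map_some]

end Shift

/-! ### Pairs given by a cut edge, and how they compose. -/

section CutEdge

open TensorProduct

variable {K : Type u} [CommRing K] (P : GradedOperad.{u, v} K)

/-- Pairs of operations with inputs labelled by the elements of `Fin n` and by one more label
`none`, which stands for an edge which has been cut. -/
abbrev CutPairs (n : ℕ) : Type v :=
  LabelledOps P (Option (Fin n)) ⊗[K] LabelledOps P (Option (Fin n))

variable {P}

/-- The right composition products `α ∘_i q`. -/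
noncomputable def cutRight {m n k b : ℕ} (i : Fin m) (hk : m + n = k + 1) (q : P.X n b) :
    CutPairs P m →ₗ[K] CutPairs P k :=
  -- In the first term `q` passes the second factor to reach the first one, whence the sign `par b`;
  -- in the second term it is grafted to the second factor directly.
  TensorProduct.map (plug (some i) (outerLabel i hk) (some ∘ inR i hk) q)
      (par b ∘ₗ relabel (outerLabel i hk)) +
    TensorProduct.map (relabel (outerLabel i hk))
      (plug (some i) (outerLabel i hk) (some ∘ inR i hk) q)

/-- The left composition products `p ∘_i β`. -/
noncomputable def cutLeft {m n k a : ℕ} (i : Fin m) (hk : m + n = k + 1) (p : P.X m a) :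
    CutPairs P n →ₗ[K] CutPairs P k :=
  TensorProduct.map (graftOnto i (outerLabel i hk ∘ some) (Option.map (inR i hk)) p)
    (relabel (Option.map (inR i hk)))

/-- The pair given by the two factors of a composite `p ∘_i q`. -/
noncomputable def cutMid {m n k a b : ℕ} (i : Fin m) (hk : m + n = k + 1) (p : P.X m a)
    (q : P.X n b) : CutPairs P k :=
  lab (outerLabel i hk ∘ some) p ⊗ₜ lab (some ∘ inR i hk) q

/-- The action of permutations on pairs. -/
noncomputable def cutAct {n : ℕ} (σ : Equiv.Perm (Fin n)) : CutPairs P n →ₗ[K] CutPairs P n :=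
  TensorProduct.map (relabel (Option.map σ)) (relabel (Option.map σ))

theorem cutRight_add {m n k b : ℕ} (i : Fin m) (hk : m + n = k + 1) (q q' : P.X n b) :
    cutRight i hk (q + q') = cutRight i hk q + cutRight i hk q' := by
  simp only [cutRight, plug_add, TensorProduct.map_add_left, TensorProduct.map_add_right]
  abel

theorem cutRight_smul {m n k b : ℕ} (i : Fin m) (hk : m + n = k + 1) (c : K) (q : P.X n b) :
    cutRight i hk (c • q) = c • cutRight i hk q := by
  simp only [cutRight, plug_smul, TensorProduct.map_smul_left, TensorProduct.map_smul_right,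
    smul_add]

theorem cutLeft_add {m n k a : ℕ} (i : Fin m) (hk : m + n = k + 1) (p p' : P.X m a) :
    cutLeft (n := n) i hk (p + p') = cutLeft i hk p + cutLeft i hk p' := by
  simp only [cutLeft, graftOnto_add, TensorProduct.map_add_left]

theorem cutLeft_smul {m n k a : ℕ} (i : Fin m) (hk : m + n = k + 1) (c : K) (p : P.X m a) :
    cutLeft (n := n) i hk (c • p) = c • cutLeft i hk p := by
  simp only [cutLeft, graftOnto_smul, TensorProduct.map_smul_left]

theorem cutAct_one {n : ℕ} : cutAct (P := P) (1 : Equiv.Perm (Fin n)) = LinearMap.id := by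
  have h : Option.map (⇑(1 : Equiv.Perm (Fin n))) = id := by
    rw [Equiv.Perm.coe_one, Option.map_id]
  rw [cutAct, h, relabel_id, TensorProduct.map_id]

theorem cutAct_mul {n : ℕ} (σ τ : Equiv.Perm (Fin n)) :
    cutAct (P := P) (σ * τ) = cutAct σ ∘ₗ cutAct τ := by
  rw [cutAct, cutAct, cutAct, ← TensorProduct.map_comp, relabel_comp_relabel,
    Equiv.Perm.coe_mul, ← Option.map_comp_map]

theorem par_relabel_comp {L L' L'' : Type} (b c : ℕ) (g : L' → L'') (f : L → L') :
    (par c ∘ₗ relabel (P := P) g) ∘ₗ (par b ∘ₗ relabel f) = par (b + c) ∘ₗ relabel (g ∘ f) := by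
  rw [LinearMap.comp_assoc, ← LinearMap.comp_assoc _ (par b), relabel_comp_par,
    LinearMap.comp_assoc, relabel_comp_relabel, ← LinearMap.comp_assoc, par_comp_par, add_comm]

theorem plug_comp_par' {L L' : Type} (e : ℕ) (z : L) (f : L → L') {n b : ℕ} (w : Fin n → L')
    (q : P.X n b) :
    plug z f w q ∘ₗ par e = (-1 : K) ^ (b * e) • (par e ∘ₗ plug z f w q) := by
  rw [plug_comp_par, smul_smul, ← mul_pow]
  simp

/-- `r` is grafted to an input of `q`, so it follows `q` into its factor. Of the four terms the two
mixed ones are zero. -/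
theorem cutRight_assoc {m n s k l t b c f : ℕ} (i : Fin m) (j : Fin n)
    (hk : m + n = k + 1) (ht : k + s = t + 1) (hl : n + s = l + 1) (ht' : m + l = t + 1)
    (hf : b + c = f) (q : P.X n b) (r : P.X s c) :
    cutRight (inR i hk j) ht r ∘ₗ cutRight i hk q = cutRight i ht' (P.circ j hl hf q r) := by
  have h₁ : plug (some (inR i hk j)) (outerLabel (inR i hk j) ht) (some ∘ inR (inR i hk j) ht) r ∘ₗ
      plug (some i) (outerLabel i hk) (some ∘ inR i hk) q =
        plug (some i) (outerLabel i ht') (some ∘ inR i ht') (P.circ j hl hf q r) := by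
    rw [plug_comp_plug_assoc _ _ _ _ _ _ _ _ j (fun y => outerLabel_ne_inR i hk y j)
      (fun y => by simp [inR_inj]) hl hf, graftWord_outerLabel_inR i j hk ht hl ht']
    congr 1
    exact funext (outerLabel_assoc i j hk ht hl ht')
  have h₂ : plug (some (inR i hk j)) (outerLabel (inR i hk j) ht)
      (some ∘ inR (inR i hk j) ht) r ∘ₗ relabel (outerLabel i hk) = 0 :=
    plug_comp_relabel_eq_zero _ _ (fun y => outerLabel_ne_inR i hk y j) _ _ _
  have h₃ : relabel (P := P) (outerLabel (inR i hk j) ht) ∘ₗ relabel (outerLabel i hk) =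
      relabel (outerLabel i ht') := by
    rw [relabel_comp_relabel]
    congr 1
    exact funext (outerLabel_assoc i j hk ht hl ht')
  have h₄ : (par c ∘ₗ relabel (P := P) (outerLabel (inR i hk j) ht)) ∘ₗ
      (par b ∘ₗ relabel (outerLabel i hk)) = par f ∘ₗ relabel (outerLabel i ht') := by
    rw [par_relabel_comp, hf, ← relabel_comp_relabel, h₃]
  have h₅ : plug (some (inR i hk j)) (outerLabel (inR i hk j) ht)
      (some ∘ inR (inR i hk j) ht) r ∘ₗ (par b ∘ₗ relabel (outerLabel i hk)) = 0 := by
    rw [← relabel_comp_par, ← LinearMap.comp_assoc, h₂, LinearMap.zero_comp]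
  simp only [cutRight, LinearMap.add_comp, LinearMap.comp_add, ← TensorProduct.map_comp, h₁, h₂,
    h₃, h₄, h₅, TensorProduct.map_zero_left, TensorProduct.map_zero_right, add_zero, zero_add]

theorem cutRight_comp_cutLeft {m n s k l t a c : ℕ} (i : Fin m) (j : Fin n)
    (hk : m + n = k + 1) (ht : k + s = t + 1) (hl : n + s = l + 1) (ht' : m + l = t + 1)
    (p : P.X m a) (r : P.X s c) :
    cutRight (inR i hk j) ht r ∘ₗ cutLeft i hk p = cutLeft i ht' p ∘ₗ cutRight j hl r := by
  have h₀ : ∀ y : Option (Fin n),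
      Option.map (inR i hk) y = some (inR i hk j) ↔ y = some j := by
    rintro (_ | y) <;> simp [inR_inj]
  have h₀' : Option.map (inR i ht') ∘ outerLabel j hl =
      outerLabel (inR i hk j) ht ∘ Option.map (inR i hk) :=
    funext (fun x => (outerLabel_map_inR i j hk ht hl ht' x).symm)
  have h₀'' : Option.map (inR i ht') ∘ some ∘ inR j hl = some ∘ inR (inR i hk j) ht :=
    funext (fun x => by simp [inR_assoc i j hk ht hl ht'])
  have h₁ : plug (some (inR i hk j)) (outerLabel (inR i hk j) ht) (some ∘ inR (inR i hk j) ht) r ∘ₗ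
      graftOnto i (outerLabel i hk ∘ some) (Option.map (inR i hk)) p =
        graftOnto i (outerLabel i ht' ∘ some) (Option.map (inR i ht')) p ∘ₗ
          plug (some j) (outerLabel j hl) (some ∘ inR j hl) r := by
    have hu : ∀ y, y ≠ i → (outerLabel i hk ∘ some) y ≠ some (inR i hk j) :=
      fun y _ => outerLabel_ne_inR i hk (some y) j
    rw [plug_comp_graftOnto (some j) _ _ _ _ _ _ _ _ (outerLabel j hl) (some ∘ inR j hl)
      (Option.map (inR i ht')) hu h₀ h₀' h₀'']
    congr 2
    exact funext (fun y => outerLabel_assoc i j hk ht hl ht' (some y))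
  have h₂ : relabel (P := P) (outerLabel (inR i hk j) ht) ∘ₗ relabel (Option.map (inR i hk)) =
      relabel (Option.map (inR i ht')) ∘ₗ relabel (outerLabel j hl) := by
    rw [relabel_comp_relabel, relabel_comp_relabel, h₀']
  have h₃ : relabel (outerLabel (inR i hk j) ht) ∘ₗ
      graftOnto i (outerLabel i hk ∘ some) (Option.map (inR i hk)) p =
        graftOnto i (outerLabel i ht' ∘ some) (Option.map (inR i ht')) p ∘ₗ
          relabel (outerLabel j hl) := by
    rw [relabel_comp_graftOnto, graftOnto_comp_relabel, h₀']
    congr 1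
    exact funext (fun y => outerLabel_assoc i j hk ht hl ht' (some y))
  have h₄ : plug (some (inR i hk j)) (outerLabel (inR i hk j) ht) (some ∘ inR (inR i hk j) ht) r ∘ₗ
      relabel (Option.map (inR i hk)) =
        relabel (Option.map (inR i ht')) ∘ₗ plug (some j) (outerLabel j hl) (some ∘ inR j hl) r := by
    rw [plug_comp_relabel _ (some j) _ h₀, relabel_comp_plug, h₀', h₀'']
  simp only [cutRight, cutLeft, LinearMap.add_comp, LinearMap.comp_add, ← TensorProduct.map_comp,
    h₁, h₃, h₄, LinearMap.comp_assoc, h₂]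
  simp only [← LinearMap.comp_assoc, relabel_comp_par]

theorem cutLeft_comp_cutLeft {m n s k l t a b e : ℕ} (i : Fin m) (j : Fin n)
    (hk : m + n = k + 1) (ht : k + s = t + 1) (hl : n + s = l + 1) (ht' : m + l = t + 1)
    (he : a + b = e) (p : P.X m a) (q : P.X n b) :
    cutLeft i ht' p ∘ₗ cutLeft j hl q = cutLeft (inR i hk j) ht (P.circ i hk he p q) := by
  have h₀ : Option.map (inR i ht') ∘ Option.map (inR j hl) = Option.map (inR (inR i hk j) ht) := by
    rw [Option.map_comp_map]
    congr 1
    exact funext (fun x => (inR_assoc i j hk ht hl ht' x).symm)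
  rw [cutLeft, cutLeft, cutLeft, ← TensorProduct.map_comp, relabel_comp_relabel, h₀,
    graftOnto_comp_graftOnto i j hk he, h₀, graftWord_outerLabel_outer i j hk ht hl ht']

/-- The input at which `r` is grafted is an input of `q`, which is the second factor; the term with
`r` in the first factor vanishes and no sign appears. -/
theorem cutRight_cutMid {m n s k l t a b c f : ℕ} (i : Fin m) (j : Fin n)
    (hk : m + n = k + 1) (ht : k + s = t + 1) (hl : n + s = l + 1) (ht' : m + l = t + 1)
    (hf : b + c = f) (p : P.X m a) (q : P.X n b) (r : P.X s c) :
    cutRight (inR i hk j) ht r (cutMid i hk p q) = cutMid i ht' p (P.circ j hl hf q r) := by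
  have hj : (some ∘ inR i hk) j = some (inR i hk j) := rfl
  have hv : ∀ y, (outerLabel i hk ∘ some) y ≠ some (inR i hk j) :=
    fun y => outerLabel_ne_inR i hk (some y) j
  rw [cutRight, cutMid, LinearMap.add_apply, TensorProduct.map_tmul, TensorProduct.map_tmul,
    plug_lab_of_notMem _ _ _ _ _ hv, TensorProduct.zero_tmul,
    zero_add, relabel_lab, plug_lab_of_unique _ _ _ _ (some ∘ inR i hk) j hj
      (fun y h => by simpa [inR_inj] using h),
    graft_eq j hl hf, graftWord_outerLabel_inR i j hk ht hl ht', cutMid]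
  congr 2
  exact congrArg _ (funext (fun y => outerLabel_assoc i j hk ht hl ht' (some y)))

theorem cutLeft_cutMid {m n s k l t a b c e : ℕ} (i : Fin m) (j : Fin n)
    (hk : m + n = k + 1) (ht : k + s = t + 1) (hl : n + s = l + 1) (ht' : m + l = t + 1)
    (he : a + b = e) (p : P.X m a) (q : P.X n b) (r : P.X s c) :
    cutLeft i ht' p (cutMid j hl q r) = cutMid (inR i hk j) ht (P.circ i hk he p q) r := by
  rw [cutLeft, cutMid, TensorProduct.map_tmul, graftOnto_lab, relabel_lab, graft_eq i hk he,
    graftWord_outerLabel_outer i j hk ht hl ht', cutMid]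
  congr 2
  exact congrArg _ (funext (fun y => congrArg some (inR_assoc i j hk ht hl ht' y).symm))

/-- If both operations enter the same factor, the sign is that of `plug_comp_plug_comm`. If they
enter different factors, it comes from moving `par` past `plug`, and the two mixed terms are
exchanged. -/
theorem cutRight_comm {m n₁ n₂ k₁ k₂ t b₁ b₂ : ℕ} {i₁ i₂ : Fin m}
    (h₁₂ : i₁ ≠ i₂) (hk₁ : m + n₁ = k₁ + 1) (ht₁ : k₁ + n₂ = t + 1)
    (hk₂ : m + n₂ = k₂ + 1) (ht₂ : k₂ + n₁ = t + 1) (q₁ : P.X n₁ b₁) (q₂ : P.X n₂ b₂) :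
    cutRight (inL i₁ hk₁ i₂ h₁₂.symm) ht₁ q₂ ∘ₗ cutRight i₁ hk₁ q₁ =
      (-1 : K) ^ (b₁ * b₂) • (cutRight (inL i₂ hk₂ i₁ h₁₂) ht₂ q₁ ∘ₗ cutRight i₂ hk₂ q₂) := by
  have hf : outerLabel (inL i₁ hk₁ i₂ h₁₂.symm) ht₁ ∘ outerLabel i₁ hk₁ =
      outerLabel (inL i₂ hk₂ i₁ h₁₂) ht₂ ∘ outerLabel i₂ hk₂ :=
    funext (outerLabel_comm h₁₂ hk₁ ht₁ hk₂ ht₂)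
  have hw₂ : outerLabel (inL i₂ hk₂ i₁ h₁₂) ht₂ ∘ some ∘ inR i₂ hk₂ =
      some ∘ inR (inL i₁ hk₁ i₂ h₁₂.symm) ht₁ :=
    funext (fun y => outerLabel_inR_comm h₁₂.symm hk₂ ht₂ hk₁ ht₁ (some y))
  have hw₁ : outerLabel (inL i₁ hk₁ i₂ h₁₂.symm) ht₁ ∘ some ∘ inR i₁ hk₁ =
      some ∘ inR (inL i₂ hk₂ i₁ h₁₂) ht₂ :=
    funext (fun y => outerLabel_inR_comm h₁₂ hk₁ ht₁ hk₂ ht₂ (some y))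
  have h₁ := plug_comp_plug_comm (P := P) (some i₁) (some i₂) (outerLabel i₁ hk₁)
    (outerLabel i₂ hk₂) (some ∘ inR i₁ hk₁) (some ∘ inR i₂ hk₂) q₁ q₂
    (some (inL i₂ hk₂ i₁ h₁₂)) (some (inL i₁ hk₁ i₂ h₁₂.symm))
    (outerLabel (inL i₂ hk₂ i₁ h₁₂) ht₂) (outerLabel (inL i₁ hk₁ i₂ h₁₂.symm) ht₁)
    (outerLabel_eq_inL h₁₂ hk₁) (outerLabel_eq_inL h₁₂.symm hk₂)
    (fun y e => inL_ne_inR _ _ _ _ _ (Option.some_injective _ e).symm)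
    (fun y e => inL_ne_inR _ _ _ _ _ (Option.some_injective _ e).symm) hf
  rw [hw₁, hw₂] at h₁
  have h₂ : plug (some (inL i₁ hk₁ i₂ h₁₂.symm)) (outerLabel (inL i₁ hk₁ i₂ h₁₂.symm) ht₁)
      (some ∘ inR (inL i₁ hk₁ i₂ h₁₂.symm) ht₁) q₂ ∘ₗ relabel (outerLabel i₁ hk₁) =
      relabel (outerLabel (inL i₂ hk₂ i₁ h₁₂) ht₂) ∘ₗ
        plug (some i₂) (outerLabel i₂ hk₂) (some ∘ inR i₂ hk₂) q₂ := by
    rw [plug_comp_relabel _ (some i₂) _ (outerLabel_eq_inL h₁₂ hk₁), relabel_comp_plug, hf, hw₂]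
  have h₃ : plug (some (inL i₂ hk₂ i₁ h₁₂)) (outerLabel (inL i₂ hk₂ i₁ h₁₂) ht₂)
      (some ∘ inR (inL i₂ hk₂ i₁ h₁₂) ht₂) q₁ ∘ₗ relabel (outerLabel i₂ hk₂) =
      relabel (outerLabel (inL i₁ hk₁ i₂ h₁₂.symm) ht₁) ∘ₗ
        plug (some i₁) (outerLabel i₁ hk₁) (some ∘ inR i₁ hk₁) q₁ := by
    rw [plug_comp_relabel _ (some i₁) _ (outerLabel_eq_inL h₁₂.symm hk₂), relabel_comp_plug, hf,
      hw₁]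
  have h₄ : relabel (P := P) (outerLabel (inL i₁ hk₁ i₂ h₁₂.symm) ht₁) ∘ₗ
      relabel (outerLabel i₁ hk₁) =
      relabel (outerLabel (inL i₂ hk₂ i₁ h₁₂) ht₂) ∘ₗ relabel (outerLabel i₂ hk₂) := by
    rw [relabel_comp_relabel, relabel_comp_relabel, hf]
  have h₅ : (par b₂ ∘ₗ relabel (P := P) (outerLabel (inL i₁ hk₁ i₂ h₁₂.symm) ht₁)) ∘ₗ
      (par b₁ ∘ₗ relabel (outerLabel i₁ hk₁)) =
      (par b₁ ∘ₗ relabel (outerLabel (inL i₂ hk₂ i₁ h₁₂) ht₂)) ∘ₗ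
        (par b₂ ∘ₗ relabel (outerLabel i₂ hk₂)) := by
    rw [par_relabel_comp, par_relabel_comp, hf, add_comm]
  have h₆ : (par b₂ ∘ₗ relabel (outerLabel (inL i₁ hk₁ i₂ h₁₂.symm) ht₁)) ∘ₗ
      plug (some i₁) (outerLabel i₁ hk₁) (some ∘ inR i₁ hk₁) q₁ =
      (-1 : K) ^ (b₁ * b₂) • (plug (some (inL i₂ hk₂ i₁ h₁₂)) (outerLabel (inL i₂ hk₂ i₁ h₁₂) ht₂)
        (some ∘ inR (inL i₂ hk₂ i₁ h₁₂) ht₂) q₁ ∘ₗ (par b₂ ∘ₗ relabel (outerLabel i₂ hk₂))) := by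
    rw [LinearMap.comp_assoc, ← h₃, ← LinearMap.comp_assoc, plug_comp_par, LinearMap.smul_comp,
      LinearMap.comp_assoc]
  have h₇ : plug (some (inL i₁ hk₁ i₂ h₁₂.symm)) (outerLabel (inL i₁ hk₁ i₂ h₁₂.symm) ht₁)
      (some ∘ inR (inL i₁ hk₁ i₂ h₁₂.symm) ht₁) q₂ ∘ₗ (par b₁ ∘ₗ relabel (outerLabel i₁ hk₁)) =
      (-1 : K) ^ (b₁ * b₂) • ((par b₁ ∘ₗ relabel (outerLabel (inL i₂ hk₂ i₁ h₁₂) ht₂)) ∘ₗ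
        plug (some i₂) (outerLabel i₂ hk₂) (some ∘ inR i₂ hk₂) q₂) := by
    rw [LinearMap.comp_assoc, ← h₂, ← LinearMap.comp_assoc, plug_comp_par', mul_comm b₂ b₁,
      LinearMap.smul_comp, LinearMap.comp_assoc]
  simp only [cutRight, LinearMap.add_comp, LinearMap.comp_add, ← TensorProduct.map_comp, h₁, h₂,
    h₅, h₆, h₇, ← h₃, h₄, smul_add, TensorProduct.map_smul_left, TensorProduct.map_smul_right]
  abel

/-- The pairs of total degree `d` in which the labels `none` of the first factor and all the labels
`some i` occur exactly once, the label `none` in the first factor. -/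
def CutPairs.homogeneous (P : GradedOperad.{u, v} K) (n d : ℕ) : Submodule K (CutPairs P n) :=
  Submodule.span K {z | ∃ (m l a b : ℕ) (v : Fin m → Option (Fin n)) (w : Fin l → Option (Fin n))
    (p : P.X m a) (q : P.X l b), a + b = d ∧ Function.Bijective (Sum.elim v w) ∧
      (∃ j, v j = none) ∧ z = lab v p ⊗ₜ lab w q}

/-- `q₂` passes both factors of `β`, which produces `par b₂ ⊗ par b₂`. On pairs of total degree `b₁`
this is multiplication by `(-1) ^ (b₁ * b₂)`; this is why the pairs have to be homogeneous. -/
theorem cutRight_cutLeft_comm {m n₁ n₂ k₁ k₂ t a b₁ b₂ e : ℕ} {i₁ i₂ : Fin m}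
    (h₁₂ : i₁ ≠ i₂) (hk₁ : m + n₁ = k₁ + 1) (ht₁ : k₁ + n₂ = t + 1)
    (hk₂ : m + n₂ = k₂ + 1) (ht₂ : k₂ + n₁ = t + 1) (he : a + b₂ = e)
    (p : P.X m a) (q₂ : P.X n₂ b₂) (β : CutPairs P n₁) (hβ : β ∈ CutPairs.homogeneous P n₁ b₁) :
    cutRight (inL i₁ hk₁ i₂ h₁₂.symm) ht₁ q₂ (cutLeft i₁ hk₁ p β) =
      (-1 : K) ^ (b₁ * b₂) • cutLeft (inL i₂ hk₂ i₁ h₁₂) ht₂ (P.circ i₂ hk₂ he p q₂) β := by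
  have hg : ∀ y : Option (Fin n₁), y.map (inR i₁ hk₁) ≠ some (inL i₁ hk₁ i₂ h₁₂.symm) := by
    rintro (_ | y)
    · simp
    · exact fun h => inL_ne_inR _ _ _ _ _ (Option.some_injective _ h).symm
  have hfg : outerLabel (inL i₁ hk₁ i₂ h₁₂.symm) ht₁ ∘ Option.map (inR i₁ hk₁) =
      Option.map (inR (inL i₂ hk₂ i₁ h₁₂) ht₂) :=
    funext (outerLabel_inR_comm h₁₂ hk₁ ht₁ hk₂ ht₂)
  have hu : ∀ y, y ≠ i₁ →
      ((outerLabel i₁ hk₁ ∘ some) y = some (inL i₁ hk₁ i₂ h₁₂.symm) ↔ y = i₂) := fun y _ => by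
    rw [Function.comp_apply, outerLabel_eq_inL h₁₂, Option.some_inj]
  have h₁ := plug_comp_graftOnto_comm (P := P) (some (inL i₁ hk₁ i₂ h₁₂.symm))
    (outerLabel (inL i₁ hk₁ i₂ h₁₂.symm) ht₁) (some ∘ inR (inL i₁ hk₁ i₂ h₁₂.symm) ht₁) q₂ h₁₂
    (outerLabel i₁ hk₁ ∘ some) (Option.map (inR i₁ hk₁)) p hu hg hk₂ he
  rw [hfg, graftWord_outerLabel_comm h₁₂ hk₁ ht₁ hk₂ ht₂] at h₁
  have h₂ : plug (some (inL i₁ hk₁ i₂ h₁₂.symm)) (outerLabel (inL i₁ hk₁ i₂ h₁₂.symm) ht₁)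
      (some ∘ inR (inL i₁ hk₁ i₂ h₁₂.symm) ht₁) q₂ ∘ₗ relabel (Option.map (inR i₁ hk₁)) = 0 :=
    plug_comp_relabel_eq_zero _ _ hg _ _ _
  have h₃ : (par b₂ ∘ₗ relabel (P := P) (outerLabel (inL i₁ hk₁ i₂ h₁₂.symm) ht₁)) ∘ₗ
      relabel (Option.map (inR i₁ hk₁)) =
      relabel (Option.map (inR (inL i₂ hk₂ i₁ h₁₂) ht₂)) ∘ₗ par b₂ := by
    rw [LinearMap.comp_assoc, relabel_comp_relabel, hfg, relabel_comp_par]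
  have h₄ : cutRight (inL i₁ hk₁ i₂ h₁₂.symm) ht₁ q₂ ∘ₗ cutLeft i₁ hk₁ p =
      cutLeft (inL i₂ hk₂ i₁ h₁₂) ht₂ (P.circ i₂ hk₂ he p q₂) ∘ₗ
        TensorProduct.map (par b₂) (par b₂) := by
    simp only [cutRight, cutLeft, LinearMap.add_comp, ← TensorProduct.map_comp, h₁, h₂, h₃,
      TensorProduct.map_zero_right, add_zero]
  rw [← LinearMap.comp_apply, h₄, LinearMap.comp_apply, ← map_smul]
  congr 1
  induction hβ using Submodule.span_induction with
  | mem z h =>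
    obtain ⟨x, y, c, d, v, w, p, q, hcd, -, -, rfl⟩ := h
    rw [TensorProduct.map_tmul, par_lab, par_lab, TensorProduct.smul_tmul_smul, ← pow_add,
      ← add_mul, hcd]
  | zero => simp
  | add x y _ _ hx hy => rw [map_add, hx, hy, smul_add]
  | smul c x _ hx => rw [map_smul, hx, smul_comm]

/-- `q₂` is grafted to an input of `p`, so only the first term of `cutRight` contributes and the
sign is the one for passing `q₁`. -/
theorem cutRight_cutMid_comm {m n₁ n₂ k₁ k₂ t a b₁ b₂ e : ℕ} {i₁ i₂ : Fin m}
    (h₁₂ : i₁ ≠ i₂) (hk₁ : m + n₁ = k₁ + 1) (ht₁ : k₁ + n₂ = t + 1)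
    (hk₂ : m + n₂ = k₂ + 1) (ht₂ : k₂ + n₁ = t + 1) (he : a + b₂ = e)
    (p : P.X m a) (q₁ : P.X n₁ b₁) (q₂ : P.X n₂ b₂) :
    cutRight (inL i₁ hk₁ i₂ h₁₂.symm) ht₁ q₂ (cutMid i₁ hk₁ p q₁) =
      (-1 : K) ^ (b₁ * b₂) • cutMid (inL i₂ hk₂ i₁ h₁₂) ht₂ (P.circ i₂ hk₂ he p q₂) q₁ := by
  have hw : ∀ y, (some ∘ inR i₁ hk₁) y ≠ some (inL i₁ hk₁ i₂ h₁₂.symm) :=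
    fun y h => inL_ne_inR _ _ _ _ _ (Option.some_injective _ h).symm
  have hv : (outerLabel i₁ hk₁ ∘ some) i₂ = some (inL i₁ hk₁ i₂ h₁₂.symm) :=
    outerLabel_some _ _ _ _
  have hv' : ∀ y, (outerLabel i₁ hk₁ ∘ some) y = some (inL i₁ hk₁ i₂ h₁₂.symm) → y = i₂ :=
    fun y h => by
      rwa [Function.comp_apply, outerLabel_eq_inL h₁₂, Option.some_inj] at h
  have hx : outerLabel (inL i₁ hk₁ i₂ h₁₂.symm) ht₁ ∘ some ∘ inR i₁ hk₁ =
      some ∘ inR (inL i₂ hk₂ i₁ h₁₂) ht₂ :=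
    funext (fun y => outerLabel_inR_comm h₁₂ hk₁ ht₁ hk₂ ht₂ (some y))
  rw [cutRight, cutMid, LinearMap.add_apply, TensorProduct.map_tmul, TensorProduct.map_tmul,
    plug_lab_of_notMem _ _ _ _ _ hw, TensorProduct.tmul_zero, add_zero,
    plug_lab_of_unique _ _ _ _ _ i₂ hv hv', graft_eq i₂ hk₂ he,
    graftWord_outerLabel_comm h₁₂ hk₁ ht₁ hk₂ ht₂, LinearMap.comp_apply, relabel_lab, hx, par_lab,
    TensorProduct.tmul_smul, cutMid]

theorem cutRight_comp_cutAct {m n k b : ℕ} (i : Fin m) (hk : m + n = k + 1)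
    (σ : Equiv.Perm (Fin m)) (τ : Equiv.Perm (Fin n)) (q : P.X n b) :
    cutRight (σ i) hk (P.ρ n b τ q) ∘ₗ cutAct σ =
      cutAct (permCirc σ i τ hk) ∘ₗ cutRight i hk q := by
  have h₀ : outerLabel (σ i) hk ∘ Option.map σ = Option.map (permCirc σ i τ hk) ∘ outerLabel i hk :=
    funext (outerLabel_perm σ i τ hk)
  have h₁ : ∀ x : Option (Fin m), x.map σ = some (σ i) ↔ x = some i := by
    rintro (_ | x) <;> simp
  have h₂ : (some ∘ inR (σ i) hk) ∘ τ = Option.map (permCirc σ i τ hk) ∘ some ∘ inR i hk :=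
    funext (fun y => by simp [permCirc_inR])
  have h₃ : plug (some (σ i)) (outerLabel (σ i) hk) (some ∘ inR (σ i) hk) (P.ρ n b τ q) ∘ₗ
      relabel (Option.map σ) = relabel (Option.map (permCirc σ i τ hk)) ∘ₗ
        plug (some i) (outerLabel i hk) (some ∘ inR i hk) q := by
    rw [plug_act, plug_comp_relabel _ (some i) _ h₁, relabel_comp_plug, h₀, h₂]
  have h₄ : relabel (P := P) (outerLabel (σ i) hk) ∘ₗ relabel (Option.map σ) =
      relabel (Option.map (permCirc σ i τ hk)) ∘ₗ relabel (outerLabel i hk) := by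
    rw [relabel_comp_relabel, relabel_comp_relabel, h₀]
  have h₅ : (par b ∘ₗ relabel (P := P) (outerLabel (σ i) hk)) ∘ₗ relabel (Option.map σ) =
      relabel (Option.map (permCirc σ i τ hk)) ∘ₗ par b ∘ₗ relabel (outerLabel i hk) := by
    rw [LinearMap.comp_assoc, h₄, ← LinearMap.comp_assoc, ← relabel_comp_par, LinearMap.comp_assoc]
  simp only [cutRight, cutAct, LinearMap.add_comp, LinearMap.comp_add, ← TensorProduct.map_comp,
    h₃, h₄, h₅]

theorem cutLeft_comp_cutAct {m n k a : ℕ} (i : Fin m) (hk : m + n = k + 1)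
    (σ : Equiv.Perm (Fin m)) (τ : Equiv.Perm (Fin n)) (p : P.X m a) :
    cutLeft (σ i) hk (P.ρ m a σ p) ∘ₗ cutAct τ =
      cutAct (permCirc σ i τ hk) ∘ₗ cutLeft i hk p := by
  have h₀ : (outerLabel (σ i) hk ∘ some) ∘ σ =
      Option.map (permCirc σ i τ hk) ∘ outerLabel i hk ∘ some :=
    funext (fun y => outerLabel_perm σ i τ hk (some y))
  have h₁ : Option.map (inR (σ i) hk) ∘ Option.map τ =
      Option.map (permCirc σ i τ hk) ∘ Option.map (inR i hk) := by
    rw [Option.map_comp_map, Option.map_comp_map]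
    congr 1
    exact funext (fun y => (permCirc_inR σ i τ hk y).symm)
  rw [cutLeft, cutLeft, cutAct, cutAct, ← TensorProduct.map_comp, ← TensorProduct.map_comp,
    graftOnto_act, graftOnto_comp_relabel, relabel_comp_graftOnto, relabel_comp_relabel,
    relabel_comp_relabel, h₀, h₁]

theorem cutMid_act {m n k a b : ℕ} (i : Fin m) (hk : m + n = k + 1)
    (σ : Equiv.Perm (Fin m)) (τ : Equiv.Perm (Fin n)) (p : P.X m a) (q : P.X n b) :
    cutMid (σ i) hk (P.ρ m a σ p) (P.ρ n b τ q) =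
      cutAct (permCirc σ i τ hk) (cutMid i hk p q) := by
  have h₀ : (outerLabel (σ i) hk ∘ some) ∘ σ =
      Option.map (permCirc σ i τ hk) ∘ outerLabel i hk ∘ some :=
    funext (fun y => outerLabel_perm σ i τ hk (some y))
  have h₂ : (some ∘ inR (σ i) hk) ∘ τ = Option.map (permCirc σ i τ hk) ∘ some ∘ inR i hk :=
    funext (fun y => by simp [permCirc_inR])
  rw [cutMid, cutMid, lab_act, lab_act, cutAct, TensorProduct.map_tmul, relabel_lab, relabel_lab,
    h₀, h₂]

end CutEdge

/-! ### Homogeneous pairs, and compatibility with the unit. -/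

section CutOperad

open TensorProduct

variable {K : Type u} [CommRing K] {P : GradedOperad.{u, v} K}

/-- There are as many inputs, `m + l`, as labels, `n + 1`, so surjectivity of the labelling suffices
for bijectivity. -/
theorem CutPairs.tmul_mem {n m l a b d : ℕ} (hd : a + b = d) (hn : m + l = n + 1)
    (v : Fin m → Option (Fin n)) (w : Fin l → Option (Fin n)) (p : P.X m a) (q : P.X l b)
    (hv : ∃ j, v j = none) (h : ∀ x, (∃ j, v j = some x) ∨ ∃ j, w j = some x) :
    (lab v p ⊗ₜ[K] lab w q : CutPairs P n) ∈ CutPairs.homogeneous P n d := by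
  refine Submodule.subset_span ⟨m, l, a, b, v, w, p, q, hd, ?_, hv, rfl⟩
  refine (Fintype.bijective_iff_surjective_and_card _).2 ⟨?_, by simp [hn]⟩
  rintro (_ | x)
  · exact hv.imp' Sum.inl (fun j hj => hj)
  · obtain ⟨j, hj⟩ | ⟨j, hj⟩ := h x
    · exact ⟨Sum.inl j, hj⟩
    · exact ⟨Sum.inr j, hj⟩

theorem CutPairs.homogeneous_induction {n d : ℕ} {C : CutPairs P n → Prop}
    (zero : C 0) (add : ∀ x y, C x → C y → C (x + y)) (smul : ∀ (c : K) x, C x → C (c • x))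
    (mem : ∀ (m l a b : ℕ) (v : Fin m → Option (Fin n)) (w : Fin l → Option (Fin n))
      (p : P.X m a) (q : P.X l b), a + b = d → m + l = n + 1 → Function.Injective v →
      Function.Injective w → (∀ i j, v i ≠ w j) → (∃ j, v j = none) →
      (∀ x, (∃ j, v j = some x) ∨ ∃ j, w j = some x) → C (lab v p ⊗ₜ lab w q))
    {z : CutPairs P n} (hz : z ∈ CutPairs.homogeneous P n d) : C z := by
  induction hz using Submodule.span_induction with
  | mem z h =>
    obtain ⟨m, l, a, b, v, w, p, q, hd, hb, hv, rfl⟩ := h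
    have hc := Fintype.card_of_bijective hb
    refine mem m l a b v w p q hd (by simpa using hc) (hb.1.comp Sum.inl_injective)
      (hb.1.comp Sum.inr_injective) (fun i j h => ?_) hv (fun x => ?_)
    · exact Sum.inl_ne_inr (hb.1 (a₁ := Sum.inl i) (a₂ := Sum.inr j) h)
    · obtain ⟨j | j, hj⟩ := hb.2 (some x)
      · exact Or.inl ⟨j, hj⟩
      · exact Or.inr ⟨j, hj⟩
  | zero => exact zero
  | add x y _ _ hx hy => exact add x y hx hy
  | smul c x _ hx => exact smul c x hx

theorem cutMid_mem {m n k a b c : ℕ} (i : Fin m) (hk : m + n = k + 1) (hc : a + b = c)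
    (p : P.X m a) (q : P.X n b) : cutMid i hk p q ∈ CutPairs.homogeneous P k c := by
  refine CutPairs.tmul_mem hc hk _ _ p q ⟨i, outerLabel_self i hk⟩ (fun x => ?_)
  obtain ⟨a, h, rfl⟩ | ⟨j, rfl⟩ := ins_cases i hk x
  · exact Or.inl ⟨a, outerLabel_some i hk a h⟩
  · exact Or.inr ⟨j, rfl⟩

theorem cutLeft_mem {m n k a b c : ℕ} (i : Fin m) (hk : m + n = k + 1) (hc : a + b = c)
    (p : P.X m a) {β : CutPairs P n} (hβ : β ∈ CutPairs.homogeneous P n b) :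
    cutLeft i hk p β ∈ CutPairs.homogeneous P k c := by
  refine CutPairs.homogeneous_induction
    (C := fun β => cutLeft i hk p β ∈ CutPairs.homogeneous P k c) ?_ ?_ ?_ ?_ hβ
  · rw [map_zero]
    exact Submodule.zero_mem _
  · intro x y hx hy
    rw [map_add]
    exact Submodule.add_mem _ hx hy
  · intro c x hx
    rw [map_smul]
    exact Submodule.smul_mem _ c hx
  intro x y e f v w q r hd hn _ _ _ ⟨j, hj⟩ hs
  have hi : m + x = (m + x - 1) + 1 := add_eq_pred_add_one i x
  rw [cutLeft, TensorProduct.map_tmul, graftOnto_lab, graft_eq i hi rfl, relabel_lab]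
  refine CutPairs.tmul_mem (by omega) (by omega) _ _ _ _ ⟨inR i hi j, ?_⟩ (fun z => ?_)
  · rw [graftWord_inR, Function.comp_apply, hj, Option.map_none]
  obtain ⟨a, h, rfl⟩ | ⟨z, rfl⟩ := ins_cases i hk z
  · exact Or.inl ⟨inL i hi a h, by rw [graftWord_inL, Function.comp_apply, outerLabel_some i hk a h]⟩
  · obtain ⟨z, hz⟩ | ⟨z, hz⟩ := hs z
    · exact Or.inl ⟨inR i hi z, by rw [graftWord_inR, Function.comp_apply, hz, Option.map_some]⟩
    · exact Or.inr ⟨z, by rw [Function.comp_apply, hz, Option.map_some]⟩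

/-- The label of `i` occurs in exactly one of the two factors, so one of the terms of `cutRight`
vanishes and the other one has a single summand. -/
theorem cutRight_mem {m n k a b c : ℕ} (i : Fin m) (hk : m + n = k + 1) (hc : a + b = c)
    (q : P.X n b) {α : CutPairs P m} (hα : α ∈ CutPairs.homogeneous P m a) :
    cutRight i hk q α ∈ CutPairs.homogeneous P k c := by
  refine CutPairs.homogeneous_induction
    (C := fun α => cutRight i hk q α ∈ CutPairs.homogeneous P k c) ?_ ?_ ?_ ?_ hα
  · rw [map_zero]
    exact Submodule.zero_mem _
  · intro x y hx hy
    rw [map_add]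
    exact Submodule.add_mem _ hx hy
  · intro c x hx
    rw [map_smul]
    exact Submodule.smul_mem _ c hx
  intro x y e f v w p r hd hn hv hw hvw ⟨j, hj⟩ hs
  rw [cutRight, LinearMap.add_apply, TensorProduct.map_tmul, TensorProduct.map_tmul]
  obtain ⟨z, hz⟩ | ⟨z, hz⟩ := hs i
  · have hi : x + n = (x + n - 1) + 1 := add_eq_pred_add_one z n
    have hjz : j ≠ z := by
      rintro rfl
      rw [hj] at hz
      exact Option.some_ne_none _ hz.symm
    rw [plug_lab_of_unique _ _ _ _ v z hz (fun y hy => hv (hy.trans hz.symm)),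
      plug_lab_of_notMem _ _ _ _ w (fun y hy => hvw z y (hz.trans hy.symm)),
      TensorProduct.tmul_zero, add_zero, LinearMap.comp_apply, relabel_lab, par_lab,
      graft_eq z hi rfl, TensorProduct.tmul_smul]
    refine Submodule.smul_mem _ _
      (CutPairs.tmul_mem (by omega) (by omega) _ _ _ _ ⟨inL z hi j hjz, ?_⟩ (fun t => ?_))
    · rw [graftWord_inL, Function.comp_apply, hj, outerLabel_none]
    obtain ⟨a, h, rfl⟩ | ⟨t, rfl⟩ := ins_cases i hk t
    · obtain ⟨t, ht⟩ | ⟨t, ht⟩ := hs a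
      · have htz : t ≠ z := by
          rintro rfl
          exact h (Option.some_injective _ (ht.symm.trans hz))
        exact Or.inl ⟨inL z hi t htz, by
          rw [graftWord_inL, Function.comp_apply, ht, outerLabel_some i hk a h]⟩
      · exact Or.inr ⟨t, by rw [Function.comp_apply, ht, outerLabel_some i hk a h]⟩
    · exact Or.inl ⟨inR z hi t, by rw [graftWord_inR, Function.comp_apply]⟩
  · have hi : y + n = (y + n - 1) + 1 := add_eq_pred_add_one z n
    rw [plug_lab_of_unique _ _ _ _ w z hz (fun y hy => hw (hy.trans hz.symm)),
      plug_lab_of_notMem _ _ _ _ v (fun y hy => hvw y z (hy.trans hz.symm)),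
      TensorProduct.zero_tmul, zero_add, relabel_lab, graft_eq z hi rfl]
    refine CutPairs.tmul_mem (by omega) (by omega) _ _ _ _ ⟨j, ?_⟩ (fun t => ?_)
    · rw [Function.comp_apply, hj, outerLabel_none]
    obtain ⟨a, h, rfl⟩ | ⟨t, rfl⟩ := ins_cases i hk t
    · obtain ⟨t, ht⟩ | ⟨t, ht⟩ := hs a
      · exact Or.inl ⟨t, by rw [Function.comp_apply, ht, outerLabel_some i hk a h]⟩
      · have htz : t ≠ z := by
          rintro rfl
          exact h (Option.some_injective _ (ht.symm.trans hz))
        exact Or.inr ⟨inL z hi t htz, by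
          rw [graftWord_inL, Function.comp_apply, ht, outerLabel_some i hk a h]⟩
    · exact Or.inr ⟨inR z hi t, by rw [graftWord_inR, Function.comp_apply]⟩

theorem cutAct_mem {n a : ℕ} (σ : Equiv.Perm (Fin n)) {α : CutPairs P n}
    (hα : α ∈ CutPairs.homogeneous P n a) : cutAct σ α ∈ CutPairs.homogeneous P n a := by
  refine CutPairs.homogeneous_induction
    (C := fun α => cutAct σ α ∈ CutPairs.homogeneous P n a) ?_ ?_ ?_ ?_ hα
  · rw [map_zero]
    exact Submodule.zero_mem _
  · intro x y hx hy
    rw [map_add]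
    exact Submodule.add_mem _ hx hy
  · intro c x hx
    rw [map_smul]
    exact Submodule.smul_mem _ c hx
  intro x y e f v w p r hd hn hv hw hvw ⟨j, hj⟩ hs
  rw [cutAct, TensorProduct.map_tmul, relabel_lab, relabel_lab]
  refine CutPairs.tmul_mem hd hn _ _ p r ⟨j, by rw [Function.comp_apply, hj, Option.map_none]⟩
    (fun t => ?_)
  obtain ⟨t, rfl⟩ := σ.surjective t
  refine (hs t).imp ?_ ?_ <;>
  · rintro ⟨z, hz⟩
    exact ⟨z, by rw [Function.comp_apply, hz, Option.map_some]⟩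

theorem outerLabel_one {m : ℕ} (i : Fin m) (hk : m + 1 = m + 1) (a : Fin m) (h : a ≠ i) :
    outerLabel i hk (some a) = some a := by
  rw [outerLabel_some i hk a h, Option.some_inj]
  apply Fin.ext
  have h' : (a : ℕ) ≠ i := fun e => h (Fin.ext e)
  rw [inL_val]
  split_ifs <;> omega

theorem inR_one {m : ℕ} (i : Fin m) (hk : m + 1 = m + 1) (j : Fin 1) : inR i hk j = i := by
  apply Fin.ext
  rw [inR_val]
  omega

theorem one_inR {n : ℕ} (i : Fin 1) (hk : 1 + n = n + 1) (j : Fin n) : inR i hk j = j := by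
  apply Fin.ext
  rw [inR_val]
  omega

theorem graft_one {L : Type} {m a : ℕ} (i : Fin m) (u : Fin m → L) (w : Fin 1 → L)
    (p : P.X m a) (h : w 0 = u i) : graft i u w p P.one = lab u p := by
  rw [graft_eq i rfl rfl, P.circ_one]
  congr 1
  refine congrArg _ (word_ext i rfl (fun y hy => ?_) (fun y => ?_))
  · rw [graftWord_inL]
    exact congrArg u (Option.some_injective _
      ((outerLabel_one i rfl y hy).symm.trans (outerLabel_some i rfl y hy)))
  · rw [graftWord_inR, inR_one, Subsingleton.elim y 0, h]

theorem one_graft {L : Type} {n b : ℕ} (i : Fin 1) (u : Fin 1 → L) (w : Fin n → L)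
    (q : P.X n b) : graft i u w P.one q = lab w q := by
  rw [graft_eq i (add_comm 1 n) (zero_add b), P.one_circ]
  congr 1
  refine congrArg _ (word_ext i (add_comm 1 n) (fun y hy => ?_) (fun y => ?_))
  · exact absurd (Subsingleton.elim y i) hy
  · rw [graftWord_inR, one_inR]

theorem cutLeft_one {n : ℕ} (i : Fin 1) (hk : 1 + n = n + 1) (β : CutPairs P n) :
    cutLeft i hk P.one β = β := by
  have h₀ : Option.map (inR (n := n) i hk) = id := by
    rw [show inR i hk = id from funext (one_inR i hk), Option.map_id]
  have h : cutLeft (n := n) i hk P.one = LinearMap.id := by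
    have h₁ : graftOnto (P := P) i (outerLabel i hk ∘ some) id P.one = LinearMap.id :=
      lab_hom_ext (fun _ _ _ _ => by rw [graftOnto_lab, one_graft]; rfl)
    rw [cutLeft, h₀, h₁, relabel_id, TensorProduct.map_id]
  rw [h, LinearMap.id_apply]

/-- Homogeneity is needed: `cutRight` contributes once for each occurrence of the label of `i`, and
it is the identity here because this label occurs exactly once. -/
theorem cutRight_one {m a : ℕ} (i : Fin m) (hk : m + 1 = m + 1) {α : CutPairs P m}
    (hα : α ∈ CutPairs.homogeneous P m a) : cutRight i hk P.one α = α := by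
  refine CutPairs.homogeneous_induction (C := fun α => cutRight i hk P.one α = α) ?_ ?_ ?_ ?_ hα
  · rw [map_zero]
  · intro x y hx hy
    rw [map_add, hx, hy]
  · intro c x hx
    rw [map_smul, hx]
  intro x y e f v w p r hd hn hv hw hvw _ hs
  have h₀ : ∀ z : Option (Fin m), z ≠ some i → outerLabel i hk z = z := by
    rintro (_ | z) hz
    · rfl
    · exact outerLabel_one i hk z (fun h => hz (congrArg some h))
  rw [cutRight, LinearMap.add_apply, TensorProduct.map_tmul, TensorProduct.map_tmul]
  have h₁ : ∀ {x e : ℕ} (v : Fin x → Option (Fin m)) (p : P.X x e) (z : Fin x) (_ : v z = some i)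
      (_ : Function.Injective v),
      plug (some i) (outerLabel i hk) (some ∘ inR i hk) P.one (lab v p) = lab v p := by
    intro x e v p z hz hv
    rw [plug_lab_of_unique _ _ _ _ v z hz (fun y hy => hv (hy.trans hz.symm)),
      graft_congr z (u' := v) (w' := some ∘ inR i hk) p P.one ?_ rfl, graft_one]
    · rw [Function.comp_apply, inR_one, hz]
    · exact fun y hy => h₀ _ (fun h => hy (hv (h.trans hz.symm)))
  have h₂ : ∀ {x e : ℕ} (v : Fin x → Option (Fin m)) (p : P.X x e) (_ : ∀ z, v z ≠ some i),
      relabel (outerLabel i hk) (lab v p) = lab v p := by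
    intro x e v p hv
    rw [relabel_lab]
    exact congrArg (fun v => lab v p) (funext (fun z => h₀ _ (hv z)))
  obtain ⟨z, hz⟩ | ⟨z, hz⟩ := hs i
  · have hw' : ∀ y, w y ≠ some i := fun y hy => hvw z y (hz.trans hy.symm)
    rw [h₁ v p z hz hv, plug_lab_of_notMem _ _ _ _ w hw', TensorProduct.tmul_zero, add_zero,
      LinearMap.comp_apply, h₂ w r hw', par_lab, mul_zero, pow_zero, one_smul]
  · have hv' : ∀ y, v y ≠ some i := fun y hy => hvw y z (hy.trans hz.symm)
    rw [h₁ w r z hz hw, plug_lab_of_notMem _ _ _ _ v hv', TensorProduct.zero_tmul, zero_add,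
      h₂ v p hv']

variable (P) in
/-- The component of the unit of `cutExt P` in the pairs. -/
noncomputable def cutUnit : CutPairs P 1 :=
  -(lab (fun _ : Fin 1 => (none : Option (Fin 1))) P.one ⊗ₜ[K]
    lab (fun _ : Fin 1 => some (0 : Fin 1)) P.one)

theorem cutUnit_mem : cutUnit P ∈ CutPairs.homogeneous P 1 0 := by
  rw [cutUnit]
  refine Submodule.neg_mem _ (CutPairs.tmul_mem (add_zero 0) rfl _ _ _ _ ⟨0, rfl⟩
    (fun x => Or.inr ⟨0, congrArg some (Subsingleton.elim _ _)⟩))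

/-- This explains the sign of `cutUnit`: since composing with the unit must not create an edge, the
cut of the unit has to cancel the term `1 ⊗ q` of the new edge. -/
theorem cutRight_unit {n b : ℕ} (i : Fin 1) (hk : 1 + n = n + 1) (q : P.X n b) :
    cutRight i hk q (cutUnit P) = -cutMid i hk P.one q := by
  have h₀ : some 0 = some i := congrArg some (Subsingleton.elim _ _)
  have h₁ : (outerLabel i hk ∘ fun _ : Fin 1 => none) = outerLabel i hk ∘ some := by
    funext y
    rw [Function.comp_apply, Function.comp_apply, outerLabel_none, Subsingleton.elim y i,
      outerLabel_self]
  rw [cutUnit, map_neg, neg_inj, cutRight, LinearMap.add_apply, TensorProduct.map_tmul,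
    TensorProduct.map_tmul,
    plug_lab_of_notMem (some i) _ _ _ (fun _ => none) (fun _ => Option.some_ne_none _ ∘ Eq.symm),
    TensorProduct.zero_tmul, zero_add,
    plug_lab_of_unique (some i) _ _ _ (fun _ => some 0) 0 h₀ (fun _ _ => Subsingleton.elim _ _),
    one_graft, relabel_lab, h₁, cutMid]

theorem cutLeft_unit {m a : ℕ} (i : Fin m) (hk : m + 1 = m + 1) (p : P.X m a) :
    cutLeft i hk p (cutUnit P) = -cutMid i hk p P.one := by
  have h₀ : (Option.map (inR i hk) ∘ fun _ => some 0) = some ∘ inR i hk :=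
    funext (fun y => by rw [Subsingleton.elim y 0]; rfl)
  rw [cutUnit, map_neg, neg_inj, cutLeft, TensorProduct.map_tmul, graftOnto_lab, relabel_lab, h₀,
    graft_one _ _ _ _ (by simp), cutMid]

end CutOperad

/-! ### The operad of pairs (operation, combination of cut pairs). -/

section CutExtension

variable {K : Type u} [CommRing K] (P : GradedOperad.{u, v} K)

theorem cutMid_add_left {m n k a b : ℕ} (i : Fin m) (hk : m + n = k + 1) (p p' : P.X m a)
    (q : P.X n b) : cutMid i hk (p + p') q = cutMid i hk p q + cutMid i hk p' q := by
  rw [cutMid, map_add, TensorProduct.add_tmul, cutMid, cutMid]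

theorem cutMid_add_right {m n k a b : ℕ} (i : Fin m) (hk : m + n = k + 1) (p : P.X m a)
    (q q' : P.X n b) : cutMid i hk p (q + q') = cutMid i hk p q + cutMid i hk p q' := by
  rw [cutMid, map_add, TensorProduct.tmul_add, cutMid, cutMid]

theorem cutMid_smul_left {m n k a b : ℕ} (i : Fin m) (hk : m + n = k + 1) (c : K) (p : P.X m a)
    (q : P.X n b) : cutMid i hk (c • p) q = c • cutMid i hk p q := by
  rw [cutMid, map_smul, ← TensorProduct.smul_tmul', cutMid]

theorem cutMid_smul_right {m n k a b : ℕ} (i : Fin m) (hk : m + n = k + 1) (c : K) (p : P.X m a)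
    (q : P.X n b) : cutMid i hk p (c • q) = c • cutMid i hk p q := by
  rw [cutMid, map_smul, TensorProduct.tmul_smul, cutMid]

/-- The pair part of the composition products of `cutExt P`. -/
noncomputable def cutCirc {m n k a b : ℕ} (i : Fin m) (hk : m + n = k + 1)
    (x : P.X m a × CutPairs P m) (y : P.X n b × CutPairs P n) : CutPairs P k :=
  cutRight i hk y.1 x.2 + cutLeft i hk x.1 y.2 + cutMid i hk x.1 y.1

variable {P} in
theorem cutCirc_mem {m n k a b c : ℕ} (i : Fin m) (hk : m + n = k + 1) (hc : a + b = c)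
    {x : P.X m a × CutPairs P m} {y : P.X n b × CutPairs P n}
    (hx : x.2 ∈ CutPairs.homogeneous P m a) (hy : y.2 ∈ CutPairs.homogeneous P n b) :
    cutCirc P i hk x y ∈ CutPairs.homogeneous P k c :=
  Submodule.add_mem _ (Submodule.add_mem _ (cutRight_mem i hk hc _ hx) (cutLeft_mem i hk hc _ hy))
    (cutMid_mem i hk hc _ _)

variable {P}

/-- Both sides have five terms, for a cut inside `p`, inside `q`, inside `r`, or at one of the two
edges between them; they agree term by term. -/
theorem cutCirc_assoc {m n s k l t a b c e f : ℕ} (i : Fin m) (j : Fin n)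
    (hk : m + n = k + 1) (ht : k + s = t + 1) (hl : n + s = l + 1) (ht' : m + l = t + 1)
    (he : a + b = e) (hf : b + c = f) (p : P.X m a) (α : CutPairs P m) (q : P.X n b)
    (β : CutPairs P n) (r : P.X s c) (γ : CutPairs P s) :
    cutCirc P (inR i hk j) ht (P.circ i hk he p q, cutCirc P i hk (p, α) (q, β)) (r, γ) =
      cutCirc P i ht' (p, α) (P.circ j hl hf q r, cutCirc P j hl (q, β) (r, γ)) := by
  simp only [cutCirc, map_add]
  rw [← LinearMap.comp_apply (cutRight (inR i hk j) ht r), cutRight_assoc i j hk ht hl ht' hf,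
    ← LinearMap.comp_apply (cutRight (inR i hk j) ht r), cutRight_comp_cutLeft i j hk ht hl ht',
    cutRight_cutMid i j hk ht hl ht' hf, ← cutLeft_comp_cutLeft i j hk ht hl ht' he,
    ← cutLeft_cutMid i j hk ht hl ht' he, LinearMap.comp_apply, LinearMap.comp_apply]
  abel

/-- The same five kinds of terms. The commutation rules for a cut inside or above `q₂` are those for
`q₁` with the roles exchanged, so the sign has to be squared away (`hs`). -/
theorem cutCirc_comm {m n₁ n₂ k₁ k₂ t a b₁ b₂ e₁ e₂ : ℕ} {i₁ i₂ : Fin m} (h₁₂ : i₁ ≠ i₂)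
    (hk₁ : m + n₁ = k₁ + 1) (ht₁ : k₁ + n₂ = t + 1) (hk₂ : m + n₂ = k₂ + 1)
    (ht₂ : k₂ + n₁ = t + 1) (he₁ : a + b₁ = e₁) (he₂ : a + b₂ = e₂) (p : P.X m a)
    (α : CutPairs P m) (q₁ : P.X n₁ b₁) {β : CutPairs P n₁} (q₂ : P.X n₂ b₂) {γ : CutPairs P n₂}
    (hβ : β ∈ CutPairs.homogeneous P n₁ b₁) (hγ : γ ∈ CutPairs.homogeneous P n₂ b₂) :
    cutCirc P (inL i₁ hk₁ i₂ h₁₂.symm) ht₁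
        (P.circ i₁ hk₁ he₁ p q₁, cutCirc P i₁ hk₁ (p, α) (q₁, β)) (q₂, γ) =
      (-1 : K) ^ (b₁ * b₂) • cutCirc P (inL i₂ hk₂ i₁ h₁₂) ht₂
        (P.circ i₂ hk₂ he₂ p q₂, cutCirc P i₂ hk₂ (p, α) (q₂, γ)) (q₁, β) := by
  have hs : ∀ z : CutPairs P t, (-1 : K) ^ (b₁ * b₂) • (-1 : K) ^ (b₁ * b₂) • z = z := fun z => by
    rw [smul_smul, ← mul_pow]
    simp
  have h₁ := congrArg (fun f => f α) (cutRight_comm h₁₂ hk₁ ht₁ hk₂ ht₂ q₁ q₂)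
  have h₂ := cutRight_cutLeft_comm h₁₂ hk₁ ht₁ hk₂ ht₂ he₂ p q₂ β hβ
  have h₃ := cutRight_cutMid_comm h₁₂ hk₁ ht₁ hk₂ ht₂ he₂ p q₁ q₂
  have h₄ := cutRight_cutLeft_comm h₁₂.symm hk₂ ht₂ hk₁ ht₁ he₁ p q₁ γ hγ
  have h₅ := cutRight_cutMid_comm h₁₂.symm hk₂ ht₂ hk₁ ht₁ he₁ p q₂ q₁
  rw [mul_comm] at h₄ h₅
  simp only [LinearMap.smul_apply, LinearMap.comp_apply] at h₁
  simp only [cutCirc, map_add, smul_add]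
  rw [h₁, h₂, h₃, h₄, h₅, hs, hs]
  abel

theorem cutCirc_equivariant {m n k a b : ℕ} (i : Fin m) (hk : m + n = k + 1)
    (σ : Equiv.Perm (Fin m)) (τ : Equiv.Perm (Fin n)) (p : P.X m a) (α : CutPairs P m)
    (q : P.X n b) (β : CutPairs P n) :
    cutCirc P (σ i) hk (P.ρ m a σ p, cutAct σ α) (P.ρ n b τ q, cutAct τ β) =
      cutAct (permCirc σ i τ hk) (cutCirc P i hk (p, α) (q, β)) := by
  simp only [cutCirc, map_add]
  rw [← LinearMap.comp_apply (cutRight _ _ _), cutRight_comp_cutAct,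
    ← LinearMap.comp_apply (cutLeft _ _ _), cutLeft_comp_cutAct, cutMid_act,
    LinearMap.comp_apply, LinearMap.comp_apply]

variable (P)

/-- The `Σ_*`-module of pairs `(p, α)` for an operation `p` and a linear combination `α` of pairs
given by a cut of an edge. -/
noncomputable def cutExtModule : GradedSigmaModule.{u, v} K where
  X n d := P.X n d × CutPairs.homogeneous P n d
  instAddCommGroup n d := inferInstance
  instModule n d := inferInstance
  ρ n d :=
    { toFun := fun σ => LinearMap.prodMap (P.ρ n d σ)
        ((cutAct σ).restrict (fun _ h => cutAct_mem σ h))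
      map_one' := by
        refine LinearMap.ext (fun x => Prod.ext ?_ (Subtype.ext ?_))
        · simp
        · exact congrArg (fun f => f x.2.1) cutAct_one
      map_mul' := fun σ τ => by
        refine LinearMap.ext (fun x => Prod.ext ?_ (Subtype.ext ?_))
        · simp
        · exact congrArg (fun f => f x.2.1) (cutAct_mul σ τ) }

/-- The composition products of `cutExt P`. -/
noncomputable def cutExtCirc {m n k a b c : ℕ} (i : Fin m) (hk : m + n = k + 1) (hc : a + b = c) :
    (P.X m a × CutPairs.homogeneous P m a) →ₗ[K] (P.X n b × CutPairs.homogeneous P n b) →ₗ[K]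
      (P.X k c × CutPairs.homogeneous P k c) :=
  LinearMap.mk₂ K
    (fun x y => (P.circ i hk hc x.1 y.1, ⟨cutCirc P i hk (x.1, x.2.1) (y.1, y.2.1),
      cutCirc_mem i hk hc x.2.2 y.2.2⟩))
    (fun x x' y => by
      refine Prod.ext (by simp) (Subtype.ext ?_)
      simp only [cutCirc, Prod.fst_add, Prod.snd_add, Submodule.coe_add, map_add, cutLeft_add,
        LinearMap.add_apply, cutMid_add_left]
      abel)
    (fun c x y => by
      refine Prod.ext (by simp) (Subtype.ext ?_)
      simp only [cutCirc, Prod.smul_fst, Prod.smul_snd, Submodule.coe_smul, map_smul, cutLeft_smul,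
        LinearMap.smul_apply, cutMid_smul_left, smul_add])
    (fun x y y' => by
      refine Prod.ext (by simp) (Subtype.ext ?_)
      simp only [cutCirc, Prod.fst_add, Prod.snd_add, Submodule.coe_add, map_add, cutRight_add,
        LinearMap.add_apply, cutMid_add_right]
      abel)
    (fun c x y => by
      refine Prod.ext (by simp) (Subtype.ext ?_)
      simp only [cutCirc, Prod.smul_fst, Prod.smul_snd, Submodule.coe_smul, map_smul,
        cutRight_smul, LinearMap.smul_apply, cutMid_smul_right, smul_add])

section

variable {P}

theorem cutExtCirc_fst {m n k a b c : ℕ} (i : Fin m) (hk : m + n = k + 1) (hc : a + b = c)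
    (x : P.X m a × CutPairs.homogeneous P m a) (y : P.X n b × CutPairs.homogeneous P n b) :
    (cutExtCirc P i hk hc x y).1 = P.circ i hk hc x.1 y.1 := rfl

theorem cutExtCirc_snd {m n k a b c : ℕ} (i : Fin m) (hk : m + n = k + 1) (hc : a + b = c)
    (x : P.X m a × CutPairs.homogeneous P m a) (y : P.X n b × CutPairs.homogeneous P n b) :
    ((cutExtCirc P i hk hc x y).2 : CutPairs P k) =
      cutCirc P i hk (x.1, x.2.1) (y.1, y.2.1) := rfl

theorem cutExtCirc_comm {m n₁ n₂ k₁ k₂ t a b₁ b₂ e₁ e₂ g : ℕ} {i₁ i₂ : Fin m} (h₁₂ : i₁ ≠ i₂)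
    (hk₁ : m + n₁ = k₁ + 1) (ht₁ : k₁ + n₂ = t + 1) (hk₂ : m + n₂ = k₂ + 1)
    (ht₂ : k₂ + n₁ = t + 1) (he₁ : a + b₁ = e₁) (hg₁ : e₁ + b₂ = g) (he₂ : a + b₂ = e₂)
    (hg₂ : e₂ + b₁ = g) (x : P.X m a × CutPairs.homogeneous P m a)
    (y : P.X n₁ b₁ × CutPairs.homogeneous P n₁ b₁)
    (z : P.X n₂ b₂ × CutPairs.homogeneous P n₂ b₂) :
    cutExtCirc P (inL i₁ hk₁ i₂ h₁₂.symm) ht₁ hg₁ (cutExtCirc P i₁ hk₁ he₁ x y) z =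
      (-1 : K) ^ (b₁ * b₂) •
        cutExtCirc P (inL i₂ hk₂ i₁ h₁₂) ht₂ hg₂ (cutExtCirc P i₂ hk₂ he₂ x z) y := by
  refine Prod.ext ?_ (Subtype.ext ?_)
  · rw [Prod.smul_fst, cutExtCirc_fst, cutExtCirc_fst, cutExtCirc_fst, cutExtCirc_fst]
    exact P.circ_comm' h₁₂ hk₁ ht₁ hk₂ ht₂ he₁ hg₁ he₂ hg₂ x.1 y.1 z.1
  · rw [Prod.smul_snd, Submodule.coe_smul, cutExtCirc_snd, cutExtCirc_snd, cutExtCirc_snd,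
      cutExtCirc_snd, cutExtCirc_fst, cutExtCirc_fst]
    exact cutCirc_comm h₁₂ hk₁ ht₁ hk₂ ht₂ he₁ he₂ x.1 x.2.1 y.1 z.1 y.2.2 z.2.2

end

/-- The operad of pairs `(p, α)` for an operation `p` and a linear combination `α` of pairs given by
a cut of an edge. -/
noncomputable def cutExt : GradedOperad.{u, v} K where
  toGradedSigmaModule := cutExtModule P
  one := (P.one, ⟨cutUnit P, cutUnit_mem⟩)
  circ i hk hc := cutExtCirc P i hk hc
  one_circ i hk hc q := by
    refine Prod.ext (P.one_circ i hk hc q.1) (Subtype.ext ?_)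
    change cutCirc P i hk (P.one, cutUnit P) (q.1, q.2.1) = q.2.1
    rw [cutCirc, cutRight_unit, cutLeft_one]
    abel
  circ_one i hk hc p := by
    refine Prod.ext (P.circ_one i hk hc p.1) (Subtype.ext ?_)
    change cutCirc P i hk (p.1, p.2.1) (P.one, cutUnit P) = p.2.1
    rw [cutCirc, cutLeft_unit, cutRight_one i hk p.2.2]
    abel
  circ_assoc {m n s k l t a b c e f g} i j j' hj hk ht hl ht' he hg hf hg' p q r := by
    obtain rfl : j' = inR i hk j := Fin.ext (hj.trans (inR_val i hk j).symm)
    exact Prod.ext (P.circ_assoc' i j hk ht hl ht' he hg hf hg' p.1 q.1 r.1)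
      (Subtype.ext (cutCirc_assoc i j hk ht hl ht' he hf p.1 p.2.1 q.1 q.2.1 r.1 r.2.1))
  circ_comm {m n₁ n₂ k₁ k₂ t a b₁ b₂ e₁ e₂ g} i₁ i₂ h₁₂ i₂' hi₂ i₁' hi₁ hk₁ ht₁ hk₂ ht₂ he₁ hg₁
      he₂ hg₂ p q₁ q₂ := by
    have hlt : (i₁ : ℕ) < i₂ := h₁₂
    have hne : i₁ ≠ i₂ := h₁₂.ne
    obtain rfl : i₂' = inL i₁ hk₁ i₂ hne.symm := by
      apply Fin.ext
      rw [inL_val, if_neg (by omega)]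
      omega
    obtain rfl : i₁' = inL i₂ hk₂ i₁ hne := by
      apply Fin.ext
      rw [inL_val, if_pos hlt, hi₁]
    exact cutExtCirc_comm hne hk₁ ht₁ hk₂ ht₂ he₁ hg₁ he₂ hg₂ p q₁ q₂
  circ_equivariant i hk hc σ τ p q := by
    refine Prod.ext (P.circ_equivariant i hk hc σ τ p.1 q.1) (Subtype.ext ?_)
    exact cutCirc_equivariant i hk σ τ p.1 p.2.1 q.1 q.2.1

end CutExtension

/-! ### Cutting the edges of an operation of a free operad. -/

section Cut

variable {K : Type u} [CommRing K] (M : GradedSigmaModule.{u, v} K)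

/-- The morphism `F(M) → cutExt F(M)` which extends the map `x ↦ (x, 0)` on generators. -/
noncomputable def toCutExt : GradedOperad.Hom (freeOperad M) (cutExt (freeOperad M)) :=
  freeLift (Q := cutExt (freeOperad M))
    { app := fun n d => LinearMap.inl K ((freeOperad M).X n d)
        (CutPairs.homogeneous (freeOperad M) n d) ∘ₗ (freeGen M).app n d
      map_ρ := fun n d σ x => by
        refine Prod.ext ((freeGen M).map_ρ n d σ x) ?_
        exact (map_zero ((cutAct σ).restrict (fun _ h => cutAct_mem σ h))).symm }

/-- The first component is compatible with the operad structure and fixes the generators, hence it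
is the identity. -/
theorem toCutExt_fst (n d : ℕ) (p : (freeOperad M).X n d) : ((toCutExt M).app n d p).1 = p := by
  refine freeOperad_induction (motive := fun n d p => ((toCutExt M).app n d p).1 = p)
    ?_ ?_ ?_ ?_ ?_ ?_ ?_ n d p
  · intro n d
    rw [map_zero]
    rfl
  · intro n d p q hp hq
    rw [map_add]
    exact congrArg₂ (· + ·) hp hq
  · intro n d c p hp
    rw [map_smul]
    exact congrArg (c • ·) hp
  · intro n d σ p hp
    rw [(toCutExt M).map_ρ]
    exact congrArg ((freeOperad M).ρ n d σ) hp
  · intro n d x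
    rfl
  · rfl
  · intro m n k a b c i hk hc p q hp hq
    rw [(toCutExt M).map_circ]
    exact congrArg₂ (fun p q => (freeOperad M).circ i hk hc p q) hp hq

variable {M}

/-- The sum of the pairs obtained from an operation in the free operad by cutting an edge. -/
noncomputable def cut {n d : ℕ} : (freeOperad M).X n d →ₗ[K] CutPairs (freeOperad M) n :=
  Submodule.subtype _ ∘ₗ LinearMap.snd K _ _ ∘ₗ (toCutExt M).app n d

theorem cut_gen {n d : ℕ} (x : M.X n d) : cut ((freeGen M).app n d x) = 0 := rfl

theorem cut_act {n d : ℕ} (σ : Equiv.Perm (Fin n)) (p : (freeOperad M).X n d) :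
    cut ((freeOperad M).ρ n d σ p) = cutAct σ (cut p) :=
  congrArg (fun x : (cutExt (freeOperad M)).X n d => x.2.1) ((toCutExt M).map_ρ n d σ p)

/-- An internal edge of `p ∘_i q` is an edge of `p`, an edge of `q`, or the new edge. This is the
multiplicativity of `toCutExt` read in its second component. -/
theorem cut_circ {m n k a b c : ℕ} (i : Fin m) (hk : m + n = k + 1) (hc : a + b = c)
    (p : (freeOperad M).X m a) (q : (freeOperad M).X n b) :
    cut ((freeOperad M).circ i hk hc p q) =
      cutRight i hk q (cut p) + cutLeft i hk p (cut q) + cutMid i hk p q := by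
  have h := congrArg (fun x : (cutExt (freeOperad M)).X k c => x.2.1)
    ((toCutExt M).map_circ i hk hc p q)
  refine h.trans ?_
  change cutCirc (freeOperad M) i hk (((toCutExt M).app m a p).1, cut p)
    (((toCutExt M).app n b q).1, cut q) = _
  rw [toCutExt_fst, toCutExt_fst, cutCirc]

end Cut

/-! ### Modules with a differential, and the five lemma. -/

section DifferentialModules

variable {K : Type u} [CommRing K]

/-- A map between modules with differentials induces an isomorphism in homology. -/
structure IsHomologyIso {X Y : Type*} [AddCommGroup X] [Module K X] [AddCommGroup Y] [Module K Y]
    (d : X →ₗ[K] X) (d' : Y →ₗ[K] Y) (f : X →ₗ[K] Y) : Prop where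
  inj : ∀ x, d x = 0 → ∀ y, f x = d' y → ∃ x', x = d x'
  surj : ∀ y, d' y = 0 → ∃ x, d x = 0 ∧ ∃ y', y = f x + d' y'

variable {A B C A' B' C' : Type*}
  [AddCommGroup A] [Module K A] [AddCommGroup B] [Module K B] [AddCommGroup C] [Module K C]
  [AddCommGroup A'] [Module K A'] [AddCommGroup B'] [Module K B'] [AddCommGroup C'] [Module K C']

theorem IsHomologyIso.comp {dA : A →ₗ[K] A} {dB : B →ₗ[K] B} {dC : C →ₗ[K] C} {f : A →ₗ[K] B}
    {g : B →ₗ[K] C} (hf : ∀ x, f (dA x) = dB (f x)) (hg : ∀ x, g (dB x) = dC (g x))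
    (h : IsHomologyIso dA dB f) (h' : IsHomologyIso dB dC g) : IsHomologyIso dA dC (g ∘ₗ f) where
  inj x hx z hz := by
    obtain ⟨y, hy⟩ := h'.inj (f x) (by rw [← hf, hx, map_zero]) z hz
    exact h.inj x hx y hy
  surj z hz := by
    obtain ⟨y, hy, z', rfl⟩ := h'.surj z hz
    obtain ⟨x, hx, y', rfl⟩ := h.surj y hy
    refine ⟨x, hx, g y' + z', ?_⟩
    rw [LinearMap.comp_apply, map_add, map_add, hg, add_assoc]

theorem IsHomologyIso.of_homotopy {dA : A →ₗ[K] A} {dB : B →ₗ[K] B} {f : A →ₗ[K] B}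
    {g : B →ₗ[K] A} {a : B →ₗ[K] B} {b : A →ₗ[K] A}
    (hg : ∀ x, g (dB x) = dA (g x)) (ha : ∀ y, dB (a y) + a (dB y) + f (g y) = y)
    (hb : ∀ x, dA (b x) + b (dA x) + g (f x) = x) : IsHomologyIso dA dB f where
  inj x hx y hy := by
    refine ⟨b x + g y, ?_⟩
    have h := hb x
    rw [hx, map_zero, add_zero, hy, hg] at h
    rw [map_add, h]
  surj y hy := by
    refine ⟨g y, by rw [← hg, hy, map_zero], a y, ?_⟩
    have h := ha y
    rw [hy, map_zero, add_zero] at h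
    rw [add_comm, h]

theorem IsHomologyIso.of_equiv {dA : A →ₗ[K] A} {dB : B →ₗ[K] B} {dA' : A' →ₗ[K] A'}
    {dB' : B' →ₗ[K] B'} {f : A →ₗ[K] B} {f' : A' →ₗ[K] B'} (e : A ≃ₗ[K] A') (e' : B ≃ₗ[K] B')
    (he : ∀ x, e (dA x) = dA' (e x)) (he' : ∀ x, e' (dB x) = dB' (e' x))
    (hf : ∀ x, e' (f x) = f' (e x)) (h : IsHomologyIso dA dB f) : IsHomologyIso dA' dB' f' where
  inj x hx y hy := by
    obtain ⟨x, rfl⟩ := e.surjective x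
    obtain ⟨y, rfl⟩ := e'.surjective y
    rw [← he, e.map_eq_zero_iff] at hx
    rw [← hf, ← he'] at hy
    obtain ⟨z, rfl⟩ := h.inj x hx y (e'.injective hy)
    exact ⟨e z, he z⟩
  surj y hy := by
    obtain ⟨y, rfl⟩ := e'.surjective y
    rw [← he', e'.map_eq_zero_iff] at hy
    obtain ⟨x, hx, y', rfl⟩ := h.surj y hy
    exact ⟨e x, by rw [← he, hx, map_zero], e' y', by rw [map_add, hf, he']⟩

theorem IsHomologyIso.pi {ι : Type*} {X Y : ι → Type*} [∀ i, AddCommGroup (X i)]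
    [∀ i, Module K (X i)] [∀ i, AddCommGroup (Y i)] [∀ i, Module K (Y i)]
    {d : ∀ i, X i →ₗ[K] X i} {d' : ∀ i, Y i →ₗ[K] Y i} {f : ∀ i, X i →ₗ[K] Y i}
    (h : ∀ i, IsHomologyIso (d i) (d' i) (f i)) :
    IsHomologyIso (LinearMap.piMap d) (LinearMap.piMap d') (LinearMap.piMap f) where
  inj x hx y hy := by
    choose z hz using fun i => (h i).inj (x i) (congrFun hx i) (y i) (congrFun hy i)
    exact ⟨z, funext hz⟩
  surj y hy := by
    choose x hx z hz using fun i => (h i).surj (y i) (congrFun hy i)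
    exact ⟨x, funext hx, z, funext hz⟩

section FiveLemma

variable {dA : A →ₗ[K] A} {dB : B →ₗ[K] B} {dC : C →ₗ[K] C} {dA' : A' →ₗ[K] A'}
  {dB' : B' →ₗ[K] B'} {dC' : C' →ₗ[K] C'} {i : A →ₗ[K] B} {p : B →ₗ[K] C} {i' : A' →ₗ[K] B'}
  {p' : B' →ₗ[K] C'} {f : A →ₗ[K] A'} {g : B →ₗ[K] B'} {h : C →ₗ[K] C'}

/-- The five lemma for the exact homology triangles, unwound into a chase on cycles and boundaries
so that no homology module or connecting map has to be formed. -/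
theorem IsHomologyIso.right_of_exact (hdB : ∀ x, dB (dB x) = 0) (hdB' : ∀ x, dB' (dB' x) = 0)
    (hi : Function.Injective i) (hi' : Function.Injective i') (hp : Function.Surjective p)
    (hp' : Function.Surjective p') (he : Function.Exact i p) (he' : Function.Exact i' p')
    (di : ∀ x, i (dA x) = dB (i x)) (dp : ∀ x, p (dB x) = dC (p x))
    (di' : ∀ x, i' (dA' x) = dB' (i' x)) (dp' : ∀ x, p' (dB' x) = dC' (p' x))
    (df : ∀ x, f (dA x) = dA' (f x)) (dg : ∀ x, g (dB x) = dB' (g x))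
    (fg : ∀ x, g (i x) = i' (f x)) (gh : ∀ x, h (p x) = p' (g x))
    (hf : IsHomologyIso dA dA' f) (hg : IsHomologyIso dB dB' g) : IsHomologyIso dC dC' h where
  inj c hc c' hc' := by
    obtain ⟨b, rfl⟩ := hp c
    obtain ⟨b', rfl⟩ := hp' c'
    obtain ⟨a', ha'⟩ := (he' (g b - dB' b')).1 (by rw [map_sub, dp', ← gh, hc', sub_self])
    obtain ⟨a, ha⟩ := (he (dB b)).1 (by rw [dp, hc])
    have h₁ : f a = dA' a' := hi' (by
      rw [← fg, ha, di', ha', map_sub, hdB', sub_zero, dg])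
    obtain ⟨a₁, rfl⟩ := hf.inj a (hi (by rw [di, ha, hdB, map_zero])) a' h₁
    -- Subtracting `i a₁` makes `b` a cycle; the cycle `a₂` then absorbs the class of `a' - f a₁`,
    -- so that the image of `b - i a₁ - i a₂` is a boundary.
    obtain ⟨a₂, ha₂, a₃, ha₃⟩ := hf.surj (a' - f a₁) (by rw [map_sub, ← df, h₁, sub_self])
    obtain ⟨b₄, hb₄⟩ := hg.inj (b - i a₁ - i a₂)
      (by rw [map_sub, map_sub, ← di, ← di, ha, ha₂, map_zero, sub_self, sub_zero]) (b' + i' a₃) (by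
        have h₂ := congrArg i' ha₃
        rw [map_sub, map_add, ha', di'] at h₂
        rw [map_sub, map_sub, fg, fg, map_add, ← sub_eq_zero]
        rw [← sub_eq_zero] at h₂
        rw [← h₂]
        abel)
    refine ⟨p b₄, ?_⟩
    rw [← dp, ← hb₄, map_sub, map_sub, he.apply_apply_eq_zero, he.apply_apply_eq_zero, sub_zero,
      sub_zero]
  surj c' hc' := by
    obtain ⟨b', rfl⟩ := hp' c'
    obtain ⟨a', ha'⟩ := (he' (dB' b')).1 (by rw [dp', hc'])
    obtain ⟨a, ha, a₁, ha₁⟩ := hf.surj a' (hi' (by rw [di', ha', hdB', map_zero]))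
    have h₁ : g (i a) = dB' (b' - i' a₁) := by
      rw [fg, map_sub, ← di', ← ha', ha₁, map_add, add_sub_cancel_right]
    obtain ⟨b, hb⟩ := hg.inj (i a) (by rw [← di, ha, map_zero]) _ h₁
    obtain ⟨b₂, hb₂, b₃, hb₃⟩ := hg.surj (b' - i' a₁ - g b)
      (by rw [map_sub, ← h₁, ← dg, ← hb, sub_self])
    refine ⟨p (b + b₂), by rw [← dp, map_add, hb₂, add_zero, ← hb, he.apply_apply_eq_zero],
      p' b₃, ?_⟩
    have h₂ := congrArg p' hb₃
    rw [map_sub, map_sub, he'.apply_apply_eq_zero, sub_zero, map_add, dp', ← gh, ← gh,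
      sub_eq_iff_eq_add] at h₂
    rw [h₂, map_add, map_add]
    abel

theorem IsHomologyIso.middle_of_exact (hdB : ∀ x, dB (dB x) = 0) (hdB' : ∀ x, dB' (dB' x) = 0)
    (hi : Function.Injective i) (hi' : Function.Injective i') (hp : Function.Surjective p)
    (hp' : Function.Surjective p') (he : Function.Exact i p) (he' : Function.Exact i' p')
    (di : ∀ x, i (dA x) = dB (i x)) (dp : ∀ x, p (dB x) = dC (p x))
    (di' : ∀ x, i' (dA' x) = dB' (i' x)) (dp' : ∀ x, p' (dB' x) = dC' (p' x))
    (df : ∀ x, f (dA x) = dA' (f x)) (dg : ∀ x, g (dB x) = dB' (g x))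
    (fg : ∀ x, g (i x) = i' (f x)) (gh : ∀ x, h (p x) = p' (g x))
    (hf : IsHomologyIso dA dA' f) (hh : IsHomologyIso dC dC' h) : IsHomologyIso dB dB' g where
  inj b hb b' hb' := by
    obtain ⟨c₁, hc₁⟩ := hh.inj (p b) (by rw [← dp, hb, map_zero]) (p' b') (by rw [gh, hb', dp'])
    obtain ⟨b₁, rfl⟩ := hp c₁
    obtain ⟨a, ha⟩ := (he (b - dB b₁)).1 (by rw [map_sub, dp, hc₁, sub_self])
    have h₁ : i' (f a) = dB' (b' - g b₁) := by rw [← fg, ha, map_sub, map_sub, hb', dg]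
    -- The class of `f a` vanishes in `B'`, hence comes from a cycle of `C'`. That cycle is replaced
    -- by the image of a cycle `c₂` of `C`, and `a₂` represents the connecting map applied to `c₂`.
    obtain ⟨c₂, hc₂, c₃, hc₃⟩ := hh.surj (p' (b' - g b₁))
      (by rw [← dp', ← h₁, he'.apply_apply_eq_zero])
    obtain ⟨b₂, rfl⟩ := hp c₂
    obtain ⟨b₃, rfl⟩ := hp' c₃
    obtain ⟨a₂, ha₂⟩ := (he (dB b₂)).1 (by rw [dp, hc₂])
    obtain ⟨a₄, ha₄⟩ := (he' (b' - g b₁ - g b₂ - dB' b₃)).1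
      (by rw [map_sub, map_sub, hc₃, gh, dp']; abel)
    have h₂ : f (a - a₂) = dA' a₄ := hi' (by
      rw [map_sub, map_sub, di', ha₄, map_sub, map_sub, ← h₁, hdB', sub_zero, ← dg, ← ha₂, fg])
    obtain ⟨a₅, ha₅⟩ := hf.inj (a - a₂) (hi (by
      rw [di, map_sub, map_sub, ha, ha₂, map_sub, hb, hdB, hdB, sub_self, sub_self, map_zero]))
      a₄ h₂
    refine ⟨b₁ + b₂ + i a₅, ?_⟩
    have h₃ := congrArg i ha₅
    rw [map_sub, ha, ha₂, di] at h₃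
    rw [map_add, map_add, ← h₃]
    abel
  surj b' hb' := by
    obtain ⟨c, hc, c', hc'⟩ := hh.surj (p' b') (by rw [← dp', hb', map_zero])
    obtain ⟨b, rfl⟩ := hp c
    obtain ⟨b₁, rfl⟩ := hp' c'
    obtain ⟨a', ha'⟩ := (he' (b' - g b - dB' b₁)).1
      (by rw [map_sub, map_sub, hc', gh, dp']; abel)
    obtain ⟨a, ha⟩ := (he (dB b)).1 (by rw [dp, hc])
    have h₁ : f a = dA' (-a') := hi' (by
      rw [← fg, ha, map_neg, map_neg, di', ha', map_sub, map_sub, hb', hdB', dg]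
      abel)
    obtain ⟨a₁, rfl⟩ := hf.inj a (hi (by rw [di, ha, hdB, map_zero])) _ h₁
    obtain ⟨a₃, ha₃, a₄, ha₄⟩ := hf.surj (a' + f a₁)
      (by rw [map_add, ← df, h₁, map_neg, add_neg_cancel])
    refine ⟨b - i a₁ + i a₃, ?_, b₁ + i' a₄, ?_⟩
    · rw [map_add, map_sub, ← di, ← di, ha, ha₃, map_zero, sub_self, add_zero]
    · have h₂ := congrArg i' ha₄
      rw [map_add, map_add, ha', di'] at h₂
      rw [map_add, map_sub, fg, fg, map_add, ← sub_eq_zero]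
      rw [← sub_eq_zero] at h₂
      rw [← h₂]
      abel

end FiveLemma

/-- A grading of a module with a differential of degree `-1` by the natural numbers, given by
the projections to the homogeneous components. -/
structure DiffGrading {X : Type*} [AddCommGroup X] [Module K X] (d : X →ₗ[K] X) where
  pr : ℕ → X →ₗ[K] X
  sgn : X →ₗ[K] X
  pr_self : ∀ a x, pr a (pr a x) = pr a x
  pr_ne : ∀ a b x, a ≠ b → pr a (pr b x) = 0
  pr_d : ∀ a x, pr a (d x) = d (pr (a + 1) x)
  d_pr_zero : ∀ x, d (pr 0 x) = 0
  sgn_pr : ∀ a x, sgn (pr a x) = (-1 : K) ^ a • pr a x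
  exists_sum : ∀ x, ∃ N, ∀ n, N ≤ n → ∑ a ∈ Finset.range n, pr a x = x

namespace DiffGrading

variable {X Y : Type*} [AddCommGroup X] [Module K X] [AddCommGroup Y] [Module K Y]
  {d : X →ₗ[K] X} {d' : Y →ₗ[K] Y} (G : DiffGrading d) (G' : DiffGrading d')

include G in
theorem hom_ext {f g : X →ₗ[K] Y} (h : ∀ a x, f (G.pr a x) = g (G.pr a x)) : f = g := by
  ext x
  obtain ⟨N, hN⟩ := G.exists_sum x
  rw [← hN N le_rfl, map_sum, map_sum]
  exact Finset.sum_congr rfl (fun a _ => h a x)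

theorem sgn_sgn (x : X) : G.sgn (G.sgn x) = x := by
  have h : G.sgn ∘ₗ G.sgn = LinearMap.id := G.hom_ext (fun a x => by
    simp [G.sgn_pr, smul_smul, ← mul_pow])
  exact congrArg (fun f => f x) h

theorem sgn_d (x : X) : G.sgn (d x) = -d (G.sgn x) := by
  have h : G.sgn ∘ₗ d = -(d ∘ₗ G.sgn) := G.hom_ext (fun a x => by
    rcases a with _ | a
    · simp [G.sgn_pr, G.d_pr_zero]
    · simp [G.sgn_pr, ← G.pr_d, pow_succ])
  exact congrArg (fun f => f x) h

theorem sgn_comm {f : X →ₗ[K] Y} (hf : ∀ a x, f (G.pr a x) = G'.pr a (f x)) (x : X) :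
    f (G.sgn x) = G'.sgn (f x) := by
  have h : f ∘ₗ G.sgn = G'.sgn ∘ₗ f := G.hom_ext (fun a x => by
    simp [G.sgn_pr, hf, G'.sgn_pr])
  exact congrArg (fun f => f x) h

end DiffGrading

end DifferentialModules

/-! ### Projective complexes: contractions, homotopy inverses, tensor products. -/

section DiffGradingHomotopy

open TensorProduct

namespace DiffGrading

variable {K : Type u} [CommRing K] {X Y : Type*} [AddCommGroup X] [Module K X] [AddCommGroup Y]
  [Module K Y] {d : X →ₗ[K] X} {d' : Y →ₗ[K] Y} (G : DiffGrading d) (G' : DiffGrading d')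

theorem finite_support (x : X) : (Function.support (fun a => G.pr a x)).Finite := by
  obtain ⟨N, hN⟩ := G.exists_sum x
  refine (Finset.range N).finite_toSet.subset (fun a ha => ?_)
  by_contra h
  rw [Finset.mem_coe, Finset.mem_range, not_lt] at h
  have h₁ := hN (a + 1) (h.trans a.le_succ)
  rw [Finset.sum_range_succ, hN a h, add_eq_left] at h₁
  exact ha h₁

/-- The map given by a family of maps on the homogeneous components. -/
noncomputable def ofComponents (l : ℕ → X →ₗ[K] Y) : X →ₗ[K] Y where
  toFun x := ∑ᶠ a, l a (G.pr a x)
  map_add' x y := by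
    rw [← finsum_add_distrib]
    · simp
    · exact (G.finite_support x).subset (fun a ha h => ha (by simp only [h, map_zero]))
    · exact (G.finite_support y).subset (fun a ha h => ha (by simp only [h, map_zero]))
  map_smul' c x := by
    rw [RingHom.id_apply, smul_finsum' c]
    · simp
    · exact (G.finite_support x).subset (fun a ha h => ha (by simp only [h, map_zero]))

theorem ofComponents_pr (l : ℕ → X →ₗ[K] Y) (a : ℕ) (x : X) :
    G.ofComponents l (G.pr a x) = l a (G.pr a x) := by
  change ∑ᶠ b, l b (G.pr b (G.pr a x)) = _
  rw [finsum_eq_single _ a (fun b hb => by rw [G.pr_ne b a x hb, map_zero]), G.pr_self]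

/-- `u` has values in cycles, which are boundaries, so projectivity lifts it through `d`. Composing
with the projections makes the lift homogeneous. -/
theorem exists_lift [Module.Projective K X] (h : ∀ x, d x = 0 → ∃ y, x = d y) (u : X →ₗ[K] X)
    (hu : ∀ x, d (u x) = 0) (a : ℕ) :
    ∃ l : X →ₗ[K] X, (∀ x, l (G.pr a x) = l x) ∧ (∀ x, G.pr (a + 1) (l x) = l x) ∧
      ∀ x, d (l x) = G.pr a (u (G.pr a x)) := by
  obtain ⟨s, hs⟩ := Module.projective_lifting_property d.rangeRestrict
    (u.codRestrict (LinearMap.range d) (fun x => by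
      obtain ⟨y, hy⟩ := h (u x) (hu x)
      exact ⟨y, hy.symm⟩)) d.surjective_rangeRestrict
  have hs' : ∀ x, d (s x) = u x := fun x => congrArg Subtype.val (LinearMap.congr_fun hs x)
  refine ⟨G.pr (a + 1) ∘ₗ s ∘ₗ G.pr a, fun x => ?_, fun x => ?_, fun x => ?_⟩
  · simp only [LinearMap.comp_apply, G.pr_self]
  · simp only [LinearMap.comp_apply, G.pr_self]
  · rw [LinearMap.comp_apply, LinearMap.comp_apply, ← G.pr_d, hs']

/-- The usual construction, degree by degree from `0`: the component in degree `a + 1` is a lift of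
`pr (a + 1) - l ∘ d`. The clause on `sgn` records that `H` is odd, as the signs in tensor products
require. -/
theorem exists_contraction [Module.Projective K X] (hd : ∀ x, d (d x) = 0)
    (h : ∀ x, d x = 0 → ∃ y, x = d y) :
    ∃ H : X →ₗ[K] X, (∀ x, d (H x) + H (d x) = x) ∧ ∀ x, H (G.sgn x) = -G.sgn (H x) := by
  -- `l` lives on degree `a` and has values in degree `a + 1`. The last clause ensures that `pr (a +
  -- 1) - l ∘ d` takes values in cycles at the next stage.
  let Q : ℕ → (X →ₗ[K] X) → Prop := fun a l => (∀ x, l (G.pr a x) = l x) ∧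
    (∀ x, G.pr (a + 1) (l x) = l x) ∧ ∀ x, d (l (d x)) = G.pr a (d x)
  have hbase : ∃ l, Q 0 l ∧ ∀ x, d (l x) = G.pr 0 x := by
    obtain ⟨l, h₁, h₂, h₃⟩ := G.exists_lift h (G.pr 0) G.d_pr_zero 0
    have h₄ : ∀ x, d (l x) = G.pr 0 x := fun x => by rw [h₃, G.pr_self, G.pr_self]
    exact ⟨l, ⟨h₁, h₂, fun x => h₄ (d x)⟩, h₄⟩
  have hstep : ∀ a l, Q a l → ∃ l', Q (a + 1) l' ∧ ∀ x, d (l' x) + l (d x) = G.pr (a + 1) x := by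
    intro a l hl
    obtain ⟨l', h₁, h₂, h₃⟩ := G.exists_lift h (G.pr (a + 1) - l ∘ₗ d) (fun x => by
      rw [LinearMap.sub_apply, map_sub, LinearMap.comp_apply, hl.2.2, G.pr_d, sub_self]) (a + 1)
    have h₄ : ∀ x, d (l' x) = G.pr (a + 1) x - l (d x) := fun x => by
      rw [h₃, LinearMap.sub_apply, LinearMap.comp_apply, map_sub, G.pr_self, G.pr_self, ← G.pr_d,
        hl.1, hl.2.1]
    refine ⟨l', ⟨h₁, h₂, fun x => ?_⟩, fun x => by rw [h₄, sub_add_cancel]⟩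
    rw [h₄, hd, map_zero, sub_zero]
  obtain ⟨l₀, hQ₀, hl₀⟩ := hbase
  choose! n hQ hn using hstep
  let l : ℕ → X →ₗ[K] X := fun a => Nat.rec l₀ n a
  have hl : ∀ a, Q a (l a) := fun a => by
    induction a with
    | zero => exact hQ₀
    | succ a ih => exact hQ a (l a) ih
  have hH : ∀ a x, G.ofComponents l (G.pr a x) = l a x := fun a x => by
    rw [G.ofComponents_pr, (hl a).1]
  refine ⟨G.ofComponents l, fun x => ?_, fun x => ?_⟩
  · have e : d ∘ₗ G.ofComponents l + G.ofComponents l ∘ₗ d = LinearMap.id :=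
      G.hom_ext (fun a x => by
        rw [LinearMap.add_apply, LinearMap.comp_apply, LinearMap.comp_apply, hH,
          LinearMap.id_apply]
        rcases a with _ | a
        · rw [G.d_pr_zero, map_zero, add_zero]
          exact hl₀ x
        · rw [← G.pr_d, hH]
          exact hn a (l a) (hl a) x)
    exact LinearMap.congr_fun e x
  · have e : G.ofComponents l ∘ₗ G.sgn = -(G.sgn ∘ₗ G.ofComponents l) :=
      G.hom_ext (fun a x => by
        rw [LinearMap.comp_apply, G.sgn_pr, map_smul, hH, LinearMap.neg_apply,
          LinearMap.comp_apply, hH, ← (hl a).2.1, G.sgn_pr, pow_succ]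
        simp)
    exact LinearMap.congr_fun e x

/-- The differential of the mapping cone. -/
noncomputable def coneD (d : X →ₗ[K] X) (d' : Y →ₗ[K] Y) (f : X →ₗ[K] Y) :
    (Y × X) →ₗ[K] (Y × X) :=
  LinearMap.prod (d' ∘ₗ LinearMap.fst K Y X + f ∘ₗ LinearMap.snd K Y X)
    (-(d ∘ₗ LinearMap.snd K Y X))

theorem coneD_apply (f : X →ₗ[K] Y) (z : Y × X) :
    coneD d d' f z = (d' z.1 + f z.2, -d z.2) := rfl

/-- The grading of the mapping cone. -/
noncomputable def cone {f : X →ₗ[K] Y} (hf : ∀ a x, f (G.pr a x) = G'.pr a (f x)) :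
    DiffGrading (coneD d d' f) where
  -- `X` is shifted up by one degree, hence has no component in degree `0` and has the opposite
  -- sign.
  pr a := LinearMap.prodMap (G'.pr a) (match a with
    | 0 => 0
    | a + 1 => G.pr a)
  sgn := LinearMap.prodMap G'.sgn (-G.sgn)
  pr_self a z := by
    rcases a with _ | a
    · simp [G'.pr_self]
    · simp [G'.pr_self, G.pr_self]
  pr_ne a b z h := by
    rcases a with _ | a <;> rcases b with _ | b
    · exact absurd rfl h
    · simp [G'.pr_ne _ _ _ h]
    · simp [G'.pr_ne _ _ _ h]
    · simp [G'.pr_ne _ _ _ h, G.pr_ne a b _ (fun e => h (e ▸ rfl))]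
  pr_d a z := by
    rcases a with _ | a
    · simp [coneD_apply, G'.pr_d, hf, G.d_pr_zero]
    · simp [coneD_apply, G'.pr_d, hf, G.pr_d]
  d_pr_zero z := by simp [coneD_apply, G'.d_pr_zero]
  sgn_pr a z := by
    rcases a with _ | a
    · simp [G'.sgn_pr]
    · simp [G'.sgn_pr, G.sgn_pr, pow_succ]
  exists_sum z := by
    obtain ⟨N, hN⟩ := G.exists_sum z.2
    obtain ⟨N', hN'⟩ := G'.exists_sum z.1
    refine ⟨N + N' + 1, fun n hn => ?_⟩
    obtain ⟨n, rfl⟩ : ∃ k, n = k + 1 := ⟨n - 1, by omega⟩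
    refine Prod.ext ?_ ?_
    · rw [Prod.fst_sum]
      exact hN' _ (by omega)
    · rw [Prod.snd_sum, Finset.sum_range_succ']
      simpa using hN n (by omega)

-- The mapping cone of `f` is acyclic, hence has a contraction `H`, and the matrix entries of `H`
-- are the required maps.
include G G' in
theorem exists_homotopyInverse [Module.Projective K X] [Module.Projective K Y]
    (hd : ∀ x, d (d x) = 0) (hd' : ∀ y, d' (d' y) = 0) {f : X →ₗ[K] Y}
    (hf : ∀ a x, f (G.pr a x) = G'.pr a (f x)) (hfd : ∀ x, f (d x) = d' (f x))
    (h : IsHomologyIso d d' f) :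
    ∃ (g : Y →ₗ[K] X) (a : Y →ₗ[K] Y) (b : X →ₗ[K] X), (∀ y, g (d' y) = d (g y)) ∧
      (∀ y, d' (a y) + a (d' y) + f (g y) = y) ∧ (∀ x, d (b x) + b (d x) + g (f x) = x) ∧
      (∀ y, g (G'.sgn y) = G.sgn (g y)) ∧ (∀ y, a (G'.sgn y) = -G'.sgn (a y)) ∧
      ∀ x, b (G.sgn x) = -G.sgn (b x) := by
  obtain ⟨H, h₁, h₂⟩ := (G.cone G' hf).exists_contraction
    (fun z => by simp [coneD_apply, hd, hd', hfd]) (fun z hz => by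
      obtain ⟨y, x⟩ := z
      have hy : d' y + f x = 0 := congrArg Prod.fst hz
      have hx : -d x = 0 := congrArg Prod.snd hz
      -- For a cycle `(y, x)` of the cone, `f x = d' (-y)` makes `x` a boundary `d x₁`. Then `y + f
      -- x₁` is a cycle, which comes from `X` up to a boundary.
      obtain ⟨x₁, rfl⟩ := h.inj x (neg_eq_zero.1 hx) (-y) (by
        rw [map_neg, eq_neg_iff_add_eq_zero, add_comm, hy])
      obtain ⟨x₂, hx₂, y₁, hy₁⟩ := h.surj (y + f x₁) (by rw [map_add, ← hfd, hy])
      refine ⟨(y₁, x₂ - x₁), Prod.ext ?_ ?_⟩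
      · change y = d' y₁ + f (x₂ - x₁)
        rw [map_sub, eq_sub_of_add_eq hy₁]
        abel
      · change d x₁ = -d (x₂ - x₁)
        rw [map_sub, hx₂, zero_sub, neg_neg])
  have e₁ : ∀ y, d' (H (y, 0)).1 + f (H (y, 0)).2 + (H (d' y, 0)).1 = y ∧
      -d (H (y, 0)).2 + (H (d' y, 0)).2 = 0 := fun y => by
    have e := h₁ (y, 0)
    rw [coneD_apply, coneD_apply, map_zero, map_zero, neg_zero, add_zero] at e
    exact ⟨congrArg Prod.fst e, congrArg Prod.snd e⟩
  have e₂ : ∀ x, -d (H (0, x)).2 + ((H (f x, 0)).2 - (H (0, d x)).2) = x := fun x => by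
    have e := congrArg Prod.snd (h₁ (0, x))
    have e' : coneD d d' f (0, x) = (f x, 0) - (0, d x) := by simp [coneD_apply]
    rw [e', map_sub] at e
    exact e
  have e₃ : ∀ y, H (G'.sgn y, 0) = (-G'.sgn (H (y, 0)).1, G.sgn (H (y, 0)).2) := fun y => by
    have e := h₂ (y, 0)
    simpa [cone] using e
  have e₄ : ∀ x, H (0, -G.sgn x) = (-G'.sgn (H (0, x)).1, G.sgn (H (0, x)).2) := fun x => by
    have e := h₂ (0, x)
    simpa [cone] using e
  -- The entry from `Y` to `X` is the inverse, the diagonal entries are the homotopies; the one on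
  -- `X` changes sign because the cone carries `-d` there.
  refine ⟨LinearMap.snd K Y X ∘ₗ H ∘ₗ LinearMap.inl K Y X,
    LinearMap.fst K Y X ∘ₗ H ∘ₗ LinearMap.inl K Y X,
    -(LinearMap.snd K Y X ∘ₗ H ∘ₗ LinearMap.inr K Y X), fun y => ?_, fun y => ?_, fun x => ?_,
    fun y => ?_, fun y => ?_, fun x => ?_⟩
  · have e := (e₁ y).2
    rw [neg_add_eq_zero] at e
    exact e.symm
  · refine Eq.trans ?_ (e₁ y).1
    change d' (H (y, 0)).1 + (H (d' y, 0)).1 + f (H (y, 0)).2 = _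
    abel
  · refine Eq.trans ?_ (e₂ x)
    change d (-(H (0, x)).2) + -(H (0, d x)).2 + (H (f x, 0)).2 = _
    rw [map_neg]
    abel
  · exact congrArg Prod.snd (e₃ y)
  · exact congrArg Prod.fst (e₃ y)
  · change -(H (0, G.sgn x)).2 = -G.sgn (-(H (0, x)).2)
    have e := congrArg Prod.snd (e₄ x)
    have e' : ((0 : Y), -G.sgn x) = -(0, G.sgn x) := by simp
    rw [e', map_neg] at e
    rw [map_neg, neg_neg]
    exact e

/-- The differential of a tensor product. -/
noncomputable def tensorD (d' : Y →ₗ[K] Y) : X ⊗[K] Y →ₗ[K] X ⊗[K] Y :=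
  TensorProduct.map d LinearMap.id + TensorProduct.map G.sgn d'

theorem tensorD_tmul (x : X) (y : Y) :
    G.tensorD d' (x ⊗ₜ y) = d x ⊗ₜ y + G.sgn x ⊗ₜ d' y := rfl

end DiffGrading

/-- One factor is changed at a time. A homotopy inverse tensored with the identity is again one,
whereas homology isomorphisms themselves need not survive a tensor product. -/
theorem IsHomologyIso.tensor {K : Type u} [CommRing K] {X Y X' Y' : Type*} [AddCommGroup X]
    [Module K X] [AddCommGroup Y] [Module K Y] [AddCommGroup X'] [Module K X'] [AddCommGroup Y']
    [Module K Y'] [Module.Projective K X] [Module.Projective K Y] [Module.Projective K X']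
    [Module.Projective K Y']
    {d : X →ₗ[K] X} {e : Y →ₗ[K] Y} {d' : X' →ₗ[K] X'} {e' : Y' →ₗ[K] Y'}
    (G : DiffGrading d) (E : DiffGrading e) (G' : DiffGrading d') (E' : DiffGrading e')
    (hd : ∀ x, d (d x) = 0) (he : ∀ x, e (e x) = 0) (hd' : ∀ x, d' (d' x) = 0)
    (he' : ∀ x, e' (e' x) = 0) {f : X →ₗ[K] X'} {g : Y →ₗ[K] Y'}
    (hf : ∀ a x, f (G.pr a x) = G'.pr a (f x)) (hfd : ∀ x, f (d x) = d' (f x))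
    (hg : ∀ a x, g (E.pr a x) = E'.pr a (g x)) (hge : ∀ x, g (e x) = e' (g x))
    (h : IsHomologyIso d d' f) (h' : IsHomologyIso e e' g) :
    IsHomologyIso (G.tensorD e) (G'.tensorD e') (TensorProduct.map f g) := by
  have h₁ : IsHomologyIso (G.tensorD e) (G'.tensorD e) (TensorProduct.map f LinearMap.id) := by
    obtain ⟨k, a, b, hk, ha, hb, sk, sa, sb⟩ := G.exists_homotopyInverse G' hd hd' hf hfd h
    refine .of_homotopy (g := TensorProduct.map k LinearMap.id)
      (a := TensorProduct.map a LinearMap.id) (b := TensorProduct.map b LinearMap.id)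
      (fun z => ?_) (fun z => ?_) (fun z => ?_)
    · induction z using TensorProduct.induction_on with
      | zero => simp
      | add x y hx hy => simp only [map_add, hx, hy]
      | tmul x y => simp [DiffGrading.tensorD_tmul, hk, sk]
    · have ht : G'.tensorD e ∘ₗ TensorProduct.map a LinearMap.id +
          TensorProduct.map a LinearMap.id ∘ₗ G'.tensorD e +
          TensorProduct.map f LinearMap.id ∘ₗ TensorProduct.map k LinearMap.id = LinearMap.id :=
        TensorProduct.ext' (fun x y => by
          refine Eq.trans ?_ (congrArg (· ⊗ₜ y) (ha x))
          simp only [LinearMap.add_apply, LinearMap.comp_apply, DiffGrading.tensorD_tmul,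
            map_add, TensorProduct.map_tmul, LinearMap.id_apply, sa,
            TensorProduct.neg_tmul, TensorProduct.add_tmul]
          abel)
      exact LinearMap.congr_fun ht z
    · have ht : G.tensorD e ∘ₗ TensorProduct.map b LinearMap.id +
          TensorProduct.map b LinearMap.id ∘ₗ G.tensorD e +
          TensorProduct.map k LinearMap.id ∘ₗ TensorProduct.map f LinearMap.id = LinearMap.id :=
        TensorProduct.ext' (fun x y => by
          refine Eq.trans ?_ (congrArg (· ⊗ₜ y) (hb x))
          simp only [LinearMap.add_apply, LinearMap.comp_apply, DiffGrading.tensorD_tmul,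
            map_add, TensorProduct.map_tmul, LinearMap.id_apply, sb,
            TensorProduct.neg_tmul, TensorProduct.add_tmul]
          abel)
      exact LinearMap.congr_fun ht z
  have h₂ : IsHomologyIso (G'.tensorD e) (G'.tensorD e') (TensorProduct.map LinearMap.id g) := by
    obtain ⟨k, a, b, hk, ha, hb, sk, sa, sb⟩ := E.exists_homotopyInverse E' he he' hg hge h'
    -- The homotopies are odd and pass the first factor, so they are twisted by `sgn`; this cancels
    -- the cross terms with the differential of the first factor.
    refine .of_homotopy (g := TensorProduct.map LinearMap.id k)
      (a := TensorProduct.map G'.sgn a) (b := TensorProduct.map G'.sgn b)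
      (fun z => ?_) (fun z => ?_) (fun z => ?_)
    · induction z using TensorProduct.induction_on with
      | zero => simp
      | add x y hx hy => simp only [map_add, hx, hy]
      | tmul x y => simp [DiffGrading.tensorD_tmul, hk]
    · have ht : G'.tensorD e' ∘ₗ TensorProduct.map G'.sgn a +
          TensorProduct.map G'.sgn a ∘ₗ G'.tensorD e' +
          TensorProduct.map LinearMap.id g ∘ₗ TensorProduct.map LinearMap.id k = LinearMap.id :=
        TensorProduct.ext' (fun x y => by
          refine Eq.trans ?_ (congrArg (x ⊗ₜ ·) (ha y))
          simp only [LinearMap.add_apply, LinearMap.comp_apply, DiffGrading.tensorD_tmul,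
            map_add, TensorProduct.map_tmul, LinearMap.id_apply, G'.sgn_sgn, G'.sgn_d,
            TensorProduct.neg_tmul, TensorProduct.tmul_add]
          abel)
      exact LinearMap.congr_fun ht z
    · have ht : G'.tensorD e ∘ₗ TensorProduct.map G'.sgn b +
          TensorProduct.map G'.sgn b ∘ₗ G'.tensorD e +
          TensorProduct.map LinearMap.id k ∘ₗ TensorProduct.map LinearMap.id g = LinearMap.id :=
        TensorProduct.ext' (fun x y => by
          refine Eq.trans ?_ (congrArg (x ⊗ₜ ·) (hb y))
          simp only [LinearMap.add_apply, LinearMap.comp_apply, DiffGrading.tensorD_tmul,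
            map_add, TensorProduct.map_tmul, LinearMap.id_apply, G'.sgn_sgn, G'.sgn_d,
            TensorProduct.neg_tmul, TensorProduct.tmul_add]
          abel)
      exact LinearMap.congr_fun ht z
  have h₃ := h₁.comp (fun z => ?_) (fun z => ?_) h₂
  · rwa [← TensorProduct.map_comp, LinearMap.id_comp, LinearMap.comp_id] at h₃
  · induction z using TensorProduct.induction_on with
    | zero => simp
    | add x y hx hy => simp only [map_add, hx, hy]
    | tmul x y => simp [DiffGrading.tensorD_tmul, hfd, G.sgn_comm G' hf]
  · induction z using TensorProduct.induction_on with
    | zero => simp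
    | add x y hx hy => simp only [map_add, hx, hy]
    | tmul x y => simp [DiffGrading.tensorD_tmul, hge]

end DiffGradingHomotopy

/-! ### Sums over all degrees, and submodules spanned by composites of a given shape. -/

section Total

variable {K : Type u} [CommRing K]

section Family

variable {X : ℕ → Type v} [∀ a, AddCommGroup (X a)] [∀ a, Module K (X a)]
  {Y : ℕ → Type w} [∀ a, AddCommGroup (Y a)] [∀ a, Module K (Y a)]

/-- The differential of the total module of a complex. -/
noncomputable def totalD (d : ∀ a, X (a + 1) →ₗ[K] X a) :
    (DirectSum ℕ X) →ₗ[K] DirectSum ℕ X :=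
  DirectSum.toModule K ℕ _ (fun a => match a with
    | 0 => 0
    | a + 1 => DirectSum.lof K ℕ X a ∘ₗ d a)

theorem totalD_lof_zero (d : ∀ a, X (a + 1) →ₗ[K] X a) (x : X 0) :
    totalD d (DirectSum.lof K ℕ X 0 x) = 0 := by
  rw [totalD, DirectSum.toModule_lof]
  rfl

theorem totalD_lof_succ (d : ∀ a, X (a + 1) →ₗ[K] X a) (a : ℕ) (x : X (a + 1)) :
    totalD d (DirectSum.lof K ℕ X (a + 1) x) = DirectSum.lof K ℕ X a (d a x) := by
  rw [totalD, DirectSum.toModule_lof]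
  rfl

theorem totalD_totalD {d : ∀ a, X (a + 1) →ₗ[K] X a} (hd : ∀ a x, d a (d (a + 1) x) = 0)
    (x : DirectSum ℕ X) : totalD d (totalD d x) = 0 := by
  have h : totalD d ∘ₗ totalD d = 0 := DirectSum.linearMap_ext K (fun a => LinearMap.ext (fun x => by
    rcases a with _ | _ | a
    · simp [totalD_lof_zero]
    · simp [totalD_lof_succ, totalD_lof_zero]
    · simp [totalD_lof_succ, hd]))
  exact LinearMap.congr_fun h x

theorem lmap_totalD {d : ∀ a, X (a + 1) →ₗ[K] X a} {d' : ∀ a, Y (a + 1) →ₗ[K] Y a}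
    {f : ∀ a, X a →ₗ[K] Y a} (hf : ∀ a x, f a (d a x) = d' a (f (a + 1) x))
    (x : DirectSum ℕ X) :
    DirectSum.lmap f (totalD d x) = totalD d' (DirectSum.lmap f x) := by
  have h : DirectSum.lmap f ∘ₗ totalD d = totalD d' ∘ₗ DirectSum.lmap f :=
    DirectSum.linearMap_ext K (fun a => LinearMap.ext (fun x => by
      rcases a with _ | a
      · simp [totalD_lof_zero]
      · simp [totalD_lof_succ, hf]))
  exact LinearMap.congr_fun h x

theorem lof_component_lof (a b : ℕ) (x : X b) :
    DirectSum.lof K ℕ X a (DirectSum.component K ℕ X a (DirectSum.lof K ℕ X b x)) =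
      if a = b then DirectSum.lof K ℕ X b x else 0 := by
  split_ifs with h
  · subst h
    rw [DirectSum.component.lof_self]
  · rw [DirectSum.component.of, dif_neg (fun e => h e.symm), map_zero]

/-- The grading of the total module of a complex. -/
noncomputable def totalGrading (d : ∀ a, X (a + 1) →ₗ[K] X a) : DiffGrading (totalD d) where
  pr a := DirectSum.lof K ℕ X a ∘ₗ DirectSum.component K ℕ X a
  sgn := DirectSum.lmap (fun a => (-1 : K) ^ a • LinearMap.id)
  pr_self a x := by simp [DirectSum.component.lof_self]
  pr_ne a b x h := by
    rw [LinearMap.comp_apply, LinearMap.comp_apply, lof_component_lof, if_neg h]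
  pr_d a x := by
    have h : (DirectSum.lof K ℕ X a ∘ₗ DirectSum.component K ℕ X a) ∘ₗ totalD d =
        totalD d ∘ₗ (DirectSum.lof K ℕ X (a + 1) ∘ₗ DirectSum.component K ℕ X (a + 1)) :=
      DirectSum.linearMap_ext K (fun b => LinearMap.ext (fun x => by
        simp only [LinearMap.comp_apply, lof_component_lof]
        rcases b with _ | b
        · simp [totalD_lof_zero]
        · rw [totalD_lof_succ, lof_component_lof]
          by_cases e : a = b
          · subst e
            simp [totalD_lof_succ]
          · rw [if_neg e, if_neg (fun h => e (by omega)), map_zero]))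
    exact LinearMap.congr_fun h x
  d_pr_zero x := totalD_lof_zero d _
  sgn_pr a x := by simp
  exists_sum x := by
    induction x using DirectSum.induction_on with
    | zero => exact ⟨0, fun n _ => by simp⟩
    | of b x =>
      refine ⟨b + 1, fun n hn => ?_⟩
      change ∑ a ∈ Finset.range n, DirectSum.lof K ℕ X a (DirectSum.component K ℕ X a
        (DirectSum.lof K ℕ X b x)) = DirectSum.lof K ℕ X b x
      simp only [lof_component_lof]
      rw [Finset.sum_ite_eq' , if_pos (Finset.mem_range.2 hn)]
    | add x y hx hy =>
      obtain ⟨N, hN⟩ := hx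
      obtain ⟨N', hN'⟩ := hy
      refine ⟨N + N', fun n hn => ?_⟩
      simp only [map_add, Finset.sum_add_distrib]
      rw [hN n (by omega), hN' n (by omega)]

theorem totalGrading_pr_lof (d : ∀ a, X (a + 1) →ₗ[K] X a) (a b : ℕ) (x : X b) :
    (totalGrading d).pr a (DirectSum.lof K ℕ X b x) =
      if a = b then DirectSum.lof K ℕ X b x else 0 := lof_component_lof a b x

theorem totalGrading_sgn_lof (d : ∀ a, X (a + 1) →ₗ[K] X a) (a : ℕ) (x : X a) :
    (totalGrading d).sgn (DirectSum.lof K ℕ X a x) =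
      (-1 : K) ^ a • DirectSum.lof K ℕ X a x := by
  rw [totalGrading, DirectSum.lmap_lof, LinearMap.smul_apply, map_smul, LinearMap.id_apply]

theorem lmap_totalGrading_pr {d : ∀ a, X (a + 1) →ₗ[K] X a} {d' : ∀ a, Y (a + 1) →ₗ[K] Y a}
    (f : ∀ a, X a →ₗ[K] Y a) (a : ℕ) (x : DirectSum ℕ X) :
    DirectSum.lmap f ((totalGrading d).pr a x) = (totalGrading d').pr a (DirectSum.lmap f x) := by
  have h : DirectSum.lmap f ∘ₗ (totalGrading d).pr a =
      (totalGrading d').pr a ∘ₗ DirectSum.lmap f :=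
    DirectSum.linearMap_ext K (fun b => LinearMap.ext (fun x => by
      simp only [LinearMap.comp_apply, totalGrading_pr_lof, DirectSum.lmap_lof]
      split_ifs <;> simp))
  exact LinearMap.congr_fun h x

end Family

/-- The grading of a quotient by a homogeneous submodule. -/
noncomputable def DiffGrading.quotient {X : Type*} [AddCommGroup X] [Module K X] {d : X →ₗ[K] X}
    (G : DiffGrading d) (S : Submodule K X) (hd : S ≤ S.comap d)
    (hS : ∀ a, S ≤ S.comap (G.pr a)) : DiffGrading (S.mapQ S d hd) where
  pr a := S.mapQ S (G.pr a) (hS a)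
  sgn := S.mapQ S G.sgn (fun x hx => by
    obtain ⟨N, hN⟩ := G.exists_sum x
    rw [Submodule.mem_comap, ← hN N le_rfl, map_sum]
    exact Submodule.sum_mem _ (fun a _ => by
      rw [G.sgn_pr]
      exact Submodule.smul_mem _ _ (hS a hx)))
  pr_self a x := by
    obtain ⟨x, rfl⟩ := S.mkQ_surjective x
    simp [G.pr_self]
  pr_ne a b x h := by
    obtain ⟨x, rfl⟩ := S.mkQ_surjective x
    simp [G.pr_ne a b x h]
  pr_d a x := by
    obtain ⟨x, rfl⟩ := S.mkQ_surjective x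
    simp [G.pr_d]
  d_pr_zero x := by
    obtain ⟨x, rfl⟩ := S.mkQ_surjective x
    simp [G.d_pr_zero]
  sgn_pr a x := by
    obtain ⟨x, rfl⟩ := S.mkQ_surjective x
    simp [G.sgn_pr]
  exists_sum x := by
    obtain ⟨x, rfl⟩ := S.mkQ_surjective x
    obtain ⟨N, hN⟩ := G.exists_sum x
    refine ⟨N, fun n hn => ?_⟩
    conv_rhs => rw [← hN n hn]
    simp

/-- The sum of the components of a graded `Σ_*`-module in an arity. -/
abbrev GradedSigmaModule.Total (M : GradedSigmaModule.{u, v} K) (n : ℕ) : Type v :=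
  DirectSum ℕ (fun d => M.X n d)

/-- The inclusion of a homogeneous component. -/
noncomputable def GradedSigmaModule.tot (M : GradedSigmaModule.{u, v} K) {n : ℕ} (d : ℕ) :
    M.X n d →ₗ[K] M.Total n :=
  DirectSum.lof K ℕ (fun d => M.X n d) d

/-- The action of permutations on the sum of the components. -/
noncomputable def GradedSigmaModule.totAct (M : GradedSigmaModule.{u, v} K) {n : ℕ}
    (σ : Equiv.Perm (Fin n)) : M.Total n →ₗ[K] M.Total n :=
  DirectSum.lmap (fun d => M.ρ n d σ)

theorem GradedSigmaModule.totAct_tot (M : GradedSigmaModule.{u, v} K) {n d : ℕ}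
    (σ : Equiv.Perm (Fin n)) (p : M.X n d) : M.totAct σ (M.tot d p) = M.tot d (M.ρ n d σ p) :=
  DirectSum.lmap_lof _ _ _

theorem GradedSigmaModule.tot_induction (M : GradedSigmaModule.{u, v} K) {n : ℕ}
    {C : M.Total n → Prop} (zero : C 0) (add : ∀ x y, C x → C y → C (x + y))
    (tot : ∀ d x, C (M.tot d x)) (x : M.Total n) : C x :=
  DirectSum.induction_on x zero tot add

namespace GradedOperad

variable (P : GradedOperad.{u, v} K)

/-- The composition products on the sums of the components. -/
noncomputable def totCirc {m n k : ℕ} (i : Fin m) (hk : m + n = k + 1) :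
    P.Total m →ₗ[K] P.Total n →ₗ[K] P.Total k :=
  DirectSum.toModule K ℕ _ (fun a => LinearMap.flip (DirectSum.toModule K ℕ _ (fun b =>
    ((P.circ i hk (rfl : a + b = a + b)).compr₂ (P.tot (a + b))).flip)))

theorem totCirc_tot {m n k a b c : ℕ} (i : Fin m) (hk : m + n = k + 1) (hc : a + b = c)
    (p : P.X m a) (q : P.X n b) :
    P.totCirc i hk (P.tot a p) (P.tot b q) = P.tot c (P.circ i hk hc p q) := by
  subst hc
  rw [totCirc, GradedSigmaModule.tot, GradedSigmaModule.tot, DirectSum.toModule_lof,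
    LinearMap.flip_apply, DirectSum.toModule_lof]
  rfl

variable {P} (D : P.Differential)

/-- The differential on the sum of the components. -/
noncomputable def Differential.total (n : ℕ) : P.Total n →ₗ[K] P.Total n := totalD (D.d n)

theorem Differential.total_tot_zero {n : ℕ} (p : P.X n 0) : D.total n (P.tot 0 p) = 0 :=
  totalD_lof_zero _ p

theorem Differential.total_tot_succ {n a : ℕ} (p : P.X n (a + 1)) :
    D.total n (P.tot (a + 1) p) = P.tot a (D.d n a p) :=
  totalD_lof_succ _ a p

theorem Differential.total_total {n : ℕ} (p : P.Total n) : D.total n (D.total n p) = 0 :=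
  totalD_totalD (D.d_d n) p

/-- The grading on the sum of the components. -/
noncomputable def Differential.grading (n : ℕ) : DiffGrading (D.total n) := totalGrading (D.d n)

theorem Differential.grading_pr_tot {n : ℕ} (a b : ℕ) (p : P.X n b) :
    (D.grading n).pr a (P.tot b p) = if a = b then P.tot b p else 0 :=
  totalGrading_pr_lof _ a b p

theorem Differential.grading_sgn_tot {n : ℕ} (a : ℕ) (p : P.X n a) :
    (D.grading n).sgn (P.tot a p) = (-1 : K) ^ a • P.tot a p :=
  totalGrading_sgn_lof _ a p

theorem Differential.total_act {n : ℕ} (σ : Equiv.Perm (Fin n)) (p : P.Total n) :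
    D.total n (P.totAct σ p) = P.totAct σ (D.total n p) :=
  (lmap_totalD (fun a x => (D.d_ρ n a σ x).symm) p).symm

/-- On the sum of all degrees the Leibniz rule takes a single form: `sgn` carries the sign, and the
vanishing of the differential in degree `0` covers the special cases. -/
theorem Differential.total_circ {m n k : ℕ} (i : Fin m) (hk : m + n = k + 1) (p : P.Total m)
    (q : P.Total n) :
    D.total k (P.totCirc i hk p q) = P.totCirc i hk (D.total m p) q +
      P.totCirc i hk ((D.grading m).sgn p) (D.total n q) := by
  induction p using P.tot_induction with
  | zero => simp
  | add x y hx hy =>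
    simp only [map_add, LinearMap.add_apply, hx, hy]
    abel
  | tot a p =>
    induction q using P.tot_induction with
    | zero => simp
    | add x y hx hy =>
      simp only [map_add, hx, hy]
      abel
    | tot b q =>
      rw [D.grading_sgn_tot, map_smul, LinearMap.smul_apply]
      rcases a with _ | a <;> rcases b with _ | b
      · rw [P.totCirc_tot i hk rfl, D.total_tot_zero, D.total_tot_zero]
        simp [D.total_tot_zero]
      · rw [P.totCirc_tot i hk (by omega : 0 + (b + 1) = b + 1), D.total_tot_succ,
          D.total_tot_succ, D.total_tot_zero, map_zero, LinearMap.zero_apply, pow_zero, one_smul,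
          P.totCirc_tot i hk (zero_add b), D.d_circ_right i hk _ (zero_add b)]
        exact (zero_add _).symm
      · rw [P.totCirc_tot i hk (by omega : (a + 1) + 0 = a + 1), D.total_tot_succ,
          D.total_tot_succ, D.total_tot_zero, map_zero, smul_zero,
          P.totCirc_tot i hk (add_zero a), D.d_circ_left i hk _ (add_zero a)]
        exact (add_zero _).symm
      · rw [P.totCirc_tot i hk (by omega : (a + 1) + (b + 1) = (a + b + 1) + 1),
          D.total_tot_succ, D.total_tot_succ, D.total_tot_succ,
          P.totCirc_tot i hk (by omega : a + (b + 1) = a + b + 1),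
          P.totCirc_tot i hk (by omega : (a + 1) + b = a + b + 1), D.d_circ i hk _ (by omega)
          (by omega), map_add, map_smul]

end GradedOperad

/-- The span of the composites `p ∘_i q`, and their images under permutations, such that the arity
of `q` and the set of the inputs of `q` satisfy a condition. -/
def GradedOperad.decomp (P : GradedOperad.{u, v} K) (n : ℕ) (Φ : ℕ → Set (Fin n) → Prop) :
    Submodule K (P.Total n) :=
  Submodule.span K {z | ∃ (m l a b d : ℕ) (i : Fin m) (hk : m + l = n + 1) (hc : a + b = d)
    (σ : Equiv.Perm (Fin n)) (p : P.X m a) (q : P.X l b), Φ l (Set.range (σ ∘ inR i hk)) ∧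
      z = P.tot d (P.ρ n d σ (P.circ i hk hc p q))}

namespace GradedOperad

variable {P : GradedOperad.{u, v} K}

theorem tot_mem_decomp {m l n a b d : ℕ} {Φ : ℕ → Set (Fin n) → Prop} (i : Fin m)
    (hk : m + l = n + 1) (hc : a + b = d) (σ : Equiv.Perm (Fin n)) (p : P.X m a) (q : P.X l b)
    (h : Φ l (Set.range (σ ∘ inR i hk))) :
    P.tot d (P.ρ n d σ (P.circ i hk hc p q)) ∈ P.decomp n Φ :=
  Submodule.subset_span ⟨m, l, a, b, d, i, hk, hc, σ, p, q, h, rfl⟩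

theorem totAct_totCirc_mem_decomp {m l n : ℕ} {Φ : ℕ → Set (Fin n) → Prop} (i : Fin m)
    (hk : m + l = n + 1) (σ : Equiv.Perm (Fin n)) (p : P.Total m) (q : P.Total l)
    (h : Φ l (Set.range (σ ∘ inR i hk))) :
    P.totAct σ (P.totCirc i hk p q) ∈ P.decomp n Φ := by
  induction p using P.tot_induction with
  | zero => simp
  | add x y hx hy =>
    rw [map_add, LinearMap.add_apply, map_add]
    exact Submodule.add_mem _ hx hy
  | tot a p =>
    induction q using P.tot_induction with
    | zero => simp
    | add x y hx hy =>
      rw [map_add, map_add]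
      exact Submodule.add_mem _ hx hy
    | tot b q =>
      rw [P.totCirc_tot i hk rfl, P.totAct_tot]
      exact tot_mem_decomp i hk rfl σ p q h

theorem decomp_mono {n : ℕ} {Φ Ψ : ℕ → Set (Fin n) → Prop} (h : ∀ l C, Φ l C → Ψ l C) :
    P.decomp n Φ ≤ P.decomp n Ψ := by
  refine Submodule.span_mono ?_
  rintro z ⟨m, l, a, b, d, i, hk, hc, σ, p, q, hΦ, rfl⟩
  exact ⟨m, l, a, b, d, i, hk, hc, σ, p, q, h _ _ hΦ, rfl⟩

/-- By the Leibniz rule the differential of `σ (p ∘_i q)` is a sum of composites with the same `σ`,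
`i` and arities, and `Φ` depends on nothing else. -/
theorem decomp_le_comap_total (D : P.Differential) (n : ℕ) (Φ : ℕ → Set (Fin n) → Prop) :
    P.decomp n Φ ≤ (P.decomp n Φ).comap (D.total n) := by
  refine Submodule.span_le.2 ?_
  rintro z ⟨m, l, a, b, d, i, hk, hc, σ, p, q, h, rfl⟩
  rw [SetLike.mem_coe, Submodule.mem_comap, ← P.totAct_tot, ← P.totCirc_tot, D.total_act,
    D.total_circ, map_add]
  exact Submodule.add_mem _ (totAct_totCirc_mem_decomp i hk σ _ _ h)
    (totAct_totCirc_mem_decomp i hk σ _ _ h)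

theorem decomp_le_comap_pr (D : P.Differential) (n : ℕ) (Φ : ℕ → Set (Fin n) → Prop) (e : ℕ) :
    P.decomp n Φ ≤ (P.decomp n Φ).comap ((D.grading n).pr e) := by
  refine Submodule.span_le.2 ?_
  rintro z ⟨m, l, a, b, d, i, hk, hc, σ, p, q, h, rfl⟩
  rw [SetLike.mem_coe, Submodule.mem_comap, D.grading_pr_tot]
  split_ifs
  · exact tot_mem_decomp i hk hc σ p q h
  · exact Submodule.zero_mem _

variable {Q : GradedOperad.{u, w} K}

/-- A morphism of operads on the sums of the components. -/
noncomputable def Hom.total (φ : GradedOperad.Hom P Q) (n : ℕ) : P.Total n →ₗ[K] Q.Total n :=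
  DirectSum.lmap (φ.app n)

theorem Hom.total_tot (φ : GradedOperad.Hom P Q) {n d : ℕ} (p : P.X n d) :
    φ.total n (P.tot d p) = Q.tot d (φ.app n d p) :=
  DirectSum.lmap_lof _ _ _

theorem Hom.total_act (φ : GradedOperad.Hom P Q) {n : ℕ} (σ : Equiv.Perm (Fin n))
    (p : P.Total n) : φ.total n (P.totAct σ p) = Q.totAct σ (φ.total n p) := by
  induction p using P.tot_induction with
  | zero => simp
  | add x y hx hy => simp only [map_add, hx, hy]
  | tot a p => rw [P.totAct_tot, φ.total_tot, φ.total_tot, Q.totAct_tot, φ.map_ρ]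

theorem Hom.total_circ (φ : GradedOperad.Hom P Q) {m n k : ℕ} (i : Fin m) (hk : m + n = k + 1)
    (p : P.Total m) (q : P.Total n) :
    φ.total k (P.totCirc i hk p q) = Q.totCirc i hk (φ.total m p) (φ.total n q) := by
  induction p using P.tot_induction with
  | zero => simp
  | add x y hx hy => simp only [map_add, LinearMap.add_apply, hx, hy]
  | tot a p =>
    induction q using P.tot_induction with
    | zero => simp
    | add x y hx hy => simp only [map_add, hx, hy]
    | tot b q =>
      rw [P.totCirc_tot i hk rfl, φ.total_tot, φ.total_tot, φ.total_tot, Q.totCirc_tot i hk rfl,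
        φ.map_circ]

theorem decomp_le_comap_hom (φ : GradedOperad.Hom P Q) (n : ℕ) (Φ : ℕ → Set (Fin n) → Prop) :
    P.decomp n Φ ≤ (Q.decomp n Φ).comap (φ.total n) := by
  refine Submodule.span_le.2 ?_
  rintro z ⟨m, l, a, b, d, i, hk, hc, σ, p, q, h, rfl⟩
  rw [SetLike.mem_coe, Submodule.mem_comap, φ.total_tot, φ.map_ρ, φ.map_circ]
  exact tot_mem_decomp i hk hc σ _ _ h

end GradedOperad

end Total

/-! ### Recovering an operation from a labelled operation. -/

section Retraction

variable {K : Type u} [CommRing K] {P : GradedOperad.{u, v} K} {L : Type}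

/-- The identification of the operations of two equal arities. -/
noncomputable def GradedOperad.castArity (P : GradedOperad.{u, v} K) {k m : ℕ} (e : k = m)
    (d : ℕ) : P.X k d →ₗ[K] P.X m d := by
  subst e
  exact LinearMap.id

open scoped Classical in
/-- The component of `retract v` on operations with inputs labelled by a given word. -/
noncomputable def retractWord {m : ℕ} (v : Fin m → L) (k d : ℕ) (w : Fin k → L) :
    P.X k d →ₗ[K] P.Total m :=
  if h : ∃ (τ : Equiv.Perm (Fin m)) (e : k = m), w = v ∘ τ ∘ Fin.cast e then
    P.totAct h.choose ∘ₗ P.tot d ∘ₗ P.castArity h.choose_spec.choose d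
  else 0

/-- As `v` is injective, the permutation relating two words is unique, so the choice in
`retractWord` does not matter. -/
theorem retractWord_self {m : ℕ} {v : Fin m → L} (hv : Function.Injective v) (d : ℕ)
    (τ : Equiv.Perm (Fin m)) (p : P.X m d) :
    retractWord v m d (v ∘ τ) p = P.tot d (P.ρ m d τ p) := by
  have h : ∃ (τ' : Equiv.Perm (Fin m)) (e : m = m), v ∘ τ = v ∘ τ' ∘ Fin.cast e := ⟨τ, rfl, rfl⟩
  obtain ⟨_, h₁⟩ := h.choose_spec
  have h₂ : h.choose = τ := Equiv.ext (fun x => (hv (congrFun h₁ x)).symm)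
  rw [retractWord, dif_pos h, h₂, LinearMap.comp_apply, LinearMap.comp_apply, P.totAct_tot]
  rfl

theorem retractWord_of_not {m : ℕ} (v : Fin m → L) (k d : ℕ) (w : Fin k → L)
    (h : ¬∃ (τ : Equiv.Perm (Fin m)) (e : k = m), w = v ∘ τ ∘ Fin.cast e) (p : P.X k d) :
    retractWord v k d w p = 0 := by
  rw [retractWord, dif_neg h, LinearMap.zero_apply]

/-- The operation with inputs labelled by the word `v`, as a function of the labelled operation. It
vanishes on the operations labelled by other words. -/
noncomputable def retract {m : ℕ} (v : Fin m → L) (hv : Function.Injective v) :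
    LabelledOps P L →ₗ[K] P.Total m :=
  labLift (fun k d w => retractWord v k d w) (fun k d w σ p => by
    by_cases h : ∃ (τ : Equiv.Perm (Fin m)) (e : k = m), w = v ∘ τ ∘ Fin.cast e
    · obtain ⟨τ, rfl, rfl⟩ := h
      have h₁ : (v ∘ τ ∘ Fin.cast rfl) ∘ σ = v ∘ (τ * σ) := rfl
      have h₂ : v ∘ τ ∘ Fin.cast rfl = v ∘ τ := rfl
      rw [h₁, h₂, retractWord_self hv, retractWord_self hv, map_mul]
      rfl
    · rw [retractWord_of_not _ _ _ _ h, retractWord_of_not]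
      rintro ⟨τ, rfl, e⟩
      refine h ⟨τ * σ⁻¹, rfl, funext (fun x => ?_)⟩
      have := congrFun e (σ⁻¹ x)
      simpa using this)

theorem retract_lab_self {m : ℕ} {v : Fin m → L} (hv : Function.Injective v) {d : ℕ}
    (p : P.X m d) : retract v hv (lab v p) = P.tot d p := by
  rw [retract, labLift_lab]
  have h := retractWord_self (P := P) hv d 1 p
  rw [map_one] at h
  exact h

theorem retract_lab_of_notMem {m : ℕ} {v : Fin m → L} (hv : Function.Injective v) {k d : ℕ}
    (w : Fin k → L) (p : P.X k d) (x : Fin k) (h : w x ∉ Set.range v) :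
    retract v hv (lab w p) = 0 := by
  rw [retract, labLift_lab, retractWord_of_not]
  rintro ⟨τ, rfl, e⟩
  exact h ⟨τ x, (congrFun e x).symm⟩

theorem retract_lab_of_notMem' {m : ℕ} {v : Fin m → L} (hv : Function.Injective v) {k d : ℕ}
    (w : Fin k → L) (p : P.X k d) (x : Fin m) (h : v x ∉ Set.range w) :
    retract v hv (lab w p) = 0 := by
  rw [retract, labLift_lab, retractWord_of_not]
  rintro ⟨τ, rfl, e⟩
  exact h ⟨τ⁻¹ x, by simpa using congrFun e (τ⁻¹ x)⟩

theorem retract_lab_of_ne {m : ℕ} {v : Fin m → L} (hv : Function.Injective v) {k d : ℕ}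
    (w : Fin k → L) (p : P.X k d) (h : k ≠ m) : retract v hv (lab w p) = 0 := by
  rw [retract, labLift_lab, retractWord_of_not]
  rintro ⟨τ, e, -⟩
  exact h e

/-- Either the word is a reordering of `v`, and the value is a composite whose block can be read
from the labels, or the value is zero. -/
theorem retract_lab_circ_mem {m : ℕ} {v : Fin m → L} (hv : Function.Injective v)
    {Φ : ℕ → Set (Fin m) → Prop} {m' l k a b c : ℕ} (i : Fin m') (hk : m' + l = k + 1)
    (hc : a + b = c) (w : Fin k → L) (p : P.X m' a) (q : P.X l b)
    (h : ∀ τ : Fin k → Fin m, k = m → w = v ∘ τ → Φ l (Set.range (τ ∘ inR i hk))) :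
    retract v hv (lab w (P.circ i hk hc p q)) ∈ P.decomp m Φ := by
  rw [retract, labLift_lab]
  by_cases h' : ∃ (τ : Equiv.Perm (Fin m)) (e : k = m), w = v ∘ τ ∘ Fin.cast e
  · obtain ⟨τ, rfl, rfl⟩ := h'
    have h₂ : v ∘ τ ∘ Fin.cast rfl = v ∘ τ := rfl
    rw [h₂, retractWord_self hv]
    exact GradedOperad.tot_mem_decomp i hk hc τ p q (h τ rfl rfl)
  · rw [retractWord_of_not _ _ _ _ h']
    exact Submodule.zero_mem _

end Retraction

/-! ### Cuts into two operations of arity at least two. -/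

section HighPairs

variable {K : Type u} [CommRing K] {P : GradedOperad.{u, v} K}

/-- The pairs of operations of arity at least two, such that the label `none` occurs in the first
factor. -/
def CutPairs.high (P : GradedOperad.{u, v} K) (n : ℕ) : Submodule K (CutPairs P n) :=
  Submodule.span K {z | ∃ (m l a b : ℕ) (v : Fin m → Option (Fin n)) (w : Fin l → Option (Fin n))
    (p : P.X m a) (q : P.X l b), 2 ≤ m ∧ 2 ≤ l ∧ (∃ j, v j = none) ∧ z = lab v p ⊗ₜ lab w q}

theorem CutPairs.high_induction {n : ℕ} {C : CutPairs P n → Prop}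
    (zero : C 0) (add : ∀ x y, C x → C y → C (x + y)) (smul : ∀ (c : K) x, C x → C (c • x))
    (mem : ∀ (m l a b : ℕ) (v : Fin m → Option (Fin n)) (w : Fin l → Option (Fin n))
      (p : P.X m a) (q : P.X l b), 2 ≤ m → 2 ≤ l → (∃ j, v j = none) → C (lab v p ⊗ₜ lab w q))
    {z : CutPairs P n} (hz : z ∈ CutPairs.high P n) : C z := by
  induction hz using Submodule.span_induction with
  | mem z h =>
    obtain ⟨m, l, a, b, v, w, p, q, hm, hl, hv, rfl⟩ := h
    exact mem m l a b v w p q hm hl hv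
  | zero => exact zero
  | add x y _ _ hx hy => exact add x y hx hy
  | smul c x _ hx => exact smul c x hx

theorem CutPairs.tmul_mem_high {m l n a b : ℕ} (v : Fin m → Option (Fin n))
    (w : Fin l → Option (Fin n)) (p : P.X m a) (q : P.X l b) (hm : 2 ≤ m) (hl : 2 ≤ l)
    (hv : ∃ j, v j = none) : (lab v p ⊗ₜ[K] lab w q : CutPairs P n) ∈ CutPairs.high P n :=
  Submodule.subset_span ⟨m, l, a, b, v, w, p, q, hm, hl, hv, rfl⟩

theorem cutAct_mem_high {n : ℕ} (σ : Equiv.Perm (Fin n)) {α : CutPairs P n}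
    (hα : α ∈ CutPairs.high P n) : cutAct σ α ∈ CutPairs.high P n := by
  refine CutPairs.high_induction (C := fun α => cutAct σ α ∈ CutPairs.high P n) ?_ ?_ ?_ ?_ hα
  · rw [map_zero]
    exact Submodule.zero_mem _
  · intro x y hx hy
    rw [map_add]
    exact Submodule.add_mem _ hx hy
  · intro c x hx
    rw [map_smul]
    exact Submodule.smul_mem _ c hx
  intro x y e f v w p r hx hy ⟨j, hj⟩
  rw [cutAct, TensorProduct.map_tmul, relabel_lab, relabel_lab]
  exact CutPairs.tmul_mem_high _ _ p r hx hy ⟨j, by rw [Function.comp_apply, hj, Option.map_none]⟩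

theorem cutLeft_mem_high {m n k a : ℕ} (i : Fin m) (hk : m + n = k + 1) (p : P.X m a)
    (hm : 2 ≤ m) {β : CutPairs P n} (hβ : β ∈ CutPairs.high P n) :
    cutLeft i hk p β ∈ CutPairs.high P k := by
  refine CutPairs.high_induction (C := fun β => cutLeft i hk p β ∈ CutPairs.high P k)
    ?_ ?_ ?_ ?_ hβ
  · rw [map_zero]
    exact Submodule.zero_mem _
  · intro x y hx hy
    rw [map_add]
    exact Submodule.add_mem _ hx hy
  · intro c x hx
    rw [map_smul]
    exact Submodule.smul_mem _ c hx
  intro x y e f v w q r hx hy ⟨j, hj⟩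
  have hi : m + x = (m + x - 1) + 1 := add_eq_pred_add_one i x
  rw [cutLeft, TensorProduct.map_tmul, graftOnto_lab, graft_eq i hi rfl, relabel_lab]
  refine CutPairs.tmul_mem_high _ _ _ _ (by omega) hy ⟨inR i hi j, ?_⟩
  rw [graftWord_inR, Function.comp_apply, hj, Option.map_none]

theorem cutRight_mem_high {m n k b : ℕ} (i : Fin m) (hk : m + n = k + 1) (q : P.X n b)
    (hn : 2 ≤ n) {α : CutPairs P m} (hα : α ∈ CutPairs.high P m) :
    cutRight i hk q α ∈ CutPairs.high P k := by
  classical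
  refine CutPairs.high_induction (C := fun α => cutRight i hk q α ∈ CutPairs.high P k)
    ?_ ?_ ?_ ?_ hα
  · rw [map_zero]
    exact Submodule.zero_mem _
  · intro x y hx hy
    rw [map_add]
    exact Submodule.add_mem _ hx hy
  · intro c x hx
    rw [map_smul]
    exact Submodule.smul_mem _ c hx
  intro x y e f v w p r hx hy ⟨j, hj⟩
  rw [cutRight, LinearMap.add_apply, TensorProduct.map_tmul, TensorProduct.map_tmul]
  refine Submodule.add_mem _ ?_ ?_
  · rw [LinearMap.comp_apply, relabel_lab, par_lab, TensorProduct.tmul_smul, plug_lab,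
      TensorProduct.sum_tmul]
    refine Submodule.smul_mem _ _ (Submodule.sum_mem _ (fun z _ => ?_))
    split_ifs with hz
    · have hi : x + n = (x + n - 1) + 1 := add_eq_pred_add_one z n
      have hjz : j ≠ z := by
        rintro rfl
        rw [hj] at hz
        exact Option.some_ne_none _ hz.symm
      rw [graft_eq z hi rfl]
      refine CutPairs.tmul_mem_high _ _ _ _ (by omega) hy ⟨inL z hi j hjz, ?_⟩
      rw [graftWord_inL, Function.comp_apply, hj, outerLabel_none]
    · rw [TensorProduct.zero_tmul]
      exact Submodule.zero_mem _
  · rw [relabel_lab, plug_lab, TensorProduct.tmul_sum]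
    refine Submodule.sum_mem _ (fun z _ => ?_)
    split_ifs with hz
    · have hi : y + n = (y + n - 1) + 1 := add_eq_pred_add_one z n
      rw [graft_eq z hi rfl]
      refine CutPairs.tmul_mem_high _ _ _ _ hx (by omega) ⟨j, ?_⟩
      rw [Function.comp_apply, hj, outerLabel_none]
    · rw [TensorProduct.tmul_zero]
      exact Submodule.zero_mem _

theorem freeOperad_arity_zero {M : GradedSigmaModule.{u, v} K} (hM : M.IsReduced) {d : ℕ}
    (p : (freeOperad M).X 0 d) : p = 0 := by
  obtain ⟨s, t, hs, ht, rfl⟩ := exists_scalar_add 0 d p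
  rw [augIdeal_low hM (by omega) ht, add_zero]
  cases hs
  rfl

theorem freeOperad_arity_one {M : GradedSigmaModule.{u, v} K} (hM : M.IsReduced) {d : ℕ}
    (p : (freeOperad M).X 1 d) : IsScalar p := by
  obtain ⟨s, t, hs, ht, rfl⟩ := exists_scalar_add 1 d p
  rwa [augIdeal_low hM le_rfl ht, add_zero]

/-- In a reduced free operad an operation of arity at most one is a multiple of the unit or zero, so
composites with such a factor reduce to the other factor. The bound on `n` excludes the unit itself,
whose cut is minus a pair of units. -/
theorem cut_mem_high {M : GradedSigmaModule.{u, v} K} (hM : M.IsReduced) {n d : ℕ} (hn : 2 ≤ n)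
    (p : (freeOperad M).X n d) : cut p ∈ CutPairs.high (freeOperad M) n := by
  refine freeOperad_induction
    (motive := fun n d p => 2 ≤ n → cut p ∈ CutPairs.high (freeOperad M) n)
    ?_ ?_ ?_ ?_ ?_ ?_ ?_ n d p hn
  · intro n d _
    rw [map_zero]
    exact Submodule.zero_mem _
  · intro n d p q hp hq hn
    rw [map_add]
    exact Submodule.add_mem _ (hp hn) (hq hn)
  · intro n d c p hp hn
    rw [map_smul]
    exact Submodule.smul_mem _ c (hp hn)
  · intro n d σ p hp hn
    rw [cut_act]
    exact cutAct_mem_high σ (hp hn)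
  · intro n d x _
    rw [cut_gen]
    exact Submodule.zero_mem _
  · intro h
    omega
  · intro m n k a b c i hk hc p q hp hq hn
    have hi := i.2
    rcases Nat.lt_or_ge m 2 with hm | hm
    · obtain rfl : m = 1 := by omega
      refine IsScalar.circ_left (C := fun z => cut z ∈ CutPairs.high (freeOperad M) k) i hk hc
        (freeOperad_arity_one hM p) ?_ (fun s hn' hb => ?_)
      · rw [map_zero]
        exact Submodule.zero_mem _
      · subst hn' hb
        rw [map_smul]
        exact Submodule.smul_mem _ s (hq hn)
    rcases Nat.lt_or_ge n 2 with hn' | hn'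
    · rcases Nat.eq_zero_or_pos n with rfl | hn''
      · rw [freeOperad_arity_zero hM q, map_zero, map_zero]
        exact Submodule.zero_mem _
      · obtain rfl : n = 1 := by omega
        refine IsScalar.circ_right (C := fun z => cut z ∈ CutPairs.high (freeOperad M) k) i hk hc
          (freeOperad_arity_one hM q) ?_ (fun s hm' hb => ?_)
        · rw [map_zero]
          exact Submodule.zero_mem _
        · subst hm' hb
          rw [map_smul]
          exact Submodule.smul_mem _ s (hp hn)
    · rw [cut_circ]
      exact Submodule.add_mem _ (Submodule.add_mem _ (cutRight_mem_high i hk q hn' (hp hm))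
        (cutLeft_mem_high i hk p hm (hq hn')))
        (CutPairs.tmul_mem_high _ _ p q hm hn' ⟨i, outerLabel_self i hk⟩)

end HighPairs

/-! ### Blocks of composites, and the component of a cut at a given block. -/

section Blocks

open TensorProduct

/-- The condition on the composites `p ∘_i q` that `p` and `q` are of arity at least two and that
some input of `q` belongs to `U`. -/
def Meets (n : ℕ) (U : Set (Fin n)) (l : ℕ) (C : Set (Fin n)) : Prop :=
  2 ≤ l ∧ l < n ∧ (C ∩ U).Nonempty

/-- The condition on the composites `p ∘_i q` that `p` and `q` are of arity at least two, and that
either some input of `q` belongs to `U`, or `u` is an input of `q` and `q` is of arity at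
least `b`. -/
def MeetsAbove (n : ℕ) (U : Set (Fin n)) (u : Fin n) (b l : ℕ) (C : Set (Fin n)) : Prop :=
  2 ≤ l ∧ l < n ∧ ((C ∩ U).Nonempty ∨ (u ∈ C ∧ b ≤ l))

/-- With `meetsAbove_of_le`: as the bound grows from `0` to `n`, the condition passes from `Meets`
for `insert u U` to `Meets` for `U`. -/
theorem meetsAbove_zero (n : ℕ) (U : Set (Fin n)) (u : Fin n) :
    MeetsAbove n U u 0 = Meets n (insert u U) := by
  funext l C
  refine propext (and_congr_right (fun _ => and_congr_right (fun _ => ⟨?_, ?_⟩)))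
  · rintro (⟨x, hx, hx'⟩ | ⟨hu, -⟩)
    · exact ⟨x, hx, Or.inr hx'⟩
    · exact ⟨u, hu, Or.inl rfl⟩
  · rintro ⟨x, hx, rfl | hx'⟩
    · exact Or.inr ⟨hx, Nat.zero_le l⟩
    · exact Or.inl ⟨x, hx, hx'⟩

theorem meetsAbove_of_le (n : ℕ) (U : Set (Fin n)) (u : Fin n) {b : ℕ} (hb : n ≤ b) :
    MeetsAbove n U u b = Meets n U := by
  funext l C
  refine propext (and_congr_right (fun _ => and_congr_right (fun hl => or_iff_left ?_)))
  rintro ⟨_, h⟩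
  omega

/-- The admissible arities of the second factor are `2, …, n - 1`, so only the bounds in this range
are actual steps of the filtration. -/
theorem meetsAbove_succ (n : ℕ) (U : Set (Fin n)) (u : Fin n) {b : ℕ} (hb : b < 2 ∨ n ≤ b) :
    MeetsAbove n U u (b + 1) = MeetsAbove n U u b := by
  funext l C
  refine propext (and_congr_right (fun h₂ => and_congr_right (fun hl => or_congr_right
    (and_congr_right (fun _ => ?_)))))
  omega

theorem MeetsAbove.of_succ {n : ℕ} {U : Set (Fin n)} {u : Fin n} {b l : ℕ} {C : Set (Fin n)}
    (h : MeetsAbove n U u (b + 1) l C) : MeetsAbove n U u b l C :=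
  ⟨h.1, h.2.1, h.2.2.imp_right (fun h' => ⟨h'.1, by omega⟩)⟩

section Words

variable {m b n : ℕ} (i : Fin m) (hk : m + b = n + 1) (σ : Equiv.Perm (Fin n))

/-- The labels of the inputs of `p` in `σ (p ∘_i q)`. -/
noncomputable def outerWord : Fin m → Option (Fin n) :=
  Option.map σ ∘ outerLabel i hk ∘ some

/-- The labels of the inputs of `q` in `σ (p ∘_i q)`. -/
noncomputable def innerWord : Fin b → Option (Fin n) := some ∘ σ ∘ inR i hk

/-- The set of the inputs of `q` in `σ (p ∘_i q)`. -/
def block : Set (Fin n) := Set.range (σ ∘ inR i hk)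

/-- The set consisting of the input `i` and of the inputs of `p` which belong to `U` in
`σ (p ∘_i q)`. -/
def contract (U : Set (Fin n)) : Set (Fin m) := {a | ∀ h : a ≠ i, σ (inL i hk a h) ∈ U}

theorem outerWord_self : outerWord i hk σ i = none := by simp [outerWord]

theorem outerWord_of_ne (a : Fin m) (h : a ≠ i) :
    outerWord i hk σ a = some (σ (inL i hk a h)) := by
  simp [outerWord, outerLabel_some i hk a h]

theorem outerWord_injective : Function.Injective (outerWord i hk σ) := by
  intro x y h
  by_cases hx : x = i
  · subst hx
    by_cases hy : y = x
    · exact hy.symm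
    · rw [outerWord_self, outerWord_of_ne _ _ _ _ hy] at h
      exact absurd h.symm (Option.some_ne_none _)
  · by_cases hy : y = i
    · subst hy
      rw [outerWord_self, outerWord_of_ne _ _ _ _ hx] at h
      exact absurd h (Option.some_ne_none _)
    · rw [outerWord_of_ne _ _ _ _ hx, outerWord_of_ne _ _ _ _ hy, Option.some_inj,
        σ.injective.eq_iff, inL_inj] at h
      exact h

theorem innerWord_injective : Function.Injective (innerWord i hk σ) := by
  intro x y h
  simpa [innerWord, inR_inj] using h

theorem mem_contract_self (U : Set (Fin n)) : i ∈ contract i hk σ U := fun h => absurd rfl h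

theorem mem_contract_of_outerWord {U : Set (Fin n)} {a : Fin m} {x : Fin n} (hx : x ∈ U)
    (h : outerWord i hk σ a = some x) : a ∈ contract i hk σ U := by
  intro ha
  rw [outerWord_of_ne _ _ _ _ ha, Option.some_inj] at h
  rwa [h]

theorem some_notMem_range_outerWord {x : Fin n} (hx : x ∈ block i hk σ) :
    some x ∉ Set.range (outerWord i hk σ) := by
  rintro ⟨a, h⟩
  obtain ⟨j, rfl⟩ := hx
  by_cases ha : a = i
  · subst ha
    rw [outerWord_self] at h
    exact Option.some_ne_none _ h.symm
  · rw [outerWord_of_ne _ _ _ _ ha, Option.some_inj] at h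
    exact inL_ne_inR _ _ _ _ _ (σ.injective h)

theorem mem_block_of_range_innerWord {x : Fin n} :
    some x ∈ Set.range (innerWord i hk σ) ↔ x ∈ block i hk σ := by
  simp [innerWord, block]

theorem ncard_block : (block i hk σ).ncard = b := by
  rw [block, ← Set.image_univ, Set.ncard_image_of_injective _ (fun x y h => by
    simpa [inR_inj] using h), Set.ncard_univ, Nat.card_fin]

end Words

/-- Two composites `σ (p ∘_i q)` with the same sets of inputs of `q` differ by permutations of `p`
and `q`. -/
theorem exists_permCirc_eq {m b n : ℕ} (i i' : Fin m) (hk : m + b = n + 1)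
    (σ σ' : Equiv.Perm (Fin n)) (h : block i hk σ = block i' hk σ') :
    ∃ (τ : Equiv.Perm (Fin m)) (ρ : Equiv.Perm (Fin b)),
      τ i' = i ∧ σ' = σ * permCirc τ i' ρ hk := by
  have hR : ∀ j : Fin b, ∃ j', σ' (inR i' hk j) = σ (inR i hk j') := fun j => by
    have : σ' (inR i' hk j) ∈ block i hk σ := h ▸ ⟨j, rfl⟩
    obtain ⟨j', hj'⟩ := this
    exact ⟨j', hj'.symm⟩
  -- Both composites have the same complement of the block, which matches the remaining inputs of
  -- the outer operations; `τ` is completed by sending `i'` to `i`.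
  have hL : ∀ a : Fin m, ∃ a', (a = i' ∧ a' = i) ∨
      ∃ (h : a ≠ i') (h' : a' ≠ i), σ' (inL i' hk a h) = σ (inL i hk a' h') := fun a => by
    by_cases ha : a = i'
    · exact ⟨i, Or.inl ⟨ha, rfl⟩⟩
    · obtain ⟨a', h', e⟩ | ⟨j, e⟩ := ins_cases i hk (σ⁻¹ (σ' (inL i' hk a ha)))
      · exact ⟨a', Or.inr ⟨ha, h', by
          rw [← e]
          exact (σ.apply_symm_apply _).symm⟩⟩
      · exfalso
        have h₁ : σ' (inL i' hk a ha) ∈ block i' hk σ' := by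
          rw [← h]
          exact ⟨j, by
            rw [Function.comp_apply, ← e]
            exact σ.apply_symm_apply _⟩
        obtain ⟨j', hj'⟩ := h₁
        exact inL_ne_inR _ _ _ _ _ (σ'.injective hj').symm
  choose ρ hρ using hR
  choose τ hτ using hL
  have hρi : Function.Injective ρ := fun x y e => by
    have := hρ x
    rw [e, ← hρ y, σ'.injective.eq_iff, inR_inj] at this
    exact this
  have hτi : Function.Injective τ := fun x y e => by
    obtain ⟨h₁, h₂⟩ | ⟨h₁, h₂, h₃⟩ := hτ x
    · obtain ⟨h₁', h₂'⟩ | ⟨h₁', h₂', h₃'⟩ := hτ y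
      · rw [h₁, h₁']
      · exact absurd (e ▸ h₂) h₂'
    · obtain ⟨h₁', h₂'⟩ | ⟨h₁', h₂', h₃'⟩ := hτ y
      · exact absurd (e ▸ h₂') h₂
      · have : σ' (inL i' hk x h₁) = σ' (inL i' hk y h₁') := by
          rw [h₃, h₃']
          congr 1
          rw [inL_inj, e]
        rwa [σ'.injective.eq_iff, inL_inj] at this
  have hτ' : τ i' = i := by
    obtain ⟨h₁, h₂⟩ | ⟨h₁, h₂, h₃⟩ := hτ i'
    · exact h₂
    · exact absurd rfl h₁
  refine ⟨Equiv.ofBijective τ (Finite.injective_iff_bijective.1 hτi),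
    Equiv.ofBijective ρ (Finite.injective_iff_bijective.1 hρi), hτ', Equiv.ext (fun x => ?_)⟩
  obtain ⟨a, ha, rfl⟩ | ⟨j, rfl⟩ := ins_cases i' hk x
  · rw [Equiv.Perm.mul_apply, permCirc_inL]
    obtain ⟨h₁, h₂⟩ | ⟨h₁, h₂, h₃⟩ := hτ a
    · exact absurd h₁ ha
    · rw [h₃]
      congr 1
      simp only [Equiv.ofBijective_apply, hτ']
  · rw [Equiv.Perm.mul_apply, permCirc_inR, hρ]
    simp only [Equiv.ofBijective_apply, hτ']

/-- Every set is the set of the inputs of the second factor of a composite. -/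
theorem exists_block_eq {m b n : ℕ} (i : Fin m) (hk : m + b = n + 1) (B : Finset (Fin n))
    (hB : B.card = b) : ∃ σ : Equiv.Perm (Fin n), block i hk σ = B := by
  classical
  have e : {x // x ∈ Finset.univ.image (inR i hk)} ≃ {x // x ∈ B} := by
    refine Fintype.equivOfCardEq ?_
    rw [Fintype.card_coe, Fintype.card_coe, Finset.card_image_of_injective _
      (fun x y h => (inR_inj i hk).1 h), hB, Finset.card_univ, Fintype.card_fin]
  refine ⟨e.extendSubtype, Set.ext (fun x => ⟨?_, fun hx => ?_⟩)⟩
  · rintro ⟨j, rfl⟩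
    exact e.extendSubtype_mem _ (Finset.mem_image_of_mem _ (Finset.mem_univ j))
  · obtain ⟨j, -, hj⟩ := Finset.mem_image.1 (e.symm ⟨x, hx⟩).2
    refine ⟨j, ?_⟩
    rw [Function.comp_apply, e.extendSubtype_apply_of_mem _
      (Finset.mem_image_of_mem _ (Finset.mem_univ j))]
    have : (⟨inR i hk j, Finset.mem_image_of_mem _ (Finset.mem_univ j)⟩ :
      {x // x ∈ Finset.univ.image (inR i hk)}) = e.symm ⟨x, hx⟩ := Subtype.ext hj
    rw [this, Equiv.apply_symm_apply]

variable {K : Type u} [CommRing K] {P : GradedOperad.{u, v} K}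

section Split

variable {m b n : ℕ} (i : Fin m) (hk : m + b = n + 1) (σ : Equiv.Perm (Fin n)) (U : Set (Fin n))

/-- The composite `σ (p ∘_i q)` as a function of `p` and `q`. -/
noncomputable def blockCirc : P.Total m →ₗ[K] P.Total b →ₗ[K] P.Total n :=
  (P.totCirc i hk).compr₂ (P.totAct σ)

/-- The component of a pair of operations on the inputs of `p` and `q` in `σ (p ∘_i q)`. -/
noncomputable def splitPair : CutPairs P n →ₗ[K]
    (P.Total m ⧸ P.decomp m (Meets m (contract i hk σ U))) ⊗[K] P.Total b :=
  TensorProduct.map (Submodule.mkQ _ ∘ₗ retract (outerWord i hk σ) (outerWord_injective i hk σ))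
    (retract (innerWord i hk σ) (innerWord_injective i hk σ))

theorem splitPair_tmul (x y : LabelledOps P (Option (Fin n))) :
    splitPair i hk σ U (x ⊗ₜ y) =
      Submodule.Quotient.mk (retract (outerWord i hk σ) (outerWord_injective i hk σ) x) ⊗ₜ
        retract (innerWord i hk σ) (innerWord_injective i hk σ) y := rfl

/-- A cut inside the inner operation leaves an outer part which is itself a composite, and the block
of that composite contains the cut edge. This edge lies in `contract`, so the pair vanishes in the
quotient. -/
theorem splitPair_cutLeft {m' l a : ℕ} (i' : Fin m') (hk' : m' + l = n + 1)
    (σ' : Equiv.Perm (Fin n)) (p : P.X m' a) (hm : 2 ≤ m') {β : CutPairs P l}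
    (hβ : β ∈ CutPairs.high P l) :
    splitPair i hk σ U (cutAct σ' (cutLeft i' hk' p β)) = 0 := by
  refine CutPairs.high_induction
    (C := fun β => splitPair i hk σ U (cutAct σ' (cutLeft i' hk' p β)) = 0) ?_ ?_ ?_ ?_ hβ
  · simp only [map_zero]
  · intro x y hx hy
    simp only [map_add, hx, hy, add_zero]
  · intro c x hx
    simp only [map_smul, hx, smul_zero]
  intro x y e f v w q r hx hy ⟨j, hj⟩
  have hi : m' + x = (m' + x - 1) + 1 := add_eq_pred_add_one i' x
  rw [cutLeft, TensorProduct.map_tmul, graftOnto_lab, graft_eq i' hi rfl, relabel_lab, cutAct,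
    TensorProduct.map_tmul, relabel_lab, relabel_lab, splitPair_tmul]
  rw [(Submodule.Quotient.mk_eq_zero _).2, TensorProduct.zero_tmul]
  refine retract_lab_circ_mem _ i' hi rfl _ p q (fun τ hτ e => ⟨hx, by omega, ?_⟩)
  refine ⟨τ (inR i' hi j), ⟨j, rfl⟩, ?_⟩
  have h₁ := congrFun e (inR i' hi j)
  rw [Function.comp_apply, graftWord_inR, Function.comp_apply, hj, Option.map_none,
    Option.map_none, Function.comp_apply, ← outerWord_self i hk σ] at h₁
  rw [← outerWord_injective i hk σ h₁]
  exact mem_contract_self i hk σ U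

/-- For a cut inside the outer operation, `q` goes to one of the two parts. If its block meets `U`,
the outer part is killed by the quotient, and the inner part carries a label outside the chosen
block. If its block meets the chosen one, the outer part carries a forbidden label, and the inner
part has arity at least `l + 1 > b`. -/
theorem splitPair_cutRight {m' l c : ℕ} (i' : Fin m') (hk' : m' + l = n + 1)
    (σ' : Equiv.Perm (Fin n)) (q : P.X l c) (hl : 2 ≤ l) (hU : Disjoint (block i hk σ) U)
    (h : (block i' hk' σ' ∩ U).Nonempty ∨ ((block i' hk' σ' ∩ block i hk σ).Nonempty ∧ b ≤ l))
    {α : CutPairs P m'} (hα : α ∈ CutPairs.high P m') :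
    splitPair i hk σ U (cutAct σ' (cutRight i' hk' q α)) = 0 := by
  classical
  refine CutPairs.high_induction
    (C := fun α => splitPair i hk σ U (cutAct σ' (cutRight i' hk' q α)) = 0) ?_ ?_ ?_ ?_ hα
  · simp only [map_zero]
  · intro x y hx hy
    simp only [map_add, hx, hy, add_zero]
  · intro c x hx
    simp only [map_smul, hx, smul_zero]
  intro x y e f v w p r hx hy ⟨j, hj⟩
  rw [cutRight, LinearMap.add_apply, TensorProduct.map_tmul, TensorProduct.map_tmul, map_add,
    map_add]
  have h₁ : ∀ z : Fin x, Submodule.Quotient.mk (p := P.decomp m (Meets m (contract i hk σ U)))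
      (retract (outerWord i hk σ) (outerWord_injective i hk σ) (relabel (Option.map σ')
      (graft z (outerLabel i' hk' ∘ v) (some ∘ inR i' hk') p q))) = 0 := fun z => by
    have hi : x + l = (x + l - 1) + 1 := add_eq_pred_add_one z l
    rw [graft_eq z hi rfl, relabel_lab]
    obtain ⟨t, ⟨j, rfl⟩, ht⟩ | ⟨⟨t, ⟨j, rfl⟩, ht⟩, hb⟩ := h
    · rw [Submodule.Quotient.mk_eq_zero]
      refine retract_lab_circ_mem _ z hi rfl _ p q (fun τ hτ e => ⟨hl, by omega, ?_⟩)
      refine ⟨τ (inR z hi j), ⟨j, rfl⟩, mem_contract_of_outerWord i hk σ ht ?_⟩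
      have h₁ := congrFun e (inR z hi j)
      rw [Function.comp_apply, graftWord_inR] at h₁
      exact h₁.symm
    · rw [retract_lab_of_notMem _ _ _ (inR z hi j), Submodule.Quotient.mk_zero]
      rw [Function.comp_apply, graftWord_inR]
      exact some_notMem_range_outerWord i hk σ ht
  have h₂ : ∀ z : Fin y, retract (innerWord i hk σ) (innerWord_injective i hk σ)
      (relabel (Option.map σ')
      (graft z (outerLabel i' hk' ∘ w) (some ∘ inR i' hk') r q)) = 0 := fun z => by
    have hi : y + l = (y + l - 1) + 1 := add_eq_pred_add_one z l
    rw [graft_eq z hi rfl, relabel_lab]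
    obtain ⟨t, ⟨j, rfl⟩, ht⟩ | ⟨_, hb⟩ := h
    · rw [retract_lab_of_notMem _ _ _ (inR z hi j)]
      rw [Function.comp_apply, graftWord_inR]
      exact fun h' => Set.disjoint_left.1 hU
        ((mem_block_of_range_innerWord i hk σ (x := (σ' ∘ inR i' hk') j)).1 h') ht
    · exact retract_lab_of_ne _ _ _ (by omega)
  rw [cutAct, TensorProduct.map_tmul, TensorProduct.map_tmul, splitPair_tmul, splitPair_tmul,
    plug_lab, plug_lab]
  rw [map_sum, map_sum, ← Submodule.mkQ_apply, map_sum, Finset.sum_eq_zero, TensorProduct.zero_tmul,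
    map_sum, map_sum, Finset.sum_eq_zero, TensorProduct.tmul_zero, add_zero]
  · intro z _
    split_ifs
    · exact h₂ z
    · simp only [map_zero]
  · intro z _
    split_ifs
    · exact h₁ z
    · simp only [map_zero]

theorem splitPair_cutMid_of_ne {m' l a c : ℕ} (i' : Fin m') (hk' : m' + l = n + 1)
    (σ' : Equiv.Perm (Fin n)) (p : P.X m' a) (q : P.X l c)
    (h : block i' hk' σ' ≠ block i hk σ) :
    splitPair i hk σ U (cutAct σ' (cutMid i' hk' p q)) = 0 := by
  rw [cutMid, cutAct, TensorProduct.map_tmul, relabel_lab, relabel_lab, splitPair_tmul]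
  have h' : retract (innerWord i hk σ) (innerWord_injective i hk σ)
      (lab (Option.map σ' ∘ some ∘ inR i' hk') q) = 0 := by
    by_cases h₁ : block i' hk' σ' ⊆ block i hk σ
    · obtain ⟨x, ⟨j, rfl⟩, hx⟩ := Set.not_subset.1 (fun h₂ => h (h₁.antisymm h₂))
      refine retract_lab_of_notMem' _ _ _ j ?_
      rintro ⟨j', hj'⟩
      exact hx ⟨j', Option.some_injective _ hj'⟩
    · obtain ⟨x, ⟨j, rfl⟩, hx⟩ := Set.not_subset.1 h₁
      exact retract_lab_of_notMem _ _ _ j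
        (fun h₂ => hx ((mem_block_of_range_innerWord i hk σ (x := (σ' ∘ inR i' hk') j)).1 h₂))
  rw [h', TensorProduct.tmul_zero]

theorem splitPair_cutMid {a c : ℕ} (p : P.X m a) (q : P.X b c) :
    splitPair i hk σ U (cutAct σ (cutMid i hk p q)) =
      Submodule.Quotient.mk (P.tot a p) ⊗ₜ P.tot c q := by
  rw [cutMid, cutAct, TensorProduct.map_tmul, relabel_lab, relabel_lab, splitPair_tmul]
  congr 1
  · congr 1
    exact retract_lab_self (outerWord_injective i hk σ) p
  · exact retract_lab_self (innerWord_injective i hk σ) q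

/-- The composites `σ (p ∘_i q)` such that `p` is a composite one of whose inner inputs is `i` or
belongs to `U`. -/
theorem blockCirc_mem {u : Fin n} (hb : 2 ≤ b) (hu : u ∈ block i hk σ) {p : P.Total m}
    (hp : p ∈ P.decomp m (Meets m (contract i hk σ U))) (q : P.Total b) :
    blockCirc i hk σ p q ∈ P.decomp n (MeetsAbove n U u (b + 1)) := by
  induction hp using Submodule.span_induction with
  | zero => simp
  | add x y _ _ hx hy =>
    rw [map_add, LinearMap.add_apply]
    exact Submodule.add_mem _ hx hy
  | smul c x _ hx =>
    rw [map_smul, LinearMap.smul_apply]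
    exact Submodule.smul_mem _ c hx
  | mem p hp =>
    obtain ⟨x, l, a, c, d, j, hx, hc, κ, p, r, ⟨hl, hlm, t, ⟨y, rfl⟩, ht⟩, rfl⟩ := hp
    induction q using P.tot_induction with
    | zero => simp
    | add x y hx hy =>
      rw [map_add]
      exact Submodule.add_mem _ hx hy
    | tot e q =>
      -- Grafting `q` at the input `i` of `κ (p ∘_j r)` amounts to grafting it at `κ⁻¹ i` of `p ∘_j
      -- r`, up to a permutation of the result.
      have hi : κ (κ⁻¹ i) = i := κ.apply_symm_apply i
      rw [blockCirc, LinearMap.compr₂_apply, P.totCirc_tot i hk rfl, P.totAct_tot]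
      have h₁ := P.circ_equivariant (κ⁻¹ i) hk (rfl : d + e = d + e) κ 1 (P.circ j hx hc p r) q
      simp only [hi, map_one, Module.End.one_apply] at h₁
      rw [h₁, ← Module.End.mul_apply, ← map_mul]
      -- If `q` is grafted to `p`, it commutes with `r`, whose block avoids `i` and therefore meets
      -- `U` itself. If `q` is grafted to `r`, then `r ∘ q` has a block containing `u` and arity `l
      -- + b - 1 ≥ b + 1`, as `l ≥ 2`.
      obtain ⟨z, hz, e₁⟩ | ⟨z, e₁⟩ := ins_cases j hx (κ⁻¹ i)
      · have h₂ : x + b = (x + b - 1) + 1 := add_eq_pred_add_one z b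
        have h₃ : (x + b - 1) + l = n + 1 := by omega
        have h₄ := P.circ_comm' hz.symm hx hk h₂ h₃ hc (rfl : d + e = d + e)
          (rfl : a + e = a + e) (by omega) p r q
        have h₅ := inL_inR_comm hz.symm hx hk h₂ h₃ y (inL_ne_inR _ _ _ _ _).symm
        have h₆ : κ⁻¹ i = inL j hx z hz := e₁
        have h₈ : inR j hx y ≠ κ⁻¹ i := by
          rw [h₆]
          exact (inL_ne_inR _ _ _ _ _).symm
        have h₉ := permCirc_inL κ (κ⁻¹ i) 1 hk (inR j hx y) h₈
        simp only [h₆] at h₉ ⊢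
        rw [h₄, map_smul, map_smul]
        refine Submodule.smul_mem _ _ (GradedOperad.tot_mem_decomp _ h₃ _ _ _ _
          ⟨hl, by omega, Or.inl ⟨_, ⟨y, rfl⟩, ?_⟩⟩)
        rw [Function.comp_apply, Equiv.Perm.mul_apply, ← h₅, h₉]
        simp only [← h₆, hi]
        exact ht _
      · obtain ⟨s, rfl⟩ := hu
        have h₂ : l + b = (l + b - 1) + 1 := add_eq_pred_add_one z b
        have h₃ : x + (l + b - 1) = n + 1 := by omega
        have h₄ := P.circ_assoc' j z hx hk h₂ h₃ hc (rfl : d + e = d + e) rfl (by omega) p r q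
        have h₅ := inR_assoc j z hx hk h₂ h₃ s
        have h₉ := permCirc_inR κ (κ⁻¹ i) 1 hk s
        simp only [e₁] at h₉ ⊢
        rw [h₄]
        refine GradedOperad.tot_mem_decomp _ h₃ _ _ _ _ ⟨by omega, by omega, Or.inr ⟨?_, by omega⟩⟩
        refine ⟨inR z h₂ s, ?_⟩
        rw [Function.comp_apply, Equiv.Perm.mul_apply, ← h₅, h₉]
        simp only [← e₁, hi]
        rfl

end Split

end Blocks

/-! ### The exact sequences of the block filtration. -/

section BlockFiltration

open TensorProduct

variable {K : Type u} [CommRing K]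

section Quotients

variable {P : GradedOperad.{u, v} K} (D : P.Differential) (n : ℕ) (Φ : ℕ → Set (Fin n) → Prop)

/-- The differential on the quotient by a submodule of decomposables. -/
noncomputable def GradedOperad.Differential.quot :
    (P.Total n ⧸ P.decomp n Φ) →ₗ[K] P.Total n ⧸ P.decomp n Φ :=
  (P.decomp n Φ).mapQ _ (D.total n) (GradedOperad.decomp_le_comap_total D n Φ)

/-- The grading on the quotient by a submodule of decomposables. -/
noncomputable def GradedOperad.Differential.quotGrading : DiffGrading (D.quot n Φ) :=
  (D.grading n).quotient _ (GradedOperad.decomp_le_comap_total D n Φ)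
    (GradedOperad.decomp_le_comap_pr D n Φ)

theorem GradedOperad.Differential.quot_mkQ {n : ℕ} {Φ : ℕ → Set (Fin n) → Prop} (x : P.Total n) :
    D.quot n Φ ((P.decomp n Φ).mkQ x) = (P.decomp n Φ).mkQ (D.total n x) :=
  Submodule.mapQ_apply _ _ _ _

theorem GradedOperad.Differential.quot_quot (x : P.Total n ⧸ P.decomp n Φ) :
    D.quot n Φ (D.quot n Φ x) = 0 := by
  obtain ⟨x, rfl⟩ := Submodule.mkQ_surjective _ x
  rw [D.quot_mkQ, D.quot_mkQ, D.total_total, map_zero]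

theorem GradedOperad.Differential.factor_quot {n : ℕ} {Φ Ψ : ℕ → Set (Fin n) → Prop}
    (h : P.decomp n Φ ≤ P.decomp n Ψ) (x : P.Total n ⧸ P.decomp n Φ) :
    Submodule.factor h (D.quot n Φ x) = D.quot n Ψ (Submodule.factor h x) := by
  obtain ⟨x, rfl⟩ := Submodule.mkQ_surjective _ x
  rw [D.quot_mkQ, Submodule.factor_mk, Submodule.factor_mk, D.quot_mkQ]

variable {Q : GradedOperad.{u, w} K}

/-- A morphism of operads on the quotients by submodules of decomposables. -/
noncomputable def GradedOperad.Hom.quot (φ : GradedOperad.Hom P Q) :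
    (P.Total n ⧸ P.decomp n Φ) →ₗ[K] Q.Total n ⧸ Q.decomp n Φ :=
  (P.decomp n Φ).mapQ _ (φ.total n) (GradedOperad.decomp_le_comap_hom φ n Φ)

theorem GradedOperad.Hom.quot_mkQ (φ : GradedOperad.Hom P Q) {n : ℕ}
    {Φ : ℕ → Set (Fin n) → Prop} (x : P.Total n) :
    φ.quot n Φ ((P.decomp n Φ).mkQ x) = (Q.decomp n Φ).mkQ (φ.total n x) :=
  Submodule.mapQ_apply _ _ _ _

theorem GradedOperad.Hom.quot_pr (φ : GradedOperad.Hom P Q) (D' : Q.Differential) (a : ℕ)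
    (x : P.Total n ⧸ P.decomp n Φ) :
    φ.quot n Φ ((D.quotGrading n Φ).pr a x) = (D'.quotGrading n Φ).pr a (φ.quot n Φ x) := by
  obtain ⟨x, rfl⟩ := Submodule.mkQ_surjective _ x
  exact congrArg (Q.decomp n Φ).mkQ (lmap_totalGrading_pr (φ.app n) a x)

theorem GradedOperad.Hom.quot_factor (φ : GradedOperad.Hom P Q) {n : ℕ}
    {Φ Ψ : ℕ → Set (Fin n) → Prop} (h : P.decomp n Φ ≤ P.decomp n Ψ)
    {h' : Q.decomp n Φ ≤ Q.decomp n Ψ} (x : P.Total n ⧸ P.decomp n Φ) :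
    φ.quot n Ψ (Submodule.factor h x) = Submodule.factor h' (φ.quot n Φ x) := by
  obtain ⟨x, rfl⟩ := Submodule.mkQ_surjective _ x
  rw [φ.quot_mkQ, Submodule.factor_mk, Submodule.factor_mk, φ.quot_mkQ]

variable {D} {D' : Q.Differential} {φ : GradedOperad.Hom P Q}
  (hφ : ∀ n a x, φ.app n a (D.d n a x) = D'.d n a (φ.app n (a + 1) x))

include hφ in
theorem GradedOperad.Hom.quot_d (x : P.Total n ⧸ P.decomp n Φ) :
    φ.quot n Φ (D.quot n Φ x) = D'.quot n Φ (φ.quot n Φ x) := by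
  obtain ⟨x, rfl⟩ := Submodule.mkQ_surjective _ x
  exact congrArg (Q.decomp n Φ).mkQ (lmap_totalD (hφ n) x)

end Quotients

/-- The possible sets of inputs of the second factor of a composite: the sets of `b` elements
containing `u` and disjoint from `U`. -/
abbrev Blocks (n b : ℕ) (U : Set (Fin n)) (u : Fin n) : Type :=
  {B : Finset (Fin n) // B.card = b ∧ u ∈ B ∧ Disjoint (B : Set (Fin n)) U}

noncomputable instance (n b : ℕ) (U : Set (Fin n)) (u : Fin n) : Fintype (Blocks n b U u) :=
  Fintype.ofFinite _

variable {P : GradedOperad.{u, v} K} {m b n : ℕ} (i : Fin m) (hk : m + b = n + 1) {U : Set (Fin n)} {u : Fin n}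

/-- A permutation whose block is a given set. -/
noncomputable def blockPerm (B : Blocks n b U u) : Equiv.Perm (Fin n) :=
  (exists_block_eq i hk B.1 B.2.1).choose

theorem block_blockPerm (B : Blocks n b U u) : block i hk (blockPerm i hk B) = B.1 :=
  (exists_block_eq i hk B.1 B.2.1).choose_spec

theorem mem_block_blockPerm (B : Blocks n b U u) : u ∈ block i hk (blockPerm i hk B) := by
  rw [block_blockPerm]
  exact B.2.2.1

theorem disjoint_block_blockPerm (B : Blocks n b U u) :
    Disjoint (block i hk (blockPerm i hk B)) U := by
  rw [block_blockPerm]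
  exact B.2.2.2

/-- The inputs of the first factor of a composite with a given block, which correspond to the block
or to elements of `U`. -/
abbrev blockContract (B : Blocks n b U u) : Set (Fin m) := contract i hk (blockPerm i hk B) U

section Factors

variable (P) in
/-- The composites with a given block, modulo the composites with a larger block. -/
def BlockFactor (B : Blocks n b U u) : Type v :=
  (P.Total m ⧸ P.decomp m (Meets m (blockContract i hk B))) ⊗[K] P.Total b

namespace BlockFactor

noncomputable instance (B : Blocks n b U u) : AddCommGroup (BlockFactor P i hk B) :=
  inferInstanceAs (AddCommGroup (_ ⊗[K] _))

noncomputable instance (B : Blocks n b U u) : Module K (BlockFactor P i hk B) :=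
  inferInstanceAs (Module K (_ ⊗[K] _))

variable {i hk}

/-- The element of `BlockFactor` given by a pair of operations. -/
def tmul (B : Blocks n b U u) (p : P.Total m) (q : P.Total b) : BlockFactor P i hk B :=
  (Submodule.Quotient.mk p :
    P.Total m ⧸ P.decomp m (Meets m (blockContract i hk B))) ⊗ₜ[K] q

theorem induction_on {B : Blocks n b U u} {C : BlockFactor P i hk B → Prop}
    (x : BlockFactor P i hk B) (zero : C 0) (add : ∀ x y, C x → C y → C (x + y))
    (tmul : ∀ p q, C (tmul B p q)) : C x :=
  TensorProduct.induction_on x zero (fun p q => by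
    obtain ⟨p, rfl⟩ := Submodule.mkQ_surjective _ p
    exact tmul p q) add

end BlockFactor

/-- The composites with a given block. -/
noncomputable def blockMap (hb : 2 ≤ b) (B : Blocks n b U u) :
    BlockFactor P i hk B →ₗ[K] P.Total n ⧸ P.decomp n (MeetsAbove n U u (b + 1)) :=
  TensorProduct.lift (Submodule.liftQ _
    ((blockCirc i hk (blockPerm i hk B)).compr₂ (Submodule.mkQ _)) (fun _ hp =>
      LinearMap.ext (fun q => (Submodule.Quotient.mk_eq_zero _).2
        (blockCirc_mem i hk _ U hb (mem_block_blockPerm i hk B) hp q))))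

theorem blockMap_tmul (hb : 2 ≤ b) (B : Blocks n b U u) (p : P.Total m) (q : P.Total b) :
    blockMap i hk hb B (.tmul B p q) =
      Submodule.Quotient.mk (blockCirc i hk (blockPerm i hk B) p q) := rfl

/-- The sum of the composites with given blocks. -/
noncomputable def blocksMap (hb : 2 ≤ b) :
    (∀ B : Blocks n b U u, BlockFactor P i hk B) →ₗ[K]
      P.Total n ⧸ P.decomp n (MeetsAbove n U u (b + 1)) :=
  ∑ B, blockMap i hk hb B ∘ₗ LinearMap.proj B

theorem blocksMap_apply (hb : 2 ≤ b) (x : ∀ B : Blocks n b U u, BlockFactor P i hk B) :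
    blocksMap i hk hb x = ∑ B, blockMap i hk hb B (x B) := by
  rw [blocksMap, LinearMap.sum_apply]
  rfl

open scoped Classical in
theorem blocksMap_single (hb : 2 ≤ b) (B : Blocks n b U u) (x : BlockFactor P i hk B) :
    blocksMap i hk hb (Pi.single B x) = blockMap i hk hb B x := by
  rw [blocksMap_apply, Finset.sum_eq_single B, Pi.single_eq_same]
  · intro B' _ h
    rw [Pi.single_eq_of_ne h, map_zero]
  · exact fun h => absurd (Finset.mem_univ _) h

theorem decomp_meetsAbove_succ_le (n : ℕ) (U : Set (Fin n)) (u : Fin n) (b : ℕ) :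
    P.decomp n (MeetsAbove n U u (b + 1)) ≤ P.decomp n (MeetsAbove n U u b) :=
  GradedOperad.decomp_mono (fun _ _ h => h.of_succ)

/-- A composite allowed by the bound `b` but not by `b + 1` has a block disjoint from `U`,
containing `u` and of size exactly `b`; such composites are the image of `blocksMap`. -/
theorem exact_blocksMap (hb : 2 ≤ b) (hm : 2 ≤ m) :
    Function.Exact (blocksMap i hk hb : (∀ B : Blocks n b U u, BlockFactor P i hk B) →ₗ[K] _)
      (Submodule.factor (decomp_meetsAbove_succ_le n U u b)) := by
  classical
  intro x
  obtain ⟨x, rfl⟩ := Submodule.mkQ_surjective _ x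
  rw [Submodule.factor_mk, Submodule.mkQ_apply, Submodule.Quotient.mk_eq_zero]
  refine ⟨fun hx => ?_, ?_⟩
  · induction hx using Submodule.span_induction with
    | zero => exact ⟨0, by simp⟩
    | add x y _ _ hx hy =>
      obtain ⟨x', hx⟩ := hx
      obtain ⟨y', hy⟩ := hy
      exact ⟨x' + y', by rw [map_add, map_add, hx, hy]⟩
    | smul c x _ hx =>
      obtain ⟨x', hx⟩ := hx
      exact ⟨c • x', by rw [map_smul, map_smul, hx]⟩
    | mem x hx =>
      obtain ⟨m', l, a, c, d, i', hk', hc, σ, p, q, ⟨hl, hln, h⟩, rfl⟩ := hx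
      by_cases h' : MeetsAbove n U u (b + 1) l (Set.range (σ ∘ inR i' hk'))
      · refine ⟨0, ?_⟩
        rw [map_zero, Submodule.mkQ_apply, eq_comm, Submodule.Quotient.mk_eq_zero]
        exact GradedOperad.tot_mem_decomp i' hk' hc σ p q h'
      · have hU : ¬(block i' hk' σ ∩ U).Nonempty := fun h₁ => h' ⟨hl, hln, Or.inl h₁⟩
        obtain ⟨hu, hbl⟩ := h.resolve_left hU
        obtain rfl : l = b := by
          by_contra hne
          exact h' ⟨hl, hln, Or.inr ⟨hu, by omega⟩⟩
        obtain rfl : m' = m := by omega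
        let B : Blocks n l U u := ⟨(block i' hk' σ).toFinite.toFinset, by
          rw [← Set.ncard_eq_toFinset_card, ncard_block], (Set.Finite.mem_toFinset _).2 hu, by
          simpa [Set.disjoint_iff_inter_eq_empty, Set.not_nonempty_iff_eq_empty] using hU⟩
        -- `σ` and the chosen permutation have the same block, so they differ by permutations that
        -- can be moved onto `p` and `q`.
        obtain ⟨τ, ρ, rfl, hσ⟩ := exists_permCirc_eq i i' hk (blockPerm i hk B) σ (by
          rw [block_blockPerm]
          simp [B])
        refine ⟨Pi.single B (.tmul B (P.tot a (P.ρ m' a τ p)) (P.tot c (P.ρ l c ρ q))), ?_⟩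
        rw [blocksMap_single, blockMap_tmul, Submodule.mkQ_apply, blockCirc,
          LinearMap.compr₂_apply, P.totCirc_tot _ hk hc, P.totAct_tot, P.circ_equivariant,
          ← Module.End.mul_apply, ← map_mul, ← hσ]
  · rintro ⟨y, hy⟩
    rw [← Submodule.Quotient.mk_eq_zero, ← Submodule.mkQ_apply,
      ← Submodule.factor_mk (decomp_meetsAbove_succ_le n U u b), ← hy, blocksMap_apply, map_sum]
    refine Finset.sum_eq_zero (fun B _ => ?_)
    induction y B using BlockFactor.induction_on with
    | zero => simp
    | add x y hx hy => rw [map_add, map_add, hx, hy, add_zero]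
    | tmul p q =>
      rw [blockMap_tmul, ← Submodule.mkQ_apply, Submodule.factor_mk,
        Submodule.mkQ_apply, Submodule.Quotient.mk_eq_zero]
      exact GradedOperad.totAct_totCirc_mem_decomp i hk _ p q
        ⟨hb, by omega, Or.inr ⟨mem_block_blockPerm i hk B, le_rfl⟩⟩

/-- The differential on the composites with a given block. -/
noncomputable def blockD (D : P.Differential) (B : Blocks n b U u) :
    BlockFactor P i hk B →ₗ[K] BlockFactor P i hk B :=
  (D.quotGrading m (Meets m (blockContract i hk B))).tensorD (D.total b)

theorem blockD_tmul (D : P.Differential) (B : Blocks n b U u) (p : P.Total m) (q : P.Total b) :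
    blockD i hk D B (.tmul B p q) =
      .tmul B (D.total m p) q + .tmul B ((D.grading m).sgn p) (D.total b q) := rfl

theorem blocksMap_d (hb : 2 ≤ b) (D : P.Differential)
    (x : ∀ B : Blocks n b U u, BlockFactor P i hk B) :
    blocksMap i hk hb (LinearMap.piMap (blockD i hk D) x) = D.quot n _ (blocksMap i hk hb x) := by
  rw [blocksMap_apply, blocksMap_apply, map_sum]
  refine Finset.sum_congr rfl (fun B _ => ?_)
  change blockMap i hk hb B (blockD i hk D B (x B)) = D.quot n _ (blockMap i hk hb B (x B))
  induction x B using BlockFactor.induction_on with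
  | zero => simp
  | add x y hx hy => simp only [map_add, hx, hy]
  | tmul p q =>
    rw [blockD_tmul, map_add]
    change Submodule.Quotient.mk (blockCirc i hk (blockPerm i hk B) (D.total m p) q) +
      Submodule.Quotient.mk (blockCirc i hk (blockPerm i hk B) ((D.grading m).sgn p)
        (D.total b q)) =
      Submodule.Quotient.mk (D.total n (blockCirc i hk (blockPerm i hk B) p q))
    rw [blockCirc, LinearMap.compr₂_apply, LinearMap.compr₂_apply, LinearMap.compr₂_apply,
      D.total_act, D.total_circ, map_add, Submodule.Quotient.mk_add]

variable {Q : GradedOperad.{u, w} K}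

/-- A morphism of operads on the composites with a given block. -/
noncomputable def GradedOperad.Hom.block (φ : GradedOperad.Hom P Q) (B : Blocks n b U u) :
    BlockFactor P i hk B →ₗ[K] BlockFactor Q i hk B :=
  TensorProduct.map (φ.quot m _) (φ.total b)

theorem GradedOperad.Hom.block_tmul (φ : GradedOperad.Hom P Q) (B : Blocks n b U u)
    (p : P.Total m) (q : P.Total b) :
    φ.block i hk B (.tmul B p q) = .tmul B (φ.total m p) (φ.total b q) := rfl

theorem blocksMap_hom (hb : 2 ≤ b) (φ : GradedOperad.Hom P Q)
    (x : ∀ B : Blocks n b U u, BlockFactor P i hk B) :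
    φ.quot n _ (blocksMap i hk hb x) = blocksMap i hk hb (LinearMap.piMap (φ.block i hk) x) := by
  rw [blocksMap_apply, blocksMap_apply, map_sum]
  refine Finset.sum_congr rfl (fun B _ => ?_)
  change φ.quot n _ (blockMap i hk hb B (x B)) = blockMap i hk hb B (φ.block i hk B (x B))
  induction x B using BlockFactor.induction_on with
  | zero => simp
  | add x y hx hy => simp only [map_add, hx, hy]
  | tmul p q =>
    change Submodule.Quotient.mk (φ.total n (blockCirc i hk (blockPerm i hk B) p q)) =
      Submodule.Quotient.mk (blockCirc i hk (blockPerm i hk B) (φ.total m p) (φ.total b q))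
    rw [blockCirc, blockCirc, LinearMap.compr₂_apply, LinearMap.compr₂_apply, φ.total_act,
      φ.total_circ]

end Factors

section Free

variable {M : GradedSigmaModule.{u, v} K}

/-- The map `cut` on the sum of the components. -/
noncomputable def totCut (n : ℕ) : (freeOperad M).Total n →ₗ[K] CutPairs (freeOperad M) n :=
  DirectSum.toModule K ℕ _ (fun _ => cut)

theorem totCut_tot {n d : ℕ} (p : (freeOperad M).X n d) :
    totCut n ((freeOperad M).tot d p) = cut p := DirectSum.toModule_lof _ _ _

variable (hM : M.IsReduced)
include hM

/-- Among all cuts of a composite, only the one at the edge that joins its two factors survives in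
the component of the block. -/
theorem splitPair_cut {m' l a c d : ℕ} (σ : Equiv.Perm (Fin n)) (i' : Fin m')
    (hk' : m' + l = n + 1) (hc : a + c = d) (σ' : Equiv.Perm (Fin n))
    (p : (freeOperad M).X m' a) (q : (freeOperad M).X l c) (hl : 2 ≤ l) (hm : 2 ≤ m')
    (hU : Disjoint (block i hk σ) U)
    (h : (block i' hk' σ' ∩ U).Nonempty ∨ ((block i' hk' σ' ∩ block i hk σ).Nonempty ∧ b ≤ l)) :
    splitPair i hk σ U (cut ((freeOperad M).ρ n d σ' ((freeOperad M).circ i' hk' hc p q))) =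
      splitPair i hk σ U (cutAct σ' (cutMid i' hk' p q)) := by
  rw [cut_act, cut_circ, map_add, map_add, map_add, map_add,
    splitPair_cutRight i hk σ U i' hk' σ' q hl hU h (cut_mem_high hM hm p),
    splitPair_cutLeft i hk σ U i' hk' σ' p hm (cut_mem_high hM hl q), zero_add, zero_add]

/-- By `splitPair_cut` it remains to see that the block of the composite is not the chosen one: it
meets `U`, or it has more than `b` elements. -/
theorem decomp_le_ker_splitPair (σ : Equiv.Perm (Fin n)) (hu : u ∈ block i hk σ)
    (hU : Disjoint (block i hk σ) U) :
    (freeOperad M).decomp n (MeetsAbove n U u (b + 1)) ≤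
      LinearMap.ker (splitPair i hk σ U ∘ₗ totCut n) := by
  refine Submodule.span_le.2 ?_
  rintro x ⟨m', l, a, c, d, i', hk', hc, σ', p, q, ⟨hl, hln, h⟩, rfl⟩
  rw [SetLike.mem_coe, LinearMap.mem_ker, LinearMap.comp_apply, totCut_tot,
    splitPair_cut i hk hM σ i' hk' hc σ' p q hl (by omega) hU
      (h.imp_right (fun h' => ⟨⟨u, h'.1, hu⟩, by omega⟩)), splitPair_cutMid_of_ne]
  rintro h'
  obtain h | ⟨_, hbl⟩ := h
  · exact Set.disjoint_iff_inter_eq_empty.1 hU ▸ (h' ▸ h : (block i hk σ ∩ U).Nonempty) |>.ne_empty rfl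
  · have := ncard_block i' hk' σ'
    rw [h', ncard_block] at this
    omega

theorem splitPair_blockCirc (hb : 2 ≤ b) (hm : 2 ≤ m) (σ : Equiv.Perm (Fin n))
    (hU : Disjoint (block i hk σ) U) (p : (freeOperad M).Total m) (q : (freeOperad M).Total b) :
    splitPair i hk σ U (totCut n (blockCirc i hk σ p q)) = Submodule.Quotient.mk p ⊗ₜ q := by
  have h : (block i hk σ ∩ block i hk σ).Nonempty :=
    ⟨_, ⟨⟨0, by omega⟩, rfl⟩, ⟨⟨0, by omega⟩, rfl⟩⟩
  induction p using (freeOperad M).tot_induction with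
  | zero => simp
  | add x y hx hy =>
    rw [map_add, LinearMap.add_apply, map_add, map_add, hx, hy, Submodule.Quotient.mk_add,
      TensorProduct.add_tmul]
  | tot a p =>
    induction q using (freeOperad M).tot_induction with
    | zero => simp
    | add x y hx hy => rw [map_add, map_add, map_add, hx, hy, TensorProduct.tmul_add]
    | tot c q =>
      rw [blockCirc, LinearMap.compr₂_apply, (freeOperad M).totCirc_tot i hk rfl,
        (freeOperad M).totAct_tot, totCut_tot,
        splitPair_cut i hk hM σ i hk rfl σ p q hb hm hU (Or.inr ⟨h, le_rfl⟩), splitPair_cutMid]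

theorem splitPair_blockCirc_of_ne (hb : 2 ≤ b) (hm : 2 ≤ m) (σ σ' : Equiv.Perm (Fin n))
    (hU : Disjoint (block i hk σ) U) (hu : u ∈ block i hk σ) (hu' : u ∈ block i hk σ')
    (hσ : block i hk σ' ≠ block i hk σ) (p : (freeOperad M).Total m)
    (q : (freeOperad M).Total b) :
    splitPair i hk σ U (totCut n (blockCirc i hk σ' p q)) = 0 := by
  induction p using (freeOperad M).tot_induction with
  | zero => simp
  | add x y hx hy => rw [map_add, LinearMap.add_apply, map_add, map_add, hx, hy, add_zero]
  | tot a p =>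
    induction q using (freeOperad M).tot_induction with
    | zero => simp
    | add x y hx hy => rw [map_add, map_add, map_add, hx, hy, add_zero]
    | tot c q =>
      rw [blockCirc, LinearMap.compr₂_apply, (freeOperad M).totCirc_tot i hk rfl,
        (freeOperad M).totAct_tot, totCut_tot,
        splitPair_cut i hk hM σ i hk rfl σ' p q hb hm hU (Or.inr ⟨⟨u, hu', hu⟩, le_rfl⟩),
        splitPair_cutMid_of_ne i hk σ U i hk σ' p q hσ]

/-- The components of `cut` at the blocks form a left inverse: the cut at the joining edge returns
`p ⊗ q` at the block of the composite and zero at the other blocks. -/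
theorem blocksMap_injective (hb : 2 ≤ b) (hm : 2 ≤ m) :
    Function.Injective (blocksMap (P := freeOperad M) i hk hb :
      (∀ B : Blocks n b U u, BlockFactor _ i hk B) →ₗ[K] _) := by
  let R (B : Blocks n b U u) : _ →ₗ[K] BlockFactor (freeOperad M) i hk B :=
    Submodule.liftQ _ _ (decomp_le_ker_splitPair i hk hM
      (blockPerm i hk B) (mem_block_blockPerm i hk B) (disjoint_block_blockPerm i hk B))
  have hR (B : Blocks n b U u) (p q) : R B (blockMap i hk hb B (.tmul B p q)) = .tmul B p q :=
    splitPair_blockCirc i hk hM hb hm (blockPerm i hk B) (disjoint_block_blockPerm i hk B) p q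
  have hR' (B B' : Blocks n b U u) (h : B' ≠ B) (p q) :
      R B (blockMap i hk hb B' (.tmul B' p q)) = 0 := by
    refine splitPair_blockCirc_of_ne i hk hM hb hm (blockPerm i hk B) (blockPerm i hk B')
      (disjoint_block_blockPerm i hk B) (mem_block_blockPerm i hk B) (mem_block_blockPerm i hk B')
      ?_ p q
    rw [block_blockPerm, block_blockPerm]
    exact fun e => h (Subtype.ext (Finset.coe_injective e))
  refine Function.LeftInverse.injective (g := fun y B => R B y) (fun x => funext (fun B => ?_))
  change R B (blocksMap i hk hb x) = x B
  rw [blocksMap_apply, map_sum, Finset.sum_eq_single B]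
  · induction x B using BlockFactor.induction_on with
    | zero => simp
    | add x y hx hy => rw [map_add, map_add, hx, hy]
    | tmul p q => exact hR B p q
  · intro B' _ h
    induction x B' using BlockFactor.induction_on with
    | zero => simp
    | add x y hx hy => rw [map_add, map_add, hx, hy, add_zero]
    | tmul p q => exact hR' B B' h p q
  · exact fun h => absurd (Finset.mem_univ _) h

end Free

end BlockFiltration

/-! ### Quasi-isomorphisms of chain complexes in terms of elements. -/

section Homology

variable {K : Type u} [CommRing K]

/-- Injectivity and surjectivity on homology, read on the explicit model of cycles modulo
boundaries. -/
theorem ModuleCat.shortComplex_quasiIso_iff {S T : ShortComplex (ModuleCat.{v} K)} (φ : S ⟶ T) :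
    ShortComplex.QuasiIso φ ↔
      (∀ x : S.X₂, S.g x = 0 → ∀ y : T.X₁, φ.τ₂ x = T.f y → ∃ x', x = S.f x') ∧
      (∀ y : T.X₂, T.g y = 0 → ∃ x : S.X₂, S.g x = 0 ∧ ∃ y', y = φ.τ₂ x + T.f y') := by
  let γ : ShortComplex.LeftHomologyMapData φ S.moduleCatLeftHomologyData
    T.moduleCatLeftHomologyData := default
  let k : LinearMap.ker S.g.hom →ₗ[K] LinearMap.ker T.g.hom := γ.φK.hom
  have hK : ∀ z : LinearMap.ker S.g.hom, (k z).1 = φ.τ₂ z.1 :=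
    fun z => ConcreteCategory.congr_hom γ.commi (show S.moduleCatLeftHomologyData.K from z)
  have hH : ∀ z : LinearMap.ker S.g.hom,
      γ.φH (Submodule.Quotient.mk (p := LinearMap.range S.moduleCatToCycles) z) =
        Submodule.Quotient.mk (p := LinearMap.range T.moduleCatToCycles) (k z) :=
    fun z => ConcreteCategory.congr_hom γ.commπ z
  rw [γ.quasiIso_iff, ConcreteCategory.isIso_iff_bijective]
  refine and_congr ?_ ?_
  · rw [injective_iff_map_eq_zero]
    constructor
    · intro h x hx y hy
      have h₁ := h (Submodule.Quotient.mk (p := LinearMap.range S.moduleCatToCycles) ⟨x, hx⟩) (by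
        rw [hH]
        exact (Submodule.Quotient.mk_eq_zero _).2 ⟨y, Subtype.ext ((hK ⟨x, hx⟩).trans hy).symm⟩)
      obtain ⟨x', hx'⟩ := (Submodule.Quotient.mk_eq_zero _).1 h₁
      exact ⟨x', (congrArg Subtype.val hx').symm⟩
    · intro h z hz
      obtain ⟨⟨x, hx⟩, rfl⟩ := Submodule.Quotient.mk_surjective
        (LinearMap.range S.moduleCatToCycles) z
      rw [hH] at hz
      obtain ⟨y, hy⟩ := (Submodule.Quotient.mk_eq_zero _).1 hz
      obtain ⟨x', hx'⟩ := h x hx y ((hK ⟨x, hx⟩).symm.trans (congrArg Subtype.val hy).symm)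
      exact (Submodule.Quotient.mk_eq_zero _).2 ⟨x', Subtype.ext hx'.symm⟩
  · constructor
    · intro h y hy
      obtain ⟨z, hz⟩ := h (Submodule.Quotient.mk (p := LinearMap.range T.moduleCatToCycles) ⟨y, hy⟩)
      obtain ⟨⟨x, hx⟩, rfl⟩ := Submodule.Quotient.mk_surjective
        (LinearMap.range S.moduleCatToCycles) z
      rw [hH] at hz
      obtain ⟨y', hy'⟩ := (Submodule.Quotient.eq _).1 hz.symm
      refine ⟨x, hx, y', ?_⟩
      have h₁ : T.f y' = y - (k ⟨x, hx⟩).1 :=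
        congrArg Subtype.val hy'
      rw [h₁, hK ⟨x, hx⟩, add_sub_cancel]
    · intro h z
      obtain ⟨⟨y, hy⟩, rfl⟩ := Submodule.Quotient.mk_surjective
        (LinearMap.range T.moduleCatToCycles) z
      obtain ⟨x, hx, y', e⟩ := h y hy
      refine ⟨Submodule.Quotient.mk (p := LinearMap.range S.moduleCatToCycles) ⟨x, hx⟩, ?_⟩
      rw [hH]
      refine ((Submodule.Quotient.eq (LinearMap.range T.moduleCatToCycles)).2
        (LinearMap.mem_range.2 ⟨y', Subtype.ext ?_⟩)).symm
      change T.f y' = y - (k ⟨x, hx⟩).1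
      rw [hK ⟨x, hx⟩, e, add_sub_cancel_left]

variable {X Y : ℕ → Type v} [∀ a, AddCommGroup (X a)] [∀ a, Module K (X a)]
  [∀ a, AddCommGroup (Y a)] [∀ a, Module K (Y a)]

theorem component_totalD (d : ∀ a, X (a + 1) →ₗ[K] X a) (a : ℕ) (x : DirectSum ℕ X) :
    DirectSum.component K ℕ X a (totalD d x) = d a (DirectSum.component K ℕ X (a + 1) x) := by
  induction x using DirectSum.induction_on with
  | zero => simp
  | add x y hx hy => simp only [map_add, hx, hy]
  | of b x =>
    change DirectSum.component K ℕ X a (totalD d (DirectSum.lof K ℕ X b x)) =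
      d a (DirectSum.component K ℕ X (a + 1) (DirectSum.lof K ℕ X b x))
    rcases b with _ | b
    · rw [totalD_lof_zero, map_zero, DirectSum.component.of, dif_neg (by omega), map_zero]
    · rw [totalD_lof_succ]
      by_cases h : b = a
      · subst h
        rw [DirectSum.component.lof_self, DirectSum.component.lof_self]
      · rw [DirectSum.component.of, DirectSum.component.of, dif_neg h, dif_neg (by omega), map_zero]

theorem component_lmap (f : ∀ a, X a →ₗ[K] Y a) (a : ℕ) (x : DirectSum ℕ X) :
    DirectSum.component K ℕ Y a (DirectSum.lmap f x) = f a (DirectSum.component K ℕ X a x) := by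
  exact DFinsupp.mapRange_apply (fun a => f a) (fun a => map_zero (f a)) x a

theorem totalD_lof_component {d : ∀ a, X (a + 1) →ₗ[K] X a} {x : DirectSum ℕ X}
    (hx : totalD d x = 0) (a : ℕ) :
    totalD d (DirectSum.lof K ℕ X a (DirectSum.component K ℕ X a x)) = 0 := by
  rcases a with _ | a
  · exact totalD_lof_zero d _
  · rw [totalD_lof_succ, ← component_totalD, hx, map_zero, map_zero]

theorem exists_sum_lof_component (x : DirectSum ℕ X) :
    ∃ N, ∀ n, N ≤ n →
      ∑ a ∈ Finset.range n, DirectSum.lof K ℕ X a (DirectSum.component K ℕ X a x) = x :=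
  (totalGrading (K := K) (fun a => (0 : X (a + 1) →ₗ[K] X a))).exists_sum x

theorem lof_injective' (a : ℕ) : Function.Injective (DirectSum.lof K ℕ X a) :=
  Function.LeftInverse.injective (DirectSum.component.lof_self K a)

/-- Homology commutes with the sum over degrees. Cycles are expressed through `totalD`, so that
degree `0`, where every element is a cycle, needs no separate clause. -/
theorem isHomologyIso_totalD_iff (d : ∀ a, X (a + 1) →ₗ[K] X a) (d' : ∀ a, Y (a + 1) →ₗ[K] Y a)
    (f : ∀ a, X a →ₗ[K] Y a) :
    IsHomologyIso (totalD d) (totalD d') (DirectSum.lmap f) ↔ ∀ a,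
      (∀ x : X a, totalD d (DirectSum.lof K ℕ X a x) = 0 → ∀ y, f a x = d' a y →
        ∃ x', x = d a x') ∧
      (∀ y : Y a, totalD d' (DirectSum.lof K ℕ Y a y) = 0 →
        ∃ x : X a, totalD d (DirectSum.lof K ℕ X a x) = 0 ∧ ∃ y', y = f a x + d' a y') := by
  constructor
  · intro h a
    constructor
    · intro x hx y hy
      obtain ⟨x', hx'⟩ := h.inj _ hx (DirectSum.lof K ℕ Y (a + 1) y)
        (by rw [DirectSum.lmap_lof, totalD_lof_succ, hy])
      refine ⟨DirectSum.component K ℕ X (a + 1) x', ?_⟩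
      rw [← component_totalD, ← hx', DirectSum.component.lof_self]
    · intro y hy
      obtain ⟨x, hx, y', e⟩ := h.surj _ hy
      refine ⟨DirectSum.component K ℕ X a x, totalD_lof_component hx a,
        DirectSum.component K ℕ Y (a + 1) y', ?_⟩
      rw [← component_totalD, ← component_lmap, ← map_add, ← e, DirectSum.component.lof_self]
  · intro h
    constructor
    · intro x hx y hy
      obtain ⟨N, hN⟩ := exists_sum_lof_component (K := K) x
      choose z hz using fun a => (h a).1 (DirectSum.component K ℕ X a x)
        (totalD_lof_component hx a) (DirectSum.component K ℕ Y (a + 1) y)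
        (by rw [← component_lmap, hy, component_totalD])
      refine ⟨∑ a ∈ Finset.range N, DirectSum.lof K ℕ X (a + 1) (z a), ?_⟩
      rw [map_sum]
      conv_lhs => rw [← hN N le_rfl]
      refine Finset.sum_congr rfl (fun a _ => ?_)
      rw [totalD_lof_succ, ← hz]
    · intro y hy
      obtain ⟨N, hN⟩ := exists_sum_lof_component (K := K) y
      choose x hx z hz using fun a => (h a).2 (DirectSum.component K ℕ Y a y)
        (totalD_lof_component hy a)
      refine ⟨∑ a ∈ Finset.range N, DirectSum.lof K ℕ X a (x a), ?_,
        ∑ a ∈ Finset.range N, DirectSum.lof K ℕ Y (a + 1) (z a), ?_⟩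
      · rw [map_sum]
        exact Finset.sum_eq_zero (fun a _ => hx a)
      · rw [map_sum, map_sum, ← Finset.sum_add_distrib]
        conv_lhs => rw [← hN N le_rfl]
        refine Finset.sum_congr rfl (fun a _ => ?_)
        rw [totalD_lof_succ, DirectSum.lmap_lof, ← map_add, ← hz]

theorem ModuleCat.quasiIsoAt_iff {C D : ChainComplex (ModuleCat.{v} K) ℕ} (φ : C ⟶ D) (i j k : ℕ)
    (hi : (ComplexShape.down ℕ).prev j = i) (hk : (ComplexShape.down ℕ).next j = k) :
    QuasiIsoAt φ j ↔
      (∀ x : C.X j, C.d j k x = 0 → ∀ y : D.X i, φ.f j x = D.d i j y → ∃ x', x = C.d i j x') ∧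
      (∀ y : D.X j, D.d j k y = 0 →
        ∃ x : C.X j, C.d j k x = 0 ∧ ∃ y', y = φ.f j x + D.d i j y') := by
  rw [quasiIsoAt_iff' φ i j k hi hk]
  exact ModuleCat.shortComplex_quasiIso_iff _

/-- Both sides are compared degree by degree. Only degree `0` needs care: nothing lies below it, so
the outgoing differential vanishes by `shape`. -/
theorem quasiIso_ofHom_iff {d : ∀ a, X (a + 1) →ₗ[K] X a} {d' : ∀ a, Y (a + 1) →ₗ[K] Y a}
    {f : ∀ a, X a →ₗ[K] Y a}
    (hd : ∀ a, ModuleCat.ofHom (d (a + 1)) ≫ ModuleCat.ofHom (d a) = 0)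
    (hd' : ∀ a, ModuleCat.ofHom (d' (a + 1)) ≫ ModuleCat.ofHom (d' a) = 0)
    (φ : ChainComplex.of (fun a => ModuleCat.of K (X a)) (fun a => ModuleCat.ofHom (d a)) hd ⟶
      ChainComplex.of (fun a => ModuleCat.of K (Y a)) (fun a => ModuleCat.ofHom (d' a)) hd')
    (hφ : ∀ a, φ.f a = ModuleCat.ofHom (f a)) :
    QuasiIso φ ↔ IsHomologyIso (totalD d) (totalD d') (DirectSum.lmap f) := by
  let C := ChainComplex.of (fun a => ModuleCat.of K (X a)) (fun a => ModuleCat.ofHom (d a)) hd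
  let D := ChainComplex.of (fun a => ModuleCat.of K (Y a)) (fun a => ModuleCat.ofHom (d' a)) hd'
  have hC : ∀ a (x : X (a + 1)), C.d (a + 1) a x = d a x := fun a x =>
    ConcreteCategory.congr_hom (ChainComplex.of_d (fun a => ModuleCat.of K (X a)) (fun a => ModuleCat.ofHom (d a)) a) x
  have hD : ∀ a (y : Y (a + 1)), D.d (a + 1) a y = d' a y := fun a y =>
    ConcreteCategory.congr_hom (ChainComplex.of_d (fun a => ModuleCat.of K (Y a)) (fun a => ModuleCat.ofHom (d' a)) a) y
  have hφ' : ∀ a (x : X a), φ.f a x = f a x := fun a x => ConcreteCategory.congr_hom (hφ a) x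
  have hCz : ∀ a (x : X a), C.d a ((ComplexShape.down ℕ).next a) x = 0 ↔
      totalD d (DirectSum.lof K ℕ X a x) = 0 := fun a x => by
    rcases a with _ | a
    · rw [totalD_lof_zero, HomologicalComplex.shape C _ _ (by simp)]
      exact iff_of_true rfl rfl
    · rw [totalD_lof_succ, (DirectSum.lof K ℕ X a).map_eq_zero_iff (lof_injective' a),
        ChainComplex.next_nat_succ, ← hC]
  have hDz : ∀ a (y : Y a), D.d a ((ComplexShape.down ℕ).next a) y = 0 ↔
      totalD d' (DirectSum.lof K ℕ Y a y) = 0 := fun a y => by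
    rcases a with _ | a
    · rw [totalD_lof_zero, HomologicalComplex.shape D _ _ (by simp)]
      exact iff_of_true rfl rfl
    · rw [totalD_lof_succ, (DirectSum.lof K ℕ Y a).map_eq_zero_iff (lof_injective' a),
        ChainComplex.next_nat_succ, ← hD]
  rw [isHomologyIso_totalD_iff, quasiIso_iff]
  refine forall_congr' (fun a => ?_)
  rw [ModuleCat.quasiIsoAt_iff φ (a + 1) a _ (by simp) rfl]
  refine and_congr ⟨fun h x hx y hy => ?_, fun h x hx y hy => ?_⟩
    ⟨fun h y hy => ?_, fun h y hy => ?_⟩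
  · obtain ⟨x', hx'⟩ := h x ((hCz a x).2 hx) y ((hφ' a x).trans (hy.trans (hD a y).symm))
    exact ⟨x', hx'.trans (hC a x')⟩
  · obtain ⟨x', hx'⟩ := h x ((hCz a x).1 hx) y ((hφ' a x).symm.trans (hy.trans (hD a y)))
    exact ⟨x', hx'.trans (hC a x').symm⟩
  · obtain ⟨x, hx, y', e⟩ := h y ((hDz a y).2 hy)
    exact ⟨x, (hCz a x).1 hx, y', e.trans (congrArg₂ (· + ·) (hφ' a x) (hD a y'))⟩
  · obtain ⟨x, hx, y', e⟩ := h y ((hDz a y).1 hy)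
    exact ⟨x, (hCz a x).2 hx, y', e.trans (congrArg₂ (· + ·) (hφ' a x) (hD a y')).symm⟩

end Homology

/-! ### The induction on the arity. -/

section Comparison

open TensorProduct

variable {K : Type u} [CommRing K]

/-- As `C` is projective the sequence splits, and the middle term is `A × C`. -/
theorem Function.Exact.projective_middle {A B C : Type*} [AddCommGroup A] [Module K A]
    [AddCommGroup B] [Module K B] [AddCommGroup C] [Module K C] [Module.Projective K A]
    [Module.Projective K C] {i : A →ₗ[K] B} {p : B →ₗ[K] C} (h : Function.Exact i p)
    (hi : Function.Injective i) (hp : Function.Surjective p) : Module.Projective K B :=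
  have ⟨s, hs⟩ := Module.projective_lifting_property p LinearMap.id hp
  .of_equiv' (h.splitSurjectiveEquiv hi ⟨s, hs⟩).1.symm

theorem Module.Projective.pi_of_finite {ι : Type*} [Finite ι] {A : ι → Type*}
    [∀ j, AddCommGroup (A j)] [∀ j, Module K (A j)] [∀ j, Module.Projective K (A j)] :
    Module.Projective K (∀ j, A j) := by
  have := Fintype.ofFinite ι
  classical
  exact .of_equiv' (DFinsupp.linearEquivFunOnFintype (R := K) (M := A))

theorem decomp_eq_bot {P : GradedOperad.{u, v} K} {n : ℕ} {Φ : ℕ → Set (Fin n) → Prop}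
    (h : ∀ l C, ¬Φ l C) : P.decomp n Φ = ⊥ := by
  refine Submodule.span_eq_bot.2 ?_
  rintro z ⟨m, l, a, b, d, i, hk, hc, σ, p, q, hΦ, rfl⟩
  exact absurd hΦ (h _ _)

theorem not_meets_empty (n l : ℕ) (C : Set (Fin n)) : ¬Meets n ∅ l C := by
  rintro ⟨-, -, x, -, hx⟩
  exact hx

theorem not_meets_of_le {n : ℕ} (hn : n ≤ 2) (U : Set (Fin n)) (l : ℕ) (C : Set (Fin n)) :
    ¬Meets n U l C := by
  rintro ⟨h₁, h₂, -⟩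
  omega

/-- Descending induction on the set `U` in the condition `Meets n U`, along the filtration by the
arity of the second factor. -/
theorem meets_induction {n : ℕ} {C : (ℕ → Set (Fin n) → Prop) → Prop}
    (step : ∀ U u b, 2 ≤ b → b < n → C (MeetsAbove n U u b) → C (MeetsAbove n U u (b + 1)))
    (h : C (Meets n Set.univ)) (U : Set (Fin n)) : C (Meets n U) := by
  have h₁ : ∀ U u, C (Meets n (insert u U)) → C (Meets n U) := fun U u h₀ => by
    -- One input `u` is removed from the set by raising the bound from `0` to `n`.
    have h₂ : ∀ b, C (MeetsAbove n U u b) := fun b => by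
      induction b with
      | zero =>
        rw [meetsAbove_zero]
        exact h₀
      | succ b ih =>
        by_cases hb : b < 2 ∨ n ≤ b
        · rw [meetsAbove_succ n U u hb]
          exact ih
        · exact step U u b (by omega) (by omega) ih
    rw [← meetsAbove_of_le n U u le_rfl]
    exact h₂ n
  have h₂ : ∀ (S : Finset (Fin n)), C (Meets n (S ∪ U)) → C (Meets n U) := fun S => by
    induction S using Finset.induction_on with
    | empty => simp
    | insert a S _ ih =>
      intro h₃
      rw [Finset.coe_insert, Set.insert_union] at h₃
      exact ih (h₁ _ a h₃)
  refine h₂ Finset.univ ?_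
  rwa [Finset.coe_univ, Set.univ_union]

section BlockFactor

variable {P Q : GradedOperad.{u, v} K} {D : P.Differential} {D' : Q.Differential}
  {φ : GradedOperad.Hom P Q}

theorem GradedOperad.Hom.total_pr (φ : GradedOperad.Hom P Q) (D : P.Differential)
    (D' : Q.Differential) {n : ℕ} (a : ℕ) (x : P.Total n) :
    φ.total n ((D.grading n).pr a x) = (D'.grading n).pr a (φ.total n x) :=
  lmap_totalGrading_pr (φ.app n) a x

variable (hφ : ∀ n a x, φ.app n a (D.d n a x) = D'.d n a (φ.app n (a + 1) x))
include hφ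

theorem GradedOperad.Hom.total_d {n : ℕ} (x : P.Total n) :
    φ.total n (D.total n x) = D'.total n (φ.total n x) :=
  lmap_totalD (hφ n) x

theorem GradedOperad.Hom.block_d {m b n : ℕ} (i : Fin m) (hk : m + b = n + 1) {U : Set (Fin n)}
    {u : Fin n} (B : Blocks n b U u) (x : BlockFactor P i hk B) :
    φ.block i hk B (blockD i hk D B x) = blockD i hk D' B (φ.block i hk B x) := by
  induction x using BlockFactor.induction_on with
  | zero => simp
  | add x y hx hy => simp only [map_add, hx, hy]
  | tmul p q =>
    rw [blockD_tmul, map_add, GradedOperad.Hom.block_tmul, GradedOperad.Hom.block_tmul,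
      GradedOperad.Hom.block_tmul, blockD_tmul, φ.total_d hφ, φ.total_d hφ,
      DiffGrading.sgn_comm _ (D'.grading m) (φ.total_pr D D')]

theorem GradedOperad.Hom.piMap_block_d {m b n : ℕ} (i : Fin m) (hk : m + b = n + 1)
    {U : Set (Fin n)} {u : Fin n} (x : ∀ B : Blocks n b U u, BlockFactor P i hk B) :
    LinearMap.piMap (φ.block i hk) (LinearMap.piMap (blockD i hk D) x) =
      LinearMap.piMap (blockD i hk D') (LinearMap.piMap (φ.block i hk) x) :=
  funext (fun B => φ.block_d hφ i hk B (x B))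

end BlockFactor

section Projective

variable {M : GradedSigmaModule.{u, v} K}

/-- For `2 ≤ b < n` both factors of the kernel term have arity smaller than `n`, so it is projective
by hypothesis, and the sequence splits. -/
theorem projective_quot_step (hM : M.IsReduced) {n : ℕ}
    (ih : ∀ m < n, ∀ V : Set (Fin m), Module.Projective K
      ((freeOperad M).Total m ⧸ (freeOperad M).decomp m (Meets m V)))
    (ih' : ∀ m < n, Module.Projective K ((freeOperad M).Total m)) (U : Set (Fin n)) (u : Fin n)
    (b : ℕ) (hb : 2 ≤ b) (hbn : b < n)
    (h : Module.Projective K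
      ((freeOperad M).Total n ⧸ (freeOperad M).decomp n (MeetsAbove n U u b))) :
    Module.Projective K
      ((freeOperad M).Total n ⧸ (freeOperad M).decomp n (MeetsAbove n U u (b + 1))) := by
  -- Any input would do: the position of the inner operation is governed by the permutation attached
  -- to the block.
  let i : Fin (n + 1 - b) := ⟨0, by omega⟩
  have hk : n + 1 - b + b = n + 1 := by omega
  have h₁ : ∀ B : Blocks n b U u, Module.Projective K (BlockFactor (freeOperad M) i hk B) :=
    fun B => by
      have := ih (n + 1 - b) (by omega) (blockContract i hk B)
      have := ih' b hbn
      exact inferInstanceAs (Module.Projective K (_ ⊗[K] _))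
  have := Module.Projective.pi_of_finite (K := K)
    (A := fun B : Blocks n b U u => BlockFactor (freeOperad M) i hk B)
  exact (exact_blocksMap i hk hb (by omega)).projective_middle
    (blocksMap_injective i hk hM hb (by omega)) (Submodule.factor_surjective _)

end Projective

section QuasiIso

variable {M M' : GradedSigmaModule.{u, v} K} (hM : M.IsReduced) (hM' : M'.IsReduced)
  {D : (freeOperad M).Differential} {D' : (freeOperad M').Differential}
  {φ : GradedOperad.Hom (freeOperad M) (freeOperad M')}
  (hφ : ∀ n a x, φ.app n a (D.d n a x) = D'.d n a (φ.app n (a + 1) x))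
  [∀ n, Module.Projective K ((freeOperad M).Total n)]
  [∀ n, Module.Projective K ((freeOperad M').Total n)]
  [∀ n (V : Set (Fin n)), Module.Projective K
    ((freeOperad M).Total n ⧸ (freeOperad M).decomp n (Meets n V))]
  [∀ n (V : Set (Fin n)), Module.Projective K
    ((freeOperad M').Total n ⧸ (freeOperad M').decomp n (Meets n V))]

include hM hM' hφ

omit hM hM' in
theorem isHomologyIso_block {m b n : ℕ} (i : Fin m) (hk : m + b = n + 1) {U : Set (Fin n)}
    {u : Fin n} (B : Blocks n b U u)
    (h : ∀ V : Set (Fin m), IsHomologyIso (D.quot m (Meets m V)) (D'.quot m (Meets m V))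
      (φ.quot m (Meets m V)))
    (h' : IsHomologyIso (D.total b) (D'.total b) (φ.total b)) :
    IsHomologyIso (blockD i hk D B) (blockD i hk D' B) (φ.block i hk B) := by
  exact IsHomologyIso.tensor (D.quotGrading _ _) (D.grading b) (D'.quotGrading _ _) (D'.grading b)
      (D.quot_quot _ _) D.total_total (D'.quot_quot _ _) D'.total_total
      (φ.quot_pr D _ _ D') (φ.quot_d _ _ hφ) (φ.total_pr D D') (φ.total_d hφ) (h _) h'

/-- The kernel terms involve only the arities `n + 1 - b` and `b`, both smaller than `n`, so they
are already compared. The two forms of the five lemma give the two implications. -/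
theorem isHomologyIso_step {n : ℕ}
    (ih : ∀ m < n, ∀ V : Set (Fin m), IsHomologyIso (D.quot m (Meets m V)) (D'.quot m (Meets m V))
      (φ.quot m (Meets m V)))
    (ih' : ∀ m < n, IsHomologyIso (D.total m) (D'.total m) (φ.total m)) (U : Set (Fin n))
    (u : Fin n) (b : ℕ) (hb : 2 ≤ b) (hbn : b < n) :
    IsHomologyIso (D.quot n (MeetsAbove n U u b)) (D'.quot n (MeetsAbove n U u b))
        (φ.quot n (MeetsAbove n U u b)) ↔
      IsHomologyIso (D.quot n (MeetsAbove n U u (b + 1))) (D'.quot n (MeetsAbove n U u (b + 1)))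
        (φ.quot n (MeetsAbove n U u (b + 1))) := by
  let i : Fin (n + 1 - b) := ⟨0, by omega⟩
  have hk : n + 1 - b + b = n + 1 := by omega
  have hm : 2 ≤ n + 1 - b := by omega
  have h₁ : ∀ B : Blocks n b U u, IsHomologyIso (blockD i hk D B) (blockD i hk D' B)
      (φ.block i hk B) := fun B => isHomologyIso_block hφ i hk B (ih _ (by omega)) (ih' _ hbn)
  constructor
  · intro h
    exact .middle_of_exact (D.quot_quot _ _) (D'.quot_quot _ _) (blocksMap_injective i hk hM hb hm)
      (blocksMap_injective i hk hM' hb hm) (Submodule.factor_surjective _)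
      (Submodule.factor_surjective _) (exact_blocksMap i hk hb hm) (exact_blocksMap i hk hb hm)
      (blocksMap_d i hk hb D) (D.factor_quot _) (blocksMap_d i hk hb D') (D'.factor_quot _)
      (φ.piMap_block_d hφ i hk) (φ.quot_d _ _ hφ) (blocksMap_hom i hk hb φ) (φ.quot_factor _)
      (.pi h₁) h
  · intro h
    exact .right_of_exact (D.quot_quot _ _) (D'.quot_quot _ _) (blocksMap_injective i hk hM hb hm)
      (blocksMap_injective i hk hM' hb hm) (Submodule.factor_surjective _)
      (Submodule.factor_surjective _) (exact_blocksMap i hk hb hm) (exact_blocksMap i hk hb hm)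
      (blocksMap_d i hk hb D) (D.factor_quot _) (blocksMap_d i hk hb D') (D'.factor_quot _)
      (φ.piMap_block_d hφ i hk) (φ.quot_d _ _ hφ) (blocksMap_hom i hk hb φ) (φ.quot_factor _)
      (.pi h₁) h

omit hM hM' hφ [∀ n, Module.Projective K ((freeOperad M).Total n)]
  [∀ n, Module.Projective K ((freeOperad M').Total n)]
  [∀ n (V : Set (Fin n)), Module.Projective K
    ((freeOperad M).Total n ⧸ (freeOperad M).decomp n (Meets n V))]
  [∀ n (V : Set (Fin n)), Module.Projective K
    ((freeOperad M').Total n ⧸ (freeOperad M').decomp n (Meets n V))] in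
theorem isHomologyIso_quot_iff_total {n : ℕ} {Φ : ℕ → Set (Fin n) → Prop} (h : ∀ l C, ¬Φ l C) :
    IsHomologyIso (D.quot n Φ) (D'.quot n Φ) (φ.quot n Φ) ↔
      IsHomologyIso (D.total n) (D'.total n) (φ.total n) := by
  let e := Submodule.quotEquivOfEqBot _ (decomp_eq_bot (P := freeOperad M) h)
  let e' := Submodule.quotEquivOfEqBot _ (decomp_eq_bot (P := freeOperad M') h)
  exact ⟨.of_equiv e e' (fun x => by
      obtain ⟨x, rfl⟩ := Submodule.mkQ_surjective _ x
      rfl) (fun x => by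
      obtain ⟨x, rfl⟩ := Submodule.mkQ_surjective _ x
      rfl) (fun x => by
      obtain ⟨x, rfl⟩ := Submodule.mkQ_surjective _ x
      rfl), .of_equiv e.symm e'.symm (fun x => rfl) (fun x => rfl) (fun x => rfl)⟩

theorem isHomologyIso_meets_iff {n : ℕ}
    (ih : ∀ m < n, ∀ V : Set (Fin m), IsHomologyIso (D.quot m (Meets m V)) (D'.quot m (Meets m V))
      (φ.quot m (Meets m V))) (U : Set (Fin n)) :
    IsHomologyIso (D.quot n (Meets n U)) (D'.quot n (Meets n U)) (φ.quot n (Meets n U)) ↔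
      IsHomologyIso (D.quot n (Meets n Set.univ)) (D'.quot n (Meets n Set.univ))
        (φ.quot n (Meets n Set.univ)) :=
  meets_induction (C := fun Φ => IsHomologyIso (D.quot n Φ) (D'.quot n Φ) (φ.quot n Φ) ↔
      IsHomologyIso (D.quot n (Meets n Set.univ)) (D'.quot n (Meets n Set.univ))
        (φ.quot n (Meets n Set.univ)))
    (fun U u b hb hbn h => (isHomologyIso_step hM hM' hφ ih (fun m hm =>
      (isHomologyIso_quot_iff_total (not_meets_empty m)).1 (ih m hm ∅)) U u b hb hbn).symm.trans h)
    Iff.rfl U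

/-- Either hypothesis fixes, in each arity, one end of the chain of quotients: the empty set or the
set of all inputs. By strong induction on the arity the comparison then holds for every `V`, in
particular at the other end. -/
theorem isHomologyIso_total_iff :
    (∀ n, IsHomologyIso (D.total n) (D'.total n) (φ.total n)) ↔
      ∀ n, IsHomologyIso (D.quot n (Meets n Set.univ)) (D'.quot n (Meets n Set.univ))
        (φ.quot n (Meets n Set.univ)) := by
  constructor
  · intro h
    have key : ∀ n (V : Set (Fin n)), IsHomologyIso (D.quot n (Meets n V)) (D'.quot n (Meets n V))
        (φ.quot n (Meets n V)) := fun n => by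
      induction n using Nat.strong_induction_on with
      | _ n ih =>
        intro V
        -- Every `V` is equivalent to the set of all inputs, and this one to the empty set, where
        -- the quotient is the operad itself.
        rw [isHomologyIso_meets_iff hM hM' hφ ih, ← isHomologyIso_meets_iff hM hM' hφ ih ∅,
          isHomologyIso_quot_iff_total (not_meets_empty n)]
        exact h n
    exact fun n => key n _
  · intro h
    have key : ∀ n (V : Set (Fin n)), IsHomologyIso (D.quot n (Meets n V)) (D'.quot n (Meets n V))
        (φ.quot n (Meets n V)) := fun n => by
      induction n using Nat.strong_induction_on with
      | _ n ih => exact fun V => (isHomologyIso_meets_iff hM hM' hφ ih V).2 (h n)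
    exact fun n => (isHomologyIso_quot_iff_total (not_meets_empty n)).1 (key n ∅)

end QuasiIso

end Comparison

/-! ### Arities at most one, and the generators as a quotient of the operad. -/

section Generators

variable {K : Type u} [CommRing K]

theorem Module.projective_of_isField (h : IsField K) (N : Type*) [AddCommGroup N] [Module K N] :
    Module.Projective K N := by
  have : IsSimpleOrder (Ideal K) := Ring.isField_iff_isSimpleOrder_ideal.1 h
  have : IsSimpleModule K K := (isSimpleModule_iff K K).2 this
  exact Module.projective_of_isSemisimpleRing K N

section Low

variable {M : GradedSigmaModule.{u, v} K} (hM : M.IsReduced)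

include hM in
theorem freeOperad_arity_one_succ {d : ℕ} (p : (freeOperad M).X 1 (d + 1)) : p = 0 := by
  cases freeOperad_arity_one hM p
  rfl

include hM in
theorem freeOperad_arity_one_zero (p : (freeOperad M).X 1 0) :
    ∃ c : K, p = c • (freeOperad M).one := by
  cases freeOperad_arity_one hM p with
  | zero => exact ⟨0, (zero_smul K _).symm⟩
  | smul_one c => exact ⟨c, rfl⟩

/-- The unit component of the square zero extension detects `c`; hence `F(M)(1)` is free of rank one
when `M` is reduced. -/
theorem smul_one_eq_zero {c : K} (h : c • (freeOperad M).one = 0) : c = 0 := by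
  have h₁ := congrArg ((toSqZero M).app 1 0) h
  rw [map_smul, map_zero, (toSqZero M).map_one] at h₁
  have h₂ : c • (1 : K) = 0 :=
    congrArg (fun z : unitPart K 1 0 × M.X 1 0 => (z.1 : K)) h₁
  rwa [smul_eq_mul, mul_one] at h₂

include hM in
theorem projective_total_low {n : ℕ} (hn : n ≤ 1) :
    Module.Projective K ((freeOperad M).Total n) := by
  have h : ∀ d, Module.Projective K ((freeOperad M).X n d) := fun d => by
    rcases Nat.eq_zero_or_pos n with rfl | h₀
    · have : Subsingleton ((freeOperad M).X 0 d) := subsingleton_of_forall_eq 0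
        (fun p => freeOperad_arity_zero hM p)
      infer_instance
    obtain rfl : n = 1 := by omega
    rcases d with _ | d
    · refine Module.Projective.of_equiv' (LinearEquiv.ofBijective
        (LinearMap.toSpanSingleton K ((freeOperad M).X 1 0) (freeOperad M).one) ⟨?_, fun p => ?_⟩)
      · exact (injective_iff_map_eq_zero _).2 (fun c hc => smul_one_eq_zero hc)
      · obtain ⟨c, rfl⟩ := freeOperad_arity_one_zero hM p
        exact ⟨c, rfl⟩
    · have : Subsingleton ((freeOperad M).X 1 (d + 1)) := subsingleton_of_forall_eq 0
        (fun p => freeOperad_arity_one_succ hM p)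
      infer_instance
  exact Module.Projective.directSum

variable {M' : GradedSigmaModule.{u, v} K} (hM' : M'.IsReduced)
  {D : (freeOperad M).Differential} {D' : (freeOperad M').Differential}
  {φ : GradedOperad.Hom (freeOperad M) (freeOperad M')}

-- In arity `0` both sides are zero. In arity `1` both are `K`, generated by the unit, which `φ`
-- preserves.
include hM hM' in
theorem isHomologyIso_total_low {n : ℕ} (hn : n ≤ 1) :
    IsHomologyIso (D.total n) (D'.total n) (φ.total n) := by
  refine (isHomologyIso_totalD_iff (D.d n) (D'.d n) (φ.app n)).2 (fun a => ?_)
  rcases Nat.eq_zero_or_pos n with rfl | h₀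
  · refine ⟨fun x _ _ _ => ⟨0, ?_⟩, fun y _ => ⟨0, by rw [map_zero, map_zero], 0, ?_⟩⟩
    · rw [freeOperad_arity_zero hM x, map_zero]
    · rw [freeOperad_arity_zero hM' y, map_zero, map_zero, add_zero]
  obtain rfl : n = 1 := by omega
  rcases a with _ | a
  · refine ⟨fun x _ y hy => ⟨0, ?_⟩, fun y _ => ?_⟩
    · obtain ⟨c, rfl⟩ := freeOperad_arity_one_zero hM x
      rw [freeOperad_arity_one_succ hM' y, map_zero, map_smul, φ.map_one] at hy
      rw [smul_one_eq_zero hy, zero_smul, map_zero]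
    · obtain ⟨c, rfl⟩ := freeOperad_arity_one_zero hM' y
      refine ⟨c • (freeOperad M).one, totalD_lof_zero _ _, 0, ?_⟩
      rw [map_smul, φ.map_one, map_zero, add_zero]
  · refine ⟨fun x _ _ _ => ⟨0, ?_⟩, fun y _ => ⟨0, by rw [map_zero, map_zero], 0, ?_⟩⟩
    · rw [freeOperad_arity_one_succ hM x, map_zero]
    · rw [freeOperad_arity_one_succ hM' y, map_zero, map_zero, add_zero]

end Low

section High

variable {M : GradedSigmaModule.{u, v} K}

variable (M) in
/-- The inclusion of the generators on the sum of the components. -/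
noncomputable def totGen (n : ℕ) : M.Total n →ₗ[K] (freeOperad M).Total n :=
  DirectSum.lmap ((freeGen M).app n)

theorem totGen_tot {n d : ℕ} (x : M.X n d) :
    totGen M n (M.tot d x) = (freeOperad M).tot d ((freeGen M).app n d x) :=
  DirectSum.lmap_lof _ _ _

/-- The augmentation ideal vanishes in arities at most one, so both factors of a nonzero
decomposable composite have arity at least two. -/
theorem tot_mem_decomp_of_decomposable (hM : M.IsReduced) {n d : ℕ} {z : (freeOperad M).X n d}
    (hz : z ∈ decomposables M n d) :
    (freeOperad M).tot d z ∈ (freeOperad M).decomp n (Meets n Set.univ) := by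
  induction hz using Submodule.span_induction with
  | zero => simp
  | add x y _ _ hx hy =>
    rw [map_add]
    exact Submodule.add_mem _ hx hy
  | smul c x _ hx =>
    rw [map_smul]
    exact Submodule.smul_mem _ c hx
  | mem z h =>
    obtain ⟨m, l, a, b, i, hk, hc, σ, p, hp, q, hq, rfl⟩ := h
    rcases Nat.lt_or_ge 1 m with hm | hm
    · rcases Nat.lt_or_ge 1 l with hl | hl
      · exact GradedOperad.tot_mem_decomp i hk hc σ p q
          ⟨hl, by omega, _, ⟨⟨0, by omega⟩, rfl⟩, trivial⟩
      · rw [augIdeal_low hM hl hq]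
        simp
    · rw [augIdeal_low hM hm hp]
      simp

variable (M) in
/-- The projection of the free operad onto the generators. -/
noncomputable def totProj (n : ℕ) : (freeOperad M).Total n →ₗ[K] M.Total n :=
  DirectSum.lmap (fun d => LinearMap.snd K _ (M.X n d) ∘ₗ (toSqZero M).app n d)

theorem totProj_tot {n d : ℕ} (p : (freeOperad M).X n d) :
    totProj M n ((freeOperad M).tot d p) = M.tot d ((toSqZero M).app n d p).2 :=
  DirectSum.lmap_lof _ _ _

theorem decomp_le_ker_totProj (n : ℕ) :
    (freeOperad M).decomp n (Meets n Set.univ) ≤ LinearMap.ker (totProj M n) := by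
  refine Submodule.span_le.2 ?_
  rintro z ⟨m, l, a, b, d, i, hk, hc, σ, p, q, ⟨hl, hln, -⟩, rfl⟩
  rw [SetLike.mem_coe, LinearMap.mem_ker, totProj_tot, toSqZero_decomposables, map_zero]
  exact act_mem_decomposables σ (circ_mem_decomposables i hk hc (augIdeal_high (by omega) p)
    (augIdeal_high hl q))

theorem totProj_totGen {n : ℕ} (x : M.Total n) : totProj M n (totGen M n x) = x := by
  induction x using M.tot_induction with
  | zero => simp
  | add x y hx hy => rw [map_add, map_add, hx, hy]
  | tot d x => rw [totGen_tot, totProj_tot, toSqZero_gen]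

/-- Injective because the projection to the square zero extension kills decomposables; surjective
because in arity at least two everything is in the augmentation ideal, hence a generator plus a
decomposable. -/
theorem mkQ_totGen_bijective (hM : M.IsReduced) {n : ℕ} (hn : 2 ≤ n) :
    Function.Bijective
      (((freeOperad M).decomp n (Meets n Set.univ)).mkQ ∘ₗ totGen M n) := by
  constructor
  · exact Function.LeftInverse.injective
      (g := Submodule.liftQ _ (totProj M n) (decomp_le_ker_totProj n)) totProj_totGen
  · intro y
    obtain ⟨y, rfl⟩ := Submodule.mkQ_surjective _ y
    induction y using (freeOperad M).tot_induction with
    | zero => exact ⟨0, by rw [map_zero, map_zero]⟩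
    | add x y hx hy =>
      obtain ⟨x', hx⟩ := hx
      obtain ⟨y', hy⟩ := hy
      exact ⟨x' + y', by rw [map_add, map_add, hx, hy]⟩
    | tot d p =>
      obtain ⟨_, ⟨x, rfl⟩, z, hz, rfl⟩ := Submodule.mem_sup.1 (augIdeal_le (augIdeal_high hn p))
      refine ⟨M.tot d x, (Submodule.Quotient.eq _).2 ?_⟩
      rw [totGen_tot, map_add, sub_add_cancel_left]
      exact Submodule.neg_mem _ (tot_mem_decomp_of_decomposable hM hz)

/-- The identification of the generators with the quotient of the free operad by the
decomposables. -/
noncomputable def genQuotEquiv (hM : M.IsReduced) {n : ℕ} (hn : 2 ≤ n) :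
    M.Total n ≃ₗ[K] (freeOperad M).Total n ⧸ (freeOperad M).decomp n (Meets n Set.univ) :=
  LinearEquiv.ofBijective _ (mkQ_totGen_bijective hM hn)

theorem genQuotEquiv_tot (hM : M.IsReduced) {n d : ℕ} (hn : 2 ≤ n) (x : M.X n d) :
    genQuotEquiv hM hn (M.tot d x) = ((freeOperad M).decomp n (Meets n Set.univ)).mkQ
      ((freeOperad M).tot d ((freeGen M).app n d x)) :=
  congrArg (Submodule.mkQ _) (totGen_tot x)

theorem genD_genD (hM : M.IsReduced) (D : (freeOperad M).Differential) (n a : ℕ)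
    (x : M.X n (a + 1 + 1)) : genD hM D n a (genD hM D n (a + 1) x) = 0 := by
  simp [genD, indecD_indecD]

/-- The defining equation of `genD` in the indecomposable quotient, lifted to the free operad. -/
theorem gen_genD_sub_mem (hM : M.IsReduced) (D : (freeOperad M).Differential) (n a : ℕ)
    (x : M.X n (a + 1)) : (freeGen M).app n a (genD hM D n a x) -
      D.d n a ((freeGen M).app n (a + 1) x) ∈ decomposables M n a := by
  have h : indecEquiv M n a (genD hM D n a x) = indecD hM D n a (indecEquiv M n (a + 1) x) :=
    (indecEquiv M n a).apply_symm_apply _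
  exact (Submodule.Quotient.eq ((decomposables M n a).submoduleOf (augIdeal M n a))).1 h

variable {M' : GradedSigmaModule.{u, v} K}

theorem gen_genMap_sub_mem (φ : GradedOperad.Hom (freeOperad M) (freeOperad M'))
    (hφ : PreservesAug φ) (n a : ℕ) (x : M.X n a) :
    (freeGen M').app n a (genMap φ hφ n a x) - φ.app n a ((freeGen M).app n a x) ∈
      decomposables M' n a := by
  have h : indecEquiv M' n a (genMap φ hφ n a x) = indecMap φ hφ n a (indecEquiv M n a x) :=
    (indecEquiv M' n a).apply_symm_apply _
  exact (Submodule.Quotient.eq ((decomposables M' n a).submoduleOf (augIdeal M' n a))).1 h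

theorem genQuotEquiv_totalD (hM : M.IsReduced) (D : (freeOperad M).Differential) {n : ℕ}
    (hn : 2 ≤ n) (x : M.Total n) :
    genQuotEquiv hM hn (totalD (genD hM D n) x) = D.quot n _ (genQuotEquiv hM hn x) := by
  induction x using M.tot_induction with
  | zero => simp
  | add x y hx hy => simp only [map_add, hx, hy]
  | tot a x =>
    rw [genQuotEquiv_tot, D.quot_mkQ]
    rcases a with _ | a
    · rw [D.total_tot_zero, map_zero, GradedSigmaModule.tot, totalD_lof_zero, map_zero]
    · rw [D.total_tot_succ, GradedSigmaModule.tot, totalD_lof_succ]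
      rw [← GradedSigmaModule.tot, genQuotEquiv_tot]
      refine (Submodule.Quotient.eq _).2 ?_
      rw [← map_sub]
      exact tot_mem_decomp_of_decomposable hM (gen_genD_sub_mem hM D n a x)

theorem genQuotEquiv_lmap (hM : M.IsReduced) (hM' : M'.IsReduced)
    (φ : GradedOperad.Hom (freeOperad M) (freeOperad M')) (hφ : PreservesAug φ) {n : ℕ}
    (hn : 2 ≤ n) (x : M.Total n) :
    genQuotEquiv hM' hn (DirectSum.lmap (genMap φ hφ n) x) =
      φ.quot n _ (genQuotEquiv hM hn x) := by
  induction x using M.tot_induction with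
  | zero => simp
  | add x y hx hy => simp only [map_add, hx, hy]
  | tot a x =>
    rw [genQuotEquiv_tot, φ.quot_mkQ, φ.total_tot, GradedSigmaModule.tot, DirectSum.lmap_lof,
      ← GradedSigmaModule.tot, genQuotEquiv_tot]
    refine (Submodule.Quotient.eq _).2 ?_
    rw [← map_sub]
    exact tot_mem_decomp_of_decomposable hM' (gen_genMap_sub_mem φ hφ n a x)

theorem isHomologyIso_genMap_iff (hM : M.IsReduced) (hM' : M'.IsReduced)
    (D : (freeOperad M).Differential) (D' : (freeOperad M').Differential)
    (φ : GradedOperad.Hom (freeOperad M) (freeOperad M')) (hφ : PreservesAug φ) (n : ℕ) :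
    IsHomologyIso (D.quot n (Meets n Set.univ)) (D'.quot n (Meets n Set.univ))
        (φ.quot n (Meets n Set.univ)) ↔
      IsHomologyIso (totalD (genD hM D n)) (totalD (genD hM' D' n))
        (DirectSum.lmap (genMap φ hφ n)) := by
  rcases Nat.lt_or_ge 1 n with hn | hn
  · let e := genQuotEquiv hM hn
    let e' := genQuotEquiv hM' hn
    have h₁ : ∀ x, e (totalD (genD hM D n) x) = D.quot n _ (e x) := genQuotEquiv_totalD hM D hn
    have h₂ : ∀ x, e' (totalD (genD hM' D' n) x) = D'.quot n _ (e' x) :=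
      genQuotEquiv_totalD hM' D' hn
    have h₃ : ∀ x, e' (DirectSum.lmap (genMap φ hφ n) x) = φ.quot n _ (e x) :=
      genQuotEquiv_lmap hM hM' φ hφ hn
    refine ⟨.of_equiv e.symm e'.symm (fun x => ?_) (fun x => ?_) (fun x => ?_),
      .of_equiv e e' h₁ h₂ h₃⟩
    · rw [LinearEquiv.symm_apply_eq, h₁, LinearEquiv.apply_symm_apply]
    · rw [LinearEquiv.symm_apply_eq, h₂, LinearEquiv.apply_symm_apply]
    · rw [LinearEquiv.symm_apply_eq, h₃, LinearEquiv.apply_symm_apply]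
  · refine iff_of_true ((isHomologyIso_quot_iff_total (not_meets_of_le (by omega) _)).2
      (isHomologyIso_total_low hM hM' hn)) ((isHomologyIso_totalD_iff _ _ _).2 (fun a => ?_))
    have h₁ : ∀ {N : GradedSigmaModule.{u, v} K}, N.IsReduced → ∀ d, Subsingleton (N.X n d) :=
      fun hN d => by
        rcases Nat.eq_zero_or_pos n with rfl | h₀
        · exact hN.arity_zero d
        · obtain rfl : n = 1 := by omega
          exact hN.arity_one d
    have h₂ := h₁ hM
    have h₃ := h₁ hM'
    exact ⟨fun x _ _ _ => ⟨0, Subsingleton.elim _ _⟩,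
      fun y _ => ⟨0, by rw [map_zero, map_zero], 0, Subsingleton.elim _ _⟩⟩

/-- Strong induction on the arity, starting in each arity from the full set of inputs: there the
quotient is `M(n)` for `n ≥ 2`, and the free operad itself for `n ≤ 1`. -/
theorem projective_quot (hM : M.IsReduced) (h : ∀ n d, Module.Projective K (M.X n d)) (n : ℕ)
    (U : Set (Fin n)) : Module.Projective K
      ((freeOperad M).Total n ⧸ (freeOperad M).decomp n (Meets n U)) := by
  induction n using Nat.strong_induction_on with
  | _ n ih =>
    have h₀ : Module.Projective K
        ((freeOperad M).Total n ⧸ (freeOperad M).decomp n (Meets n Set.univ)) := by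
      rcases Nat.lt_or_ge 1 n with hn | hn
      · have : Module.Projective K (M.Total n) := Module.Projective.directSum
        exact .of_equiv' (genQuotEquiv hM hn)
      · have := projective_total_low hM hn
        exact .of_equiv' (Submodule.quotEquivOfEqBot _
          (decomp_eq_bot (not_meets_of_le (by omega) _))).symm
    refine meets_induction (C := fun Φ => Module.Projective K
      ((freeOperad M).Total n ⧸ (freeOperad M).decomp n Φ)) (fun V u b hb hbn hV => ?_) h₀ U
    refine projective_quot_step hM ih (fun m hm => ?_) V u b hb hbn hV
    have := ih m hm ∅
    exact .of_equiv' (Submodule.quotEquivOfEqBot _ (decomp_eq_bot (not_meets_empty m)))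

theorem projective_total (hM : M.IsReduced) (h : ∀ n d, Module.Projective K (M.X n d)) (n : ℕ) :
    Module.Projective K ((freeOperad M).Total n) :=
  have := projective_quot hM h n ∅
  .of_equiv' (Submodule.quotEquivOfEqBot _ (decomp_eq_bot (not_meets_empty n)))

end High

end Generators

/-! ### The theorem. -/

theorem mainTheorem9 {K : Type u} [CommRing K] (M M' : GradedSigmaModule.{u, v} K)
    (hM : M.IsReduced) (hM' : M'.IsReduced)
    (hproj : ¬ IsField K →
      (∀ n d, Module.Projective K (M.X n d)) ∧ (∀ n d, Module.Projective K (M'.X n d)))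
    (D : (freeOperad M).Differential) (D' : (freeOperad M').Differential)
    (φ : DGOperad.Hom (quasiFree M D) (quasiFree M' D')) (hφ : PreservesAug φ.toOperadHom) :
    φ.IsQuasiIso ↔ ∀ n, QuasiIso (genChainMap hM hM' φ hφ n) := by
  -- Over a field every module is projective, so both cases of the hypothesis reduce to the
  -- projective one.
  have h : (∀ n d, Module.Projective K (M.X n d)) ∧ ∀ n d, Module.Projective K (M'.X n d) := by
    by_cases hK : IsField K
    · exact ⟨fun n d => Module.projective_of_isField hK _,
        fun n d => Module.projective_of_isField hK _⟩
    · exact hproj hK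
  have h₁ := projective_quot hM h.1
  have h₂ := projective_quot hM' h.2
  have h₃ := projective_total hM h.1
  have h₄ := projective_total hM' h.2
  have h₅ : ∀ n, QuasiIso (φ.chainMap n) ↔
      IsHomologyIso (D.total n) (D'.total n) (φ.toOperadHom.total n) := fun n =>
    quasiIso_ofHom_iff (d := D.d n) (d' := D'.d n) (f := φ.app n)
      (fun a => ModuleCat.hom_ext (LinearMap.ext (D.d_d n a)))
      (fun a => ModuleCat.hom_ext (LinearMap.ext (D'.d_d n a))) (φ.chainMap n)
      (fun a => rfl)
  have h₆ : ∀ n, QuasiIso (genChainMap hM hM' φ hφ n) ↔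
      IsHomologyIso (totalD (genD hM D n)) (totalD (genD hM' D' n))
        (DirectSum.lmap (genMap φ.toOperadHom hφ n)) := fun n =>
    quasiIso_ofHom_iff (d := genD hM D n) (d' := genD hM' D' n)
      (f := genMap φ.toOperadHom hφ n)
      (fun a => ModuleCat.hom_ext (LinearMap.ext (genD_genD hM D n a)))
      (fun a => ModuleCat.hom_ext (LinearMap.ext (genD_genD hM' D' n a))) (genChainMap hM hM' φ hφ n) (fun a => rfl)
  have h₇ := isHomologyIso_total_iff hM hM' (φ := φ.toOperadHom) (D := D) (D' := D') φ.map_d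
  rw [DGOperad.Hom.IsQuasiIso, forall_congr' h₅, forall_congr' h₆]
  exact h₇.trans (forall_congr' (isHomologyIso_genMap_iff hM hM' D D' φ.toOperadHom hφ))
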